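/- Let $M$ be a unital $C^*$-algebra with a tracial state $\varphi$ (for example, a von Neumann algebra with a normal tracial state), and let $X=(x_1,\dots,x_n)$ be self-adjoint elements of $M$. For $m,k\in\mathbb N$ and $\gamma>0$ let $\Gamma(X;m,k,\gamma)$ be the set of $n$-tuples $(a_1,\dots,a_n)$ of self-adjoint complex $k\times k$ matrices with $|tr_k(a_{i_1}\cdots a_{i_p})-\varphi(x_{i_1}\cdots x_{i_p})|<\gamma$ for all $1\le p\le m$ and $1\le i_1,\dots,i_p\le n$, where $tr_k=\frac1k Tr$; for $R>0$ let $\Gamma_R(X;m,k,\gamma)$ be the subset of those tuples with all operator norms $\|a_j\|\le R$. These sets carry the metric of $|a|_2=(\sum_j tr_k(a_j^2))^{1/2}$. For a metric space $\Omega$ let $P_\epsilon(\Omega)$ be the maximal number of mutually disjoint open $\epsilon$-balls of $\Omega$, and $K_\epsilon(\Omega)$ the minimal number of open $\epsilon$-balls of $\Omega$ that cover $\Omega$. With $\log 0=-\infty$ put \[ \mathbb P_{\epsilon,R}(X)=\inf_{m\in\mathbb N,\gamma>0}\ \limsup_{k\to\infty}k^{-2}\log P_\epsilon(\Gamma_R(X;m,k,\gamma)),\qquad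 \mathbb P_\epsilon(X)=\sup_{R>0}\mathbb P_{\epsilon,R}(X), \] \[ \mathbb P_{\epsilon,\infty}(X)=\inf_{m\in\mathbb N,\gamma>0}\ \limsup_{k\to\infty}k^{-2}\log P_\epsilon(\Gamma(X;m,k,\gamma)), \] and define $\mathbb K_{\epsilon}(X)$ and $\mathbb K_{\epsilon,\infty}(X)$ in the same way with $K_\epsilon$ in place of $P_\epsilon$. Let \[ \delta_0(X)=n+\limsup_{\epsilon\to0}\frac{\chi(x_1+\epsilon s_1,\dots,x_n+\epsilon s_n:s_1,\dots,s_n)}{|\log\epsilon|} \] be Voiculescu's modified free entropy dimension, where $s_1,\dots,s_n$ is a standard semicircular family free from $X$, in $M$ or in any unital $C^*$-algebra with a tracial state that receives a trace-preserving unital $*$-homomorphism from $M$. Here, for self-adjoint tuples $Y=(y_1,\dots,y_n)$ and $Z$, \[ \chi(Y:Z)=\sup_{R>0}\ \inf_{m\in\mathbb N,\gamma>0}\ \limsup_{k\to\infty}\Big(k^{-2}\log \mathrm{vol}\,\Gamma_R(Y:Z;m,k,\gamma)+\frac n2\log k\Big), \] where $\Gamma_R(Y:Z;m,k,\gamma)$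 is the projection of $\Gamma_R(Y,Z;m,k,\gamma)$ to the coordinates of $Y$, and $\mathrm{vol}$ is Lebesgue measure for the inner product $\sum_j Tr(a_jb_j)$. Then, as elements of $[-\infty,\infty]$, \[ \delta_0(X)=\limsup_{\epsilon\to0}\frac{\mathbb P_{\epsilon,\infty}(X)}{|\log\epsilon|}=\limsup_{\epsilon\to0}\frac{\mathbb K_{\epsilon,\infty}(X)}{|\log\epsilon|}=\limsup_{\epsilon\to0}\frac{\mathbb P_{\epsilon}(X)}{|\log\epsilon|}=\limsup_{\epsilon\to0}\frac{\mathbb K_{\epsilon}(X)}{|\log\epsilon|}. \] -/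

import Mathlib

open Filter Topology MeasureTheory
open scoped ENNReal ComplexOrder

noncomputable section

namespace FreeEntropy

/-! ### Tracial states, freeness, semicircular families -/

/-- A tracial state on a unital complex `*`-algebra. -/
structure IsTracialState {M : Type*} [Ring M] [StarRing M] [Algebra ℂ M]
    (φ : M →ₗ[ℂ] ℂ) : Prop where
  map_one : φ 1 = 1
  nonneg : ∀ a, 0 ≤ φ (star a * a)
  tracial : ∀ a b, φ (a * b) = φ (b * a)

/-- Voiculescu's freeness of a family of unital subalgebras with respect to `φ`: a product of
`φ`-centred elements, neighbouring factors of which come from different subalgebras, is itself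
`φ`-centred. -/
def IsFreeFamily {M I : Type*} [Ring M] [Algebra ℂ M] (φ : M →ₗ[ℂ] ℂ)
    (A : I → Subalgebra ℂ M) : Prop :=
  ∀ (p : ℕ) (i : Fin (p + 1) → I) (a : Fin (p + 1) → M),
    (∀ j : Fin p, i j.castSucc ≠ i j.succ) →
    (∀ j, a j ∈ A (i j)) → (∀ j, φ (a j) = 0) →
    φ (List.ofFn a).prod = 0

/-- A self-adjoint element whose distribution is the standard (centred, variance one) semicircle
law, of density `√(4 - t ^ 2) / (2 π)` on `[-2, 2]`. The distribution of a bounded self-adjoint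
element is determined by its moments. -/
def IsSemicircular {M : Type*} [Ring M] [StarRing M] [Algebra ℂ M] (φ : M →ₗ[ℂ] ℂ)
    (s : M) : Prop :=
  IsSelfAdjoint s ∧ ∀ p : ℕ,
    φ (s ^ p) = (((2 * Real.pi)⁻¹ * ∫ t in (-2 : ℝ)..2, t ^ p * √(4 - t ^ 2) : ℝ) : ℂ)

/-- A (standard) semicircular family: a free family of semicircular elements. -/
def IsSemicircularFamily {M I : Type*} [Ring M] [StarRing M] [Algebra ℂ M] (φ : M →ₗ[ℂ] ℂ)
    (s : I → M) : Prop :=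
  (∀ i, IsSemicircular φ (s i)) ∧ IsFreeFamily φ fun i => Algebra.adjoin ℂ {s i}

/-- Two tuples (of self-adjoint elements) are free from each other with respect to `φ`: the
unital algebras that they generate are free. -/
def AreFree {M I J : Type*} [Ring M] [Algebra ℂ M] (φ : M →ₗ[ℂ] ℂ)
    (x : I → M) (y : J → M) : Prop :=
  IsFreeFamily φ ![Algebra.adjoin ℂ (Set.range x), Algebra.adjoin ℂ (Set.range y)]

/-! ### Microstates -/

/-- The normalized trace `tr_k` of a `k × k` matrix. -/
def normTrace {k : ℕ} (A : Matrix (Fin k) (Fin k) ℂ) : ℂ := (k : ℂ)⁻¹ * A.trace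

/-- The operator norm of a matrix, acting on the Euclidean space `ℂ ^ k`. -/
def opNorm {k : ℕ} (A : Matrix (Fin k) (Fin k) ℂ) : ℝ := ‖Matrix.toEuclideanCLM (𝕜 := ℂ) A‖

/-- The `|·|₂`-distance `(∑ j, tr_k ((A j - B j) ^ 2)) ^ (1/2)` between two tuples of
self-adjoint matrices. -/
def dist₂ {I : Type*} [Fintype I] {k : ℕ} (A B : I → Matrix (Fin k) (Fin k) ℂ) : ℝ :=
  √(∑ j, (normTrace ((A j - B j) ^ 2)).re)

variable {M : Type*} [Ring M] [Algebra ℂ M]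

/-- The microstate space `Γ(x; m, k, γ)` without bound on operator norms: tuples of self-adjoint
`k × k` matrices whose mixed moments of order `1, …, m` approximate those of `x` up to `γ`. -/
def microstates {I : Type*} (φ : M →ₗ[ℂ] ℂ) (x : I → M) (m k : ℕ) (γ : ℝ) :
    Set (I → Matrix (Fin k) (Fin k) ℂ) :=
  {A | (∀ j, (A j).IsHermitian) ∧ ∀ p : ℕ, 1 ≤ p → p ≤ m → ∀ i : Fin p → I,
    ‖normTrace (List.ofFn fun j => A (i j)).prod - φ (List.ofFn fun j => x (i j)).prod‖ < γ}

/-- The microstate space `Γ_R(x; m, k, γ)` with operator norm cutoff `R`. -/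
def microstatesCutoff {I : Type*} (φ : M →ₗ[ℂ] ℂ) (x : I → M) (R : ℝ) (m k : ℕ) (γ : ℝ) :
    Set (I → Matrix (Fin k) (Fin k) ℂ) :=
  {A | A ∈ microstates φ x m k γ ∧ ∀ j, opNorm (A j) ≤ R}

/-! ### Packing and covering numbers -/

/-- The open `ε`-ball about `a` in the space `S` with distance function `d`. -/
def ballIn {α : Type*} (d : α → α → ℝ) (S : Set α) (ε : ℝ) (a : α) : Set α :=
  {b | b ∈ S ∧ d a b < ε}

/-- `P_ε(S)`: the maximal number of mutually disjoint open `ε`-balls of the space `S`. -/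
def packingNumber {α : Type*} (d : α → α → ℝ) (S : Set α) (ε : ℝ) : ℕ∞ :=
  ⨆ (T : Set α) (_ : T ⊆ S) (_ : T.PairwiseDisjoint (ballIn d S ε)), T.encard

/-- `K_ε(S)`: the minimal number of open `ε`-balls of the space `S` that cover `S`. -/
def coveringNumber {α : Type*} (d : α → α → ℝ) (S : Set α) (ε : ℝ) : ℕ∞ :=
  ⨅ (T : Set α) (_ : T ⊆ S) (_ : S ⊆ ⋃ a ∈ T, ballIn d S ε a), T.encard

/-- `limsup_{k → ∞} k⁻² log (N k)`, with `log 0 = -∞` and `log ∞ = ∞`. -/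
def growthRate (N : ℕ → ℕ∞) : EReal :=
  limsup (fun k : ℕ => ((((k : ℝ) ^ 2)⁻¹ : ℝ) : EReal) * ENNReal.log (N k : ℝ≥0∞)) atTop

section Numbers

variable {I : Type*} [Fintype I] (φ : M →ₗ[ℂ] ℂ) (x : I → M)

/-- `ℙ_{ε,R}(x)`. -/
def packingCutoff (R ε : ℝ) : EReal :=
  ⨅ (m : ℕ) (γ : ℝ) (_ : 0 < γ),
    growthRate fun k => packingNumber dist₂ (microstatesCutoff φ x R m k γ) ε

/-- `𝕂_{ε,R}(x)`. -/
def coveringCutoff (R ε : ℝ) : EReal :=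
  ⨅ (m : ℕ) (γ : ℝ) (_ : 0 < γ),
    growthRate fun k => coveringNumber dist₂ (microstatesCutoff φ x R m k γ) ε

/-- `ℙ_ε(x) = sup_{R > 0} ℙ_{ε,R}(x)`. -/
def packing (ε : ℝ) : EReal := ⨆ (R : ℝ) (_ : 0 < R), packingCutoff φ x R ε

/-- `𝕂_ε(x) = sup_{R > 0} 𝕂_{ε,R}(x)`. -/
def covering (ε : ℝ) : EReal := ⨆ (R : ℝ) (_ : 0 < R), coveringCutoff φ x R ε

/-- `ℙ_{ε,∞}(x)`, from the microstate spaces without cutoff. -/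
def packingInfty (ε : ℝ) : EReal :=
  ⨅ (m : ℕ) (γ : ℝ) (_ : 0 < γ),
    growthRate fun k => packingNumber dist₂ (microstates φ x m k γ) ε

/-- `𝕂_{ε,∞}(x)`, from the microstate spaces without cutoff. -/
def coveringInfty (ε : ℝ) : EReal :=
  ⨅ (m : ℕ) (γ : ℝ) (_ : 0 < γ),
    growthRate fun k => coveringNumber dist₂ (microstates φ x m k γ) ε

end Numbers

/-- `limsup_{ε → 0+} f(ε) / |log ε|`. -/
def limsupDivLog (f : ℝ → EReal) : EReal :=
  limsup (fun ε : ℝ => f ε / ((|Real.log ε| : ℝ) : EReal)) (𝓝[>] 0)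

/-! ### Free entropy and Voiculescu's modified free entropy dimension -/

/-- The self-adjoint matrix with given real coordinates in the basis of `M_k^sa(ℂ)` that consists
of `E_ii`, `(E_ij + E_ji) / √2` and `√-1 (E_ij - E_ji) / √2` for `i < j`; this basis is orthonormal
for the inner product `Tr(A B)`. -/
def hermitianOfCoords {k : ℕ} (v : Fin k → Fin k → ℝ) : Matrix (Fin k) (Fin k) ℂ :=
  Matrix.of fun i j =>
    if i = j then (v i i : ℂ)
    else if i < j then ((v i j : ℂ) + Complex.I * (v j i : ℂ)) / ((√2 : ℝ) : ℂ)
    else ((v j i : ℂ) - Complex.I * (v i j : ℂ)) / ((√2 : ℝ) : ℂ)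

/-- Lebesgue measure of a set of tuples of self-adjoint matrices, for the Euclidean structure
`∑ j, Tr(A j * B j)` (non-normalized trace) on `(M_k^sa(ℂ))^I`. -/
def saVolume {I : Type*} [Fintype I] {k : ℕ} (S : Set (I → Matrix (Fin k) (Fin k) ℂ)) : ℝ≥0∞ :=
  volume {v : I → Fin k → Fin k → ℝ | (fun j => hermitianOfCoords (v j)) ∈ S}

/-- `Γ_R(x : y; m, k, γ)`, the microstates of `x` in the presence of `y`: the projection of
`Γ_R(x, y; m, k, γ)` to the coordinates of `x`. -/
def microstatesPresence {I J : Type*} (φ : M →ₗ[ℂ] ℂ) (x : I → M) (y : J → M)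
    (R : ℝ) (m k : ℕ) (γ : ℝ) : Set (I → Matrix (Fin k) (Fin k) ℂ) :=
  (fun (A : I ⊕ J → Matrix (Fin k) (Fin k) ℂ) (i : I) => A (Sum.inl i)) ''
    microstatesCutoff φ (Sum.elim x y) R m k γ

/-- `χ_R(x : y; m, γ)`. -/
def chiAux {I J : Type*} [Fintype I] (φ : M →ₗ[ℂ] ℂ) (x : I → M) (y : J → M)
    (R : ℝ) (m : ℕ) (γ : ℝ) : EReal :=
  limsup (fun k : ℕ =>
    ((((k : ℝ) ^ 2)⁻¹ : ℝ) : EReal) *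
        ENNReal.log (saVolume (microstatesPresence φ x y R m k γ)) +
      (((Fintype.card I : ℝ) / 2 * Real.log k : ℝ) : EReal)) atTop

/-- Voiculescu's free entropy `χ(x : y)` of `x` in the presence of `y`. -/
def chi {I J : Type*} [Fintype I] (φ : M →ₗ[ℂ] ℂ) (x : I → M) (y : J → M) : EReal :=
  ⨆ (R : ℝ) (_ : 0 < R), ⨅ (m : ℕ) (γ : ℝ) (_ : 0 < γ), chiAux φ x y R m γ

/-- Voiculescu's modified free entropy dimension
`δ₀(x) = n + limsup_{ε → 0} χ(x₁ + ε s₁, …, xₙ + ε sₙ : s₁, …, sₙ) / |log ε|`,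
where `s₁, …, sₙ` is a semicircular family free from `x` (as always when `delta₀` is used). -/
def delta₀ {n : ℕ} (φ : M →ₗ[ℂ] ℂ) (x s : Fin n → M) : EReal :=
  (n : EReal) + limsupDivLog fun ε => chi φ (fun i => x i + (ε : ℂ) • s i) s

end FreeEntropy

end

/-!
All quantities are compared at proportional scales, since `limsup_{ε → 0} f(ε) / |log ε|` ignores a
rescaling of `ε` and a bounded error (`limsupDivLog_le`).

**Packing and covering.** Packing and covering numbers of a metric space bound each other at
proportional scales. The microstate spaces with and without cutoff have comparable packing numbers:
if the spectrum of the matrices of a microstate is truncated to `[-R, R]`, where `R` exceeds the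
norms of the `x j`, the high moments show that the microstate moves little in `|·|₂` and remains a
microstate (`exists_close_microstatesCutoff`).

**Upper bound for the entropy** (`chi_le_covering`). If `(B, S)` is a microstate of `(x + ε s, s)`,
then `B - ε S` is a microstate of `x`, and it is at distance at most `√(2 n) ε` from `B` since the
second moments of `S` are close to one. So the microstates of `x + ε s` are covered by the balls of
radius `(1 + √(2 n)) ε` about the centres of a cover of the microstates of `x`, and the volume of
such a ball gives `- n |log ε|` on the scale `k⁻² log`.

**Lower bound for the entropy** (`packingCutoff_le_chi`). Given a microstate `A` of `x`, at least
half of the tuples `S` in the Gaussian unitary ensemble make `(A, S)` a microstate of `(x, s)` with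
`‖S j‖ ≤ 256 (n + 1)`, and then `A + ε S` is a microstate of `x + ε s` in the presence of `s`. As
the density of the Gaussian measure is bounded, these `A + ε S` fill a large volume, and for the
centres `A` of disjoint balls of radius `r ε`, with a suitable constant `r`, they fill disjoint sets.

**Asymptotic freeness.** The matrices `S` of the Gaussian unitary ensemble are asymptotically free
from arbitrary microstates `A`. Gaussian integration by parts yields the Schwinger–Dyson equations
for the expected products of normalized traces of words in `A` and `S`
(`gueMoment_schwingerDyson`). Up to terms of order `k⁻²` these are the equations that a semicircular
family free from `x` satisfies (`schwingerDyson_semicircular`), and the equations determine all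
mixed moments from those of `x`, by induction on the number of letters `S` (`tendsto_gueMoment`).
As products of two traces are included, the variances tend to zero, and Chebyshev's inequality
applies. The same equations for words in a single `S j`, of order up to a multiple of `log k`, bound
its norm (`gaussMeasure_opNorm_le`).

**Free families.** The Schwinger–Dyson equation of a letter with respect to free blocks of letters
follows from that in its own block (`schwingerDyson_of_isFreeFamily`): the alternating products of
centred polynomials from the blocks span all polynomials, and both sides vanish on those of them
that do not come from the block of the letter. It is applied to the letters of the semicircular family, and
then to the two blocks `x` and `s`; for a single semicircular letter it is the Catalan recursion.
-/

noncomputable section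

namespace FreeEntropy

open ProbabilityTheory
open scoped NNReal

/-! ### Words and their splittings -/

/-- The product of the word `w` in the letters `e`. -/
def wordProd {J A : Type*} [Monoid A] (e : J → A) (w : List J) : A := (w.map e).prod

section Words

variable {J A : Type*} [Monoid A] (e : J → A)

@[simp] lemma wordProd_nil : wordProd e [] = 1 := rfl

@[simp] lemma wordProd_cons (j : J) (w : List J) :
    wordProd e (j :: w) = e j * wordProd e w := by simp [wordProd]

@[simp] lemma wordProd_append (u w : List J) :
    wordProd e (u ++ w) = wordProd e u * wordProd e w := by simp [wordProd]

lemma map_wordProd {B F : Type*} [Monoid B] [FunLike F A B] [MonoidHomClass F A B] (f : F)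
    (w : List J) : f (wordProd e w) = wordProd (fun j => f (e j)) w := by
  simp [wordProd, map_list_prod, Function.comp_def]

lemma wordProd_map {J' : Type*} (g : J' → J) (w : List J') :
    wordProd e (w.map g) = wordProd (fun j => e (g j)) w := by
  simp [wordProd, Function.comp_def]

lemma star_wordProd {A : Type*} [Ring A] [StarRing A] {e : J → A} (he : ∀ j, star (e j) = e j)
    (w : List J) : star (wordProd e w) = wordProd e w.reverse := by
  induction w with
  | nil => simp
  | cons j w ih => simp [ih, he]

end Words

/-- The sum of `f U V` over all factorizations `w = U j V` of the word `w` at an occurrence of the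
letter `j`. -/
def splitSum {J β : Type*} [DecidableEq J] [AddCommMonoid β] (j : J) (f : List J → List J → β)
    (w : List J) : β :=
  ∑ t ∈ Finset.range w.length, if w[t]? = some j then f (w.take t) (w.drop (t + 1)) else 0

lemma eq_take_append_drop_of_getElem? {J : Type*} {w : List J} {j : J} {t : ℕ}
    (h : w[t]? = some j) :
    w = w.take t ++ j :: w.drop (t + 1) := by
  obtain ⟨ht, rfl⟩ := List.getElem?_eq_some_iff.1 h
  simp

section Split

variable {J β : Type*} [DecidableEq J] [AddCommMonoid β]

@[simp] lemma splitSum_nil (j : J) (f : List J → List J → β) : splitSum j f [] = 0 := rfl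

lemma splitSum_cons (j a : J) (f : List J → List J → β) (w : List J) :
    splitSum j f (a :: w) =
      (if a = j then f [] w else 0) + splitSum j (fun U V => f (a :: U) V) w := by
  simp [splitSum, Finset.sum_range_succ', add_comm]

lemma splitSum_congr {j : J} {f g : List J → List J → β} {w : List J}
    (h : ∀ U V, w = U ++ j :: V → f U V = g U V) : splitSum j f w = splitSum j g w := by
  refine Finset.sum_congr rfl fun t _ => ?_
  split_ifs with ht
  · exact h _ _ (eq_take_append_drop_of_getElem? ht)
  · rfl

lemma map_splitSum {γ F : Type*} [AddCommMonoid γ] [FunLike F β γ] [AddMonoidHomClass F β γ]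
    (g : F) (j : J) (f : List J → List J → β) (w : List J) :
    g (splitSum j f w) = splitSum j (fun U V => g (f U V)) w := by
  simp only [splitSum, map_sum]
  refine Finset.sum_congr rfl fun t _ => ?_
  split_ifs <;> simp

lemma splitSum_finset_sum {ι : Type*} (s : Finset ι) (j : J) (f : ι → List J → List J → β)
    (w : List J) :
    ∑ i ∈ s, splitSum j (f i) w = splitSum j (fun U V => ∑ i ∈ s, f i U V) w := by
  simp only [splitSum]
  rw [Finset.sum_comm]
  refine Finset.sum_congr rfl fun t _ => ?_
  split_ifs <;> simp

lemma mul_splitSum {R : Type*} [Semiring R] (r : R) (j : J) (f : List J → List J → R)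
    (w : List J) : r * splitSum j f w = splitSum j (fun U V => r * f U V) w :=
  map_splitSum (AddMonoidHom.mulLeft r) j f w

lemma splitSum_mul {R : Type*} [Semiring R] (r : R) (j : J) (f : List J → List J → R)
    (w : List J) : splitSum j f w * r = splitSum j (fun U V => f U V * r) w :=
  map_splitSum (AddMonoidHom.mulRight r) j f w

lemma tendsto_splitSum {ι : Type*} {l : Filter ι} [TopologicalSpace β] [ContinuousAdd β] {j : J}
    {f : ι → List J → List J → β} {g : List J → List J → β} {w : List J}
    (h : ∀ U V, w = U ++ j :: V → Tendsto (fun i => f i U V) l (𝓝 (g U V))) :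
    Tendsto (fun i => splitSum j (f i) w) l (𝓝 (splitSum j g w)) := by
  refine tendsto_finsetSum _ fun t _ => ?_
  split_ifs with ht
  · exact h _ _ (eq_take_append_drop_of_getElem? ht)
  · exact tendsto_const_nhds

end Split

/-! ### The Schwinger–Dyson equations of a Gaussian matrix -/

/-- The normalized trace of a matrix over a commutative complex algebra. -/
def ntr {R : Type*} [CommRing R] [Algebra ℂ R] {k : ℕ} (A : Matrix (Fin k) (Fin k) R) : R :=
  algebraMap ℂ R (k : ℂ)⁻¹ * A.trace

/-- The product of the normalized traces of the words of the list `L`. -/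
def trProd {R J : Type*} [CommRing R] [Algebra ℂ R] {k : ℕ} (Y : J → Matrix (Fin k) (Fin k) R)
    (L : List (List J)) : R :=
  (L.map fun w => ntr (wordProd Y w)).prod

section SchwingerDyson

variable {R J : Type*} [CommRing R] [Algebra ℂ R] {k : ℕ}

lemma ntr_mul_comm (A B : Matrix (Fin k) (Fin k) R) : ntr (A * B) = ntr (B * A) := by
  simp [ntr, Matrix.trace_mul_comm A B]

lemma normTrace_eq_ntr (A : Matrix (Fin k) (Fin k) ℂ) : normTrace A = ntr A := rfl

variable (Y : J → Matrix (Fin k) (Fin k) R)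

@[simp] lemma trProd_nil : trProd Y [] = 1 := rfl

@[simp] lemma trProd_cons (w : List J) (L : List (List J)) :
    trProd Y (w :: L) = ntr (wordProd Y w) * trProd Y L := by simp [trProd]

lemma trProd_perm {L L' : List (List J)} (h : L.Perm L') : trProd Y L = trProd Y L' :=
  (h.map _).prod_eq

lemma derivation_trProd (D : Derivation ℂ R R) (L : List (List J)) :
    D (trProd Y L) = ∑ r ∈ Finset.range L.length,
      D (ntr (wordProd Y (L.getD r []))) * trProd Y (L.eraseIdx r) := by
  induction L with
  | nil => simp
  | cons w L ih =>
    simp only [trProd_cons, Derivation.leibniz, smul_eq_mul, ih, List.length_cons,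
      Finset.sum_range_succ', List.getD_cons_succ, List.eraseIdx_cons_succ, List.getD_cons_zero,
      List.eraseIdx_cons_zero, Finset.mul_sum]
    congr 1
    · exact Finset.sum_congr rfl fun r _ => by ring
    · ring

variable [DecidableEq J] {j₀ : J}

lemma derivation_wordProd {D : Derivation ℂ R R} {a b : Fin k}
    (hD : ∀ j c d, D (Y j c d) = if j = j₀ ∧ c = b ∧ d = a then 1 else 0)
    (w : List J) (c d : Fin k) :
    D (wordProd Y w c d) =
      splitSum j₀ (fun U V => wordProd Y U c b * wordProd Y V a d) w := by
  induction w generalizing c with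
  | nil =>
    simp only [wordProd_nil, splitSum_nil, Matrix.one_apply]
    split_ifs <;> simp
  | cons j w ih =>
    simp only [wordProd_cons, Matrix.mul_apply, map_sum, Derivation.leibniz, smul_eq_mul, ih, hD,
      splitSum_cons, Finset.sum_add_distrib, wordProd_nil]
    rw [add_comm]
    congr 1
    · by_cases hj : j = j₀ <;> by_cases hc : c = b <;> simp [hj, hc, Matrix.one_apply]
    · simp_rw [mul_splitSum, splitSum_finset_sum, Finset.sum_mul, mul_assoc]

/-- The Schwinger–Dyson equation: integration by parts in the entries of `Y j₀`, whose covariance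
is that of the Gaussian unitary ensemble, for a product of normalized traces. -/
lemma schwingerDyson (E : R →ₗ[ℂ] ℂ) (D : Fin k → Fin k → Derivation ℂ R R)
    (hD : ∀ a b j c d, D a b (Y j c d) = if j = j₀ ∧ c = b ∧ d = a then 1 else 0)
    (hE : ∀ a b P, E (Y j₀ a b * P) = (k : ℂ)⁻¹ * E (D a b P))
    (w : List J) (L : List (List J)) :
    E (trProd Y ((j₀ :: w) :: L)) =
      splitSum j₀ (fun U V => E (trProd Y (U :: V :: L))) w +
      ((k : ℂ)⁻¹) ^ 2 * ∑ r ∈ Finset.range L.length,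
        splitSum j₀ (fun U V => E (trProd Y ((w ++ V ++ U) :: L.eraseIdx r))) (L.getD r []) := by
  have hEc : ∀ (c : ℂ) P, E (algebraMap ℂ R c * P) = c * E P := fun c P => by
    rw [← Algebra.smul_def, map_smul, smul_eq_mul]
  have h1 : E (trProd Y ((j₀ :: w) :: L)) =
      (k : ℂ)⁻¹ * ∑ a, ∑ b, (k : ℂ)⁻¹ * E (D a b (wordProd Y w b a * trProd Y L)) := by
    rw [trProd_cons, ntr, mul_assoc, hEc, wordProd_cons, Matrix.trace, Finset.sum_mul, map_sum]
    congr 1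
    refine Finset.sum_congr rfl fun a _ => ?_
    rw [Matrix.diag_apply, Matrix.mul_apply, Finset.sum_mul, map_sum]
    exact Finset.sum_congr rfl fun b _ => by rw [mul_assoc, hE]
  have h2 : ∑ a, ∑ b, D a b (wordProd Y w b a) =
      splitSum j₀ (fun U V => (wordProd Y U).trace * (wordProd Y V).trace) w := by
    simp_rw [fun a b => derivation_wordProd Y (hD a b) w b a, splitSum_finset_sum]
    refine splitSum_congr fun U V _ => ?_
    rw [mul_comm, Matrix.trace, Matrix.trace, Finset.sum_mul_sum]
    simp [mul_comm]
  have h3 : ∀ w', ∑ a, ∑ b, wordProd Y w b a * D a b (ntr (wordProd Y w')) =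
      splitSum j₀ (fun U V => ntr (wordProd Y (w ++ V ++ U))) w' := by
    intro w'
    have : ∀ a b, D a b (ntr (wordProd Y w')) = algebraMap ℂ R (k : ℂ)⁻¹ *
        splitSum j₀ (fun U V => wordProd Y (V ++ U) a b) w' := by
      intro a b
      rw [ntr, Derivation.leibniz]
      simp only [Derivation.map_algebraMap, mul_zero, add_zero, smul_eq_mul, Matrix.trace,
        map_sum, Matrix.diag_apply, derivation_wordProd Y (hD a b), splitSum_finset_sum]
      congr 1
      refine splitSum_congr fun U V _ => ?_
      rw [wordProd_append, Matrix.mul_apply]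
      exact Finset.sum_congr rfl fun c _ => mul_comm _ _
    simp_rw [this, mul_splitSum, splitSum_finset_sum]
    refine splitSum_congr fun U V _ => ?_
    rw [List.append_assoc, wordProd_append Y w (V ++ U), ntr, Matrix.trace, Finset.sum_comm,
      Finset.mul_sum]
    refine Finset.sum_congr rfl fun a _ => ?_
    rw [Matrix.diag_apply, Matrix.mul_apply, Finset.mul_sum]
    exact Finset.sum_congr rfl fun b _ => by ring
  have h4 : ∑ a, ∑ b, D a b (wordProd Y w b a * trProd Y L) =
      splitSum j₀ (fun U V => (wordProd Y U).trace * (wordProd Y V).trace * trProd Y L) w +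
      ∑ r ∈ Finset.range L.length,
        splitSum j₀ (fun U V => trProd Y ((w ++ V ++ U) :: L.eraseIdx r)) (L.getD r []) := by
    simp_rw [Derivation.leibniz, smul_eq_mul, Finset.sum_add_distrib]
    rw [add_comm]
    congr 1
    · rw [← splitSum_mul, ← h2, Finset.sum_mul]
      refine Finset.sum_congr rfl fun a _ => ?_
      rw [Finset.sum_mul]
      exact Finset.sum_congr rfl fun b _ => mul_comm _ _
    · simp_rw [derivation_trProd, Finset.mul_sum]
      have : ∀ a : Fin k, ∑ b, ∑ r ∈ Finset.range L.length, wordProd Y w b a *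
          (D a b (ntr (wordProd Y (L.getD r []))) * trProd Y (L.eraseIdx r)) =
          ∑ r ∈ Finset.range L.length, ∑ b, wordProd Y w b a *
          (D a b (ntr (wordProd Y (L.getD r []))) * trProd Y (L.eraseIdx r)) :=
        fun a => Finset.sum_comm
      simp_rw [this]
      rw [Finset.sum_comm]
      refine Finset.sum_congr rfl fun r _ => ?_
      simp_rw [trProd_cons, ← splitSum_mul, ← h3, Finset.sum_mul, mul_assoc]
  simp_rw [← Finset.mul_sum, ← map_sum] at h1
  rw [h1, h4, map_add, map_sum, mul_add, mul_add, ← mul_assoc, ← mul_assoc, ← sq,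
    map_splitSum, mul_splitSum]
  congr 1
  · refine splitSum_congr fun U V _ => ?_
    rw [trProd_cons, trProd_cons, ntr, ntr, mul_assoc, mul_assoc, mul_assoc, hEc,
      mul_left_comm (wordProd Y U).trace (algebraMap ℂ R _), hEc]
    ring
  · simp_rw [map_splitSum]

end SchwingerDyson

/-! ### Gaussian measures on `ℝ ^ σ` and integration by parts for polynomials -/

section Gaussian

lemma integrable_pow_mul_gaussianPDFReal {v : ℝ≥0} (hv : v ≠ 0) (a : ℕ) :
    Integrable fun x : ℝ => gaussianPDFReal 0 v x * x ^ a := by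
  have hv' : (0 : ℝ) < v := by positivity
  have h := (integrable_rpow_mul_exp_neg_mul_sq (b := (2 * (v : ℝ))⁻¹) (by positivity)
    (s := (a : ℝ)) (by have : (0 : ℝ) ≤ a := a.cast_nonneg
                       linarith)).const_mul (√(2 * Real.pi * v))⁻¹
  refine h.congr (Eventually.of_forall fun x => ?_)
  simp only [gaussianPDFReal, Real.rpow_natCast, sub_zero]
  rw [show -x ^ 2 / (2 * (v : ℝ)) = -(2 * (v : ℝ))⁻¹ * x ^ 2 by field_simp]
  ring

lemma hasDerivAt_gaussianPDFReal {v : ℝ≥0} (hv : v ≠ 0) (x : ℝ) :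
    HasDerivAt (gaussianPDFReal 0 v) (-(v : ℝ)⁻¹ * (gaussianPDFReal 0 v x * x)) x := by
  have hv' : (v : ℝ) ≠ 0 := by exact_mod_cast hv
  have h : HasDerivAt (fun x : ℝ => (√(2 * Real.pi * v))⁻¹ * Real.exp (-(x - 0) ^ 2 / (2 * v)))
      ((√(2 * Real.pi * v))⁻¹ * (Real.exp (-(x - 0) ^ 2 / (2 * v)) *
        (-(2 * (x - 0) ^ (2 - 1) * 1) / (2 * v)))) x := by
    refine (HasDerivAt.exp ?_).const_mul _
    exact ((((hasDerivAt_id x).sub_const 0).pow 2).neg).div_const _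
  refine HasDerivAt.congr_deriv (f := gaussianPDFReal 0 v) h ?_
  simp only [gaussianPDFReal]
  field_simp
  norm_num

/-- The recursion of the moments of a centred Gaussian of variance `v`. -/
lemma integral_gaussianPDFReal_mul_pow_succ {v : ℝ≥0} (hv : v ≠ 0) (a : ℕ) :
    ∫ x : ℝ, gaussianPDFReal 0 v x * x ^ (a + 1) =
      v * (a * ∫ x : ℝ, gaussianPDFReal 0 v x * x ^ (a - 1)) := by
  have hv' : (v : ℝ) ≠ 0 := by exact_mod_cast hv
  have h := integral_mul_deriv_eq_deriv_mul_of_integrable (u := fun x : ℝ => x ^ a)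
    (v := gaussianPDFReal 0 v) (u' := fun x => a * x ^ (a - 1))
    (v' := fun x => -(v : ℝ)⁻¹ * (gaussianPDFReal 0 v x * x))
    (fun x _ => hasDerivAt_pow a x) (fun x _ => hasDerivAt_gaussianPDFReal hv x)
    (((integrable_pow_mul_gaussianPDFReal hv (a + 1)).const_mul (-(v : ℝ)⁻¹)).congr
      (Eventually.of_forall fun x => by simp only [Pi.mul_apply]; ring))
    (((integrable_pow_mul_gaussianPDFReal hv (a - 1)).const_mul (a : ℝ)).congr
      (Eventually.of_forall fun x => by simp only [Pi.mul_apply]; ring))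
    ((integrable_pow_mul_gaussianPDFReal hv a).congr
      (Eventually.of_forall fun x => by simp only [Pi.mul_apply]; ring))
  have h1 : ∀ x : ℝ, x ^ a * (-(v : ℝ)⁻¹ * (gaussianPDFReal 0 v x * x)) =
    -(v : ℝ)⁻¹ * (gaussianPDFReal 0 v x * x ^ (a + 1)) := fun x => by ring
  have h2 : ∀ x : ℝ, (a * x ^ (a - 1)) * gaussianPDFReal 0 v x =
    a * (gaussianPDFReal 0 v x * x ^ (a - 1)) := fun x => by ring
  simp_rw [h1, h2, integral_const_mul] at h
  field_simp at h
  linarith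

variable {σ : Type*} [Fintype σ]

/-- The density of the centred Gaussian measure on `ℝ ^ σ` with covariance `v` times the
identity. -/
def gaussDensity (v : ℝ≥0) (u : σ → ℝ) : ℝ := ∏ c, gaussianPDFReal 0 v (u c)

/-- The centred Gaussian measure on `ℝ ^ σ` with covariance `v` times the identity. -/
def gaussMeasure (σ : Type*) [Fintype σ] (v : ℝ≥0) : Measure (σ → ℝ) :=
  volume.withDensity fun u => ENNReal.ofReal (gaussDensity v u)

lemma gaussDensity_nonneg (v : ℝ≥0) (u : σ → ℝ) : 0 ≤ gaussDensity v u :=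
  Finset.prod_nonneg fun _ _ => gaussianPDFReal_nonneg _ _ _

lemma gaussDensity_eq (v : ℝ≥0) (u : σ → ℝ) : gaussDensity v u =
    (√(2 * Real.pi * v))⁻¹ ^ Fintype.card σ * Real.exp (-(∑ c, u c ^ 2) / (2 * v)) := by
  simp only [gaussDensity, gaussianPDFReal, Finset.prod_mul_distrib, Finset.prod_const,
    Finset.card_univ, ← Real.exp_sum, sub_zero]
  rw [← Finset.sum_div, Finset.sum_neg_distrib]

lemma measurable_gaussDensity (v : ℝ≥0) : Measurable (gaussDensity v : (σ → ℝ) → ℝ) :=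
  Finset.measurable_prod _ fun c _ => (measurable_gaussianPDFReal 0 v).comp (measurable_pi_apply c)

lemma gaussMeasure_le (v : ℝ≥0) (s : Set (σ → ℝ)) : gaussMeasure σ v s ≤
    ENNReal.ofReal ((√(2 * Real.pi * v))⁻¹ ^ Fintype.card σ) * volume s := by
  have h : gaussMeasure σ v ≤
      ENNReal.ofReal ((√(2 * Real.pi * v))⁻¹ ^ Fintype.card σ) • volume := by
    rw [← withDensity_const]
    refine withDensity_mono (Eventually.of_forall fun u => ENNReal.ofReal_le_ofReal ?_)
    rw [gaussDensity_eq]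
    refine mul_le_of_le_one_right (by positivity) (Real.exp_le_one_iff.2 ?_)
    exact div_nonpos_of_nonpos_of_nonneg
      (neg_nonpos.2 (Finset.sum_nonneg fun c _ => sq_nonneg _)) (by positivity)
  exact h s

/-- The image of a polynomial in the coordinates under evaluation at a real point. -/
abbrev evalReal (u : σ → ℝ) : MvPolynomial σ ℂ →ₐ[ℂ] ℂ := MvPolynomial.aeval fun c => (u c : ℂ)

lemma gaussDensity_mul_evalReal_monomial (v : ℝ≥0) (s : σ →₀ ℕ) (a : ℂ) (u : σ → ℝ) :
    (gaussDensity v u : ℂ) * evalReal u (MvPolynomial.monomial s a) =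
      a * ∏ c, ((gaussianPDFReal 0 v (u c) * u c ^ s c : ℝ) : ℂ) := by
  rw [MvPolynomial.aeval_monomial, Finsupp.prod_fintype _ _ (fun _ => pow_zero _)]
  simp only [gaussDensity, Complex.ofReal_mul, Complex.ofReal_prod, Complex.ofReal_pow,
    Finset.prod_mul_distrib, Algebra.algebraMap_self, RingHom.id_apply]
  ring

lemma integrable_gaussDensity_mul {v : ℝ≥0} (hv : v ≠ 0) (P : MvPolynomial σ ℂ) :
    Integrable fun u : σ → ℝ => (gaussDensity v u : ℂ) * evalReal u P := by
  induction P using MvPolynomial.induction_on' with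
  | monomial s a =>
    simp_rw [gaussDensity_mul_evalReal_monomial]
    exact (Integrable.fintype_prod (f := fun c (x : ℝ) =>
      ((gaussianPDFReal 0 v x * x ^ s c : ℝ) : ℂ)) (μ := fun _ : σ => volume)
      fun c => (integrable_pow_mul_gaussianPDFReal hv (s c)).ofReal).const_mul a
  | add P Q hP hQ => 
    simp only [map_add, mul_add]
    exact hP.add hQ

/-- The Gaussian expectation of a polynomial in the coordinates. -/
def gaussExp (σ : Type*) [Fintype σ] {v : ℝ≥0} (hv : v ≠ 0) : MvPolynomial σ ℂ →ₗ[ℂ] ℂ where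
  toFun P := ∫ u : σ → ℝ, (gaussDensity v u : ℂ) * evalReal u P
  map_add' P Q := by
    simp only [map_add, mul_add]
    exact integral_add (integrable_gaussDensity_mul hv P) (integrable_gaussDensity_mul hv Q)
  map_smul' a P := by
    simp only [map_smul, smul_eq_mul, mul_left_comm _ a, RingHom.id_apply]
    exact integral_const_mul _ _

lemma gaussExp_apply {v : ℝ≥0} (hv : v ≠ 0) (P : MvPolynomial σ ℂ) :
    gaussExp σ hv P = ∫ u, evalReal u P ∂gaussMeasure σ v := by
  rw [gaussMeasure, integral_withDensity_eq_integral_toReal_smul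
    (measurable_gaussDensity v).ennreal_ofReal (Eventually.of_forall fun _ => ENNReal.ofReal_lt_top)]
  refine integral_congr_ae (Eventually.of_forall fun u => ?_)
  simp only [ENNReal.toReal_ofReal (gaussDensity_nonneg v u), Complex.real_smul]

lemma integrable_evalReal {v : ℝ≥0} (hv : v ≠ 0) (P : MvPolynomial σ ℂ) :
    Integrable (fun u => evalReal u P) (gaussMeasure σ v) := by
  rw [gaussMeasure, integrable_withDensity_iff_integrable_smul'
    (measurable_gaussDensity v).ennreal_ofReal (Eventually.of_forall fun _ => ENNReal.ofReal_lt_top)]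
  refine (integrable_gaussDensity_mul hv P).congr (Eventually.of_forall fun u => ?_)
  simp only [ENNReal.toReal_ofReal (gaussDensity_nonneg v u), Complex.real_smul]

lemma gaussExp_monomial {v : ℝ≥0} (hv : v ≠ 0) (s : σ →₀ ℕ) (a : ℂ) :
    gaussExp σ hv (MvPolynomial.monomial s a) =
      a * ∏ c, ((∫ x : ℝ, gaussianPDFReal 0 v x * x ^ s c : ℝ) : ℂ) := by
  change ∫ u : σ → ℝ, _ = _
  simp_rw [gaussDensity_mul_evalReal_monomial]
  rw [integral_const_mul, integral_fintype_prod_volume_eq_prod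
    fun c (x : ℝ) => ((gaussianPDFReal 0 v x * x ^ s c : ℝ) : ℂ)]
  simp_rw [integral_complex_ofReal]

lemma gaussExp_one {v : ℝ≥0} (hv : v ≠ 0) : gaussExp σ hv 1 = 1 := by
  rw [← MvPolynomial.C_1, ← MvPolynomial.monomial_zero', gaussExp_monomial]
  simp [integral_gaussianPDFReal_eq_one 0 hv]

instance gaussMeasure.isFiniteMeasure {v : ℝ≥0} [NeZero v] :
    IsFiniteMeasure (gaussMeasure σ v) := by
  have h := integrable_evalReal (σ := σ) (NeZero.ne v) 1
  simp only [map_one] at h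
  exact (integrable_const_iff_isFiniteMeasure one_ne_zero).1 h

lemma gaussMeasure_univ {v : ℝ≥0} (hv : v ≠ 0) : gaussMeasure σ v Set.univ = 1 := by
  have : NeZero v := ⟨hv⟩
  have h := gaussExp_apply (σ := σ) hv 1
  simp only [gaussExp_one, map_one, integral_const, measureReal_def, Complex.real_smul, mul_one]
    at h
  have h' : (gaussMeasure σ v Set.univ).toReal = 1 := by exact_mod_cast h.symm
  rw [← ENNReal.ofReal_toReal (measure_ne_top (gaussMeasure σ v) Set.univ), h', ENNReal.ofReal_one]

/-- Gaussian integration by parts. -/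
lemma gaussExp_X_mul {v : ℝ≥0} (hv : v ≠ 0) (c : σ) (P : MvPolynomial σ ℂ) :
    gaussExp σ hv (MvPolynomial.X c * P) = v * gaussExp σ hv (MvPolynomial.pderiv c P) := by
  classical
  induction P using MvPolynomial.induction_on' with
  | monomial s a =>
    rw [MvPolynomial.pderiv_monomial, MvPolynomial.X, MvPolynomial.monomial_mul, one_mul,
      gaussExp_monomial, gaussExp_monomial]
    set g : ℕ → ℂ := fun p => ((∫ x : ℝ, gaussianPDFReal 0 v x * x ^ p : ℝ) : ℂ) with hg
    change a * ∏ c', g ((Finsupp.single c 1 + s : σ →₀ ℕ) c') =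
      v * (a * s c * ∏ c', g ((s - Finsupp.single c 1 : σ →₀ ℕ) c'))
    have h1 : ∏ c', g ((Finsupp.single c 1 + s : σ →₀ ℕ) c') =
        g (s c + 1) * ∏ c' ∈ Finset.univ.erase c, g (s c') := by
      rw [← Finset.mul_prod_erase _ _ (Finset.mem_univ c)]
      congr 1
      · simp [add_comm]
      · refine Finset.prod_congr rfl fun c' hc' => ?_
        simp [Finsupp.single_eq_of_ne (Finset.mem_erase.1 hc').1]
    have h2 : ∏ c', g ((s - Finsupp.single c 1 : σ →₀ ℕ) c') =
        g (s c - 1) * ∏ c' ∈ Finset.univ.erase c, g (s c') := by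
      rw [← Finset.mul_prod_erase _ _ (Finset.mem_univ c)]
      congr 1
      · simp
      · refine Finset.prod_congr rfl fun c' hc' => ?_
        simp [Finsupp.single_eq_of_ne (Finset.mem_erase.1 hc').1]
    have h3 : g (s c + 1) = v * (s c * g (s c - 1)) := by
      simp only [hg, integral_gaussianPDFReal_mul_pow_succ hv]
      push_cast
      rfl
    rw [h1, h2, h3]
    ring
  | add P Q hP hQ => simp only [mul_add, map_add, hP, hQ]

/-- The volume of a Euclidean ball in `ℝ ^ σ`, bounded through the Gaussian measure. -/
lemma volume_sum_sq_le {v : ℝ≥0} (hv : v ≠ 0) (t : ℝ) :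
    volume {u : σ → ℝ | ∑ c, u c ^ 2 ≤ t} ≤
      ENNReal.ofReal (√(2 * Real.pi * v) ^ Fintype.card σ * Real.exp (t / (2 * v))) := by
  have hv' : (0 : ℝ) < v := by positivity
  set q : ℝ := √(2 * Real.pi * v) ^ Fintype.card σ * Real.exp (t / (2 * v))
  have hq : 0 < q := by positivity
  set s := {u : σ → ℝ | ∑ c, u c ^ 2 ≤ t}
  have hs : MeasurableSet s :=
    measurableSet_le (by fun_prop) measurable_const
  have h : ENNReal.ofReal q⁻¹ * volume s ≤ 1 := by
    rw [← gaussMeasure_univ (σ := σ) hv]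
    refine le_trans ?_ (measure_mono s.subset_univ)
    rw [gaussMeasure, withDensity_apply _ hs, ← setLIntegral_const]
    refine setLIntegral_mono' hs fun u hu => ENNReal.ofReal_le_ofReal ?_
    rw [gaussDensity_eq, mul_inv, ← inv_pow, ← Real.exp_neg, ← neg_div]
    gcongr
    exact hu
  rw [ENNReal.ofReal_inv_of_pos hq, mul_comm, ← div_eq_mul_inv] at h
  simpa using (ENNReal.div_le_iff (by simpa using hq) ENNReal.ofReal_ne_top).1 h

end Gaussian

/-! ### Coordinates on self-adjoint matrices -/

section Coordinates

variable {I : Type*} {k : ℕ}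

lemma inv_sqrt_two_mul_self : (((√2 : ℝ) : ℂ))⁻¹ * ((√2 : ℝ) : ℂ)⁻¹ = 2⁻¹ := by
  rw [← mul_inv, ← Complex.ofReal_mul, Real.mul_self_sqrt (by norm_num)]
  norm_num

lemma isHermitian_hermitianOfCoords (v : Fin k → Fin k → ℝ) :
    (hermitianOfCoords v).IsHermitian := by
  ext a b
  rcases lt_trichotomy a b with h | rfl | h
  · simp [hermitianOfCoords, h.ne, h.ne', h, h.not_gt, sub_eq_add_neg]
  · simp [hermitianOfCoords]
  · simp [hermitianOfCoords, h.ne, h.ne', h, h.not_gt, sub_eq_add_neg]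

lemma hermitianOfCoords_add_smul (v w : Fin k → Fin k → ℝ) (t : ℝ) :
    hermitianOfCoords (v + t • w) = hermitianOfCoords v + (t : ℂ) • hermitianOfCoords w := by
  ext a b
  simp only [hermitianOfCoords, Matrix.of_apply, Pi.add_apply, Pi.smul_apply, smul_eq_mul,
    Matrix.add_apply, Matrix.smul_apply]
  split_ifs <;> push_cast <;> ring

lemma exists_hermitianOfCoords_eq {A : Matrix (Fin k) (Fin k) ℂ} (hA : A.IsHermitian) :
    ∃ v, hermitianOfCoords v = A := by
  refine ⟨fun a b => if a = b then (A a a).re else if a < b then √2 * (A a b).re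
    else √2 * (A b a).im, ?_⟩
  have h2 : ((√2 : ℝ) : ℂ) ≠ 0 := by simp
  ext a b
  have hab := hA.apply a b
  rcases lt_trichotomy a b with h | rfl | h
  · simp only [hermitianOfCoords, Matrix.of_apply, h.ne, h.ne', h, h.not_gt, if_true, if_false]
    rw [div_eq_iff h2]
    conv_rhs => rw [← Complex.re_add_im (A a b)]
    push_cast
    ring
  · simp only [hermitianOfCoords, Matrix.of_apply, if_true]
    apply Complex.ext
    · simp
    · have := congrArg Complex.im hab
      simp at this
      simp
      linarith
  · simp only [hermitianOfCoords, Matrix.of_apply, h.ne, h.ne', h, h.not_gt, if_true, if_false]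
    rw [div_eq_iff h2, ← hab]
    rw [mul_comm, Complex.star_def, ← mul_right_inj' h2, Complex.ofReal_mul, Complex.ofReal_mul]
    conv_rhs => rw [← Complex.re_add_im (A b a)]
    simp only [map_add, map_mul, Complex.conj_ofReal, Complex.conj_I]
    ring

lemma normSq_hermitianOfCoords (v : Fin k → Fin k → ℝ) (a b : Fin k) :
    Complex.normSq (hermitianOfCoords v a b) = (v a b ^ 2 + v b a ^ 2) / 2 := by
  rcases lt_trichotomy a b with h | rfl | h
  · simp [hermitianOfCoords, h.ne, h, Complex.normSq_apply]
    ring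
  · simp [hermitianOfCoords, Complex.normSq_apply]
    ring
  · simp [hermitianOfCoords, h.ne', h.not_gt, Complex.normSq_apply]
    ring

lemma re_normTrace_sq {A : Matrix (Fin k) (Fin k) ℂ} (hA : A.IsHermitian) :
    (normTrace (A ^ 2)).re = (k : ℝ)⁻¹ * ∑ a, ∑ b, Complex.normSq (A a b) := by
  have : (A ^ 2).trace = ((∑ a, ∑ b, Complex.normSq (A a b) : ℝ) : ℂ) := by
    rw [sq, Matrix.trace]
    push_cast
    refine Finset.sum_congr rfl fun a _ => ?_
    rw [Matrix.diag_apply, Matrix.mul_apply]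
    refine Finset.sum_congr rfl fun b _ => ?_
    rw [← hA.apply b a, ← Complex.mul_conj]
    rfl
  rw [normTrace, this, ← Complex.ofReal_natCast, ← Complex.ofReal_inv, ← Complex.ofReal_mul,
    Complex.ofReal_re]

lemma re_normTrace_hermitianOfCoords_sq (v : Fin k → Fin k → ℝ) :
    (normTrace (hermitianOfCoords v ^ 2)).re = (k : ℝ)⁻¹ * ∑ a, ∑ b, v a b ^ 2 := by
  rw [re_normTrace_sq (isHermitian_hermitianOfCoords v)]
  simp_rw [normSq_hermitianOfCoords, ← Finset.sum_div, Finset.sum_add_distrib]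
  rw [Finset.sum_comm (f := fun a b => v b a ^ 2)]
  ring

variable [Fintype I]

/-- The tuple of self-adjoint matrices with coordinates `u`. -/
def hermTuple (u : I × Fin k × Fin k → ℝ) (j : I) : Matrix (Fin k) (Fin k) ℂ :=
  hermitianOfCoords fun a b => u (j, a, b)

omit [Fintype I] in
lemma isHermitian_hermTuple (u : I × Fin k × Fin k → ℝ) (j : I) : (hermTuple u j).IsHermitian :=
  isHermitian_hermitianOfCoords _

omit [Fintype I] in
lemma hermTuple_add_smul (u w : I × Fin k × Fin k → ℝ) (t : ℝ) (j : I) :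
    hermTuple (u + t • w) j = hermTuple u j + (t : ℂ) • hermTuple w j :=
  hermitianOfCoords_add_smul (fun a b => u (j, a, b)) (fun a b => w (j, a, b)) t

omit [Fintype I] in
lemma exists_hermTuple_eq {A : I → Matrix (Fin k) (Fin k) ℂ} (hA : ∀ j, (A j).IsHermitian) :
    ∃ u, hermTuple u = A := by
  choose v hv using fun j => exists_hermitianOfCoords_eq (hA j)
  exact ⟨fun c => v c.1 c.2.1 c.2.2, funext hv⟩

omit [Fintype I] in
lemma continuous_hermTuple (j : I) :
    Continuous fun u : I × Fin k × Fin k → ℝ => hermTuple u j := by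
  refine continuous_matrix fun a b => ?_
  simp only [hermTuple, hermitianOfCoords, Matrix.of_apply]
  split_ifs <;> fun_prop

lemma dist₂_hermTuple (u w : I × Fin k × Fin k → ℝ) :
    dist₂ (hermTuple u) (hermTuple w) = √((k : ℝ)⁻¹ * ∑ c, (u c - w c) ^ 2) := by
  have h : ∀ j, hermTuple u j - hermTuple w j =
      hermitianOfCoords fun a b => u (j, a, b) - w (j, a, b) := fun j => by
    have := hermTuple_add_smul u w (-1) j
    simp only [Complex.ofReal_neg, Complex.ofReal_one, neg_smul, one_smul, ← sub_eq_add_neg]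
      at this
    rw [← this]
    rfl
  rw [dist₂]
  simp_rw [h, re_normTrace_hermitianOfCoords_sq, ← Finset.mul_sum, Fintype.sum_prod_type]

/-- The measurable equivalence between iterated and uncurried coordinates. -/
def uncurryCoords (I : Type*) (k : ℕ) :
    (I → Fin k → Fin k → ℝ) ≃ᵐ (I × Fin k × Fin k → ℝ) where
  toFun v c := v c.1 c.2.1 c.2.2
  invFun u j a b := u (j, a, b)
  left_inv _ := rfl
  right_inv _ := rfl
  measurable_toFun := by
    refine measurable_pi_lambda _ fun c => ?_
    simp only [Equiv.coe_fn_mk]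
    fun_prop
  measurable_invFun := by
    refine measurable_pi_lambda _ fun j => measurable_pi_lambda _ fun a =>
      measurable_pi_lambda _ fun b => measurable_pi_apply (j, a, b)

lemma measurePreserving_uncurryCoords :
    MeasurePreserving (uncurryCoords I k) volume volume := by
  refine ⟨(uncurryCoords I k).measurable, ?_⟩
  refine (Measure.pi_eq fun s hs => ?_).symm
  rw [(uncurryCoords I k).map_apply]
  have : (uncurryCoords I k) ⁻¹' (Set.univ.pi s) =
      Set.univ.pi fun j => Set.univ.pi fun a => Set.univ.pi fun b => s (j, a, b) := by
    ext v
    simp [uncurryCoords, Set.mem_pi]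
  rw [this, volume_pi_pi]
  simp_rw [volume_pi_pi, Fintype.prod_prod_type]

lemma saVolume_eq (S : Set (I → Matrix (Fin k) (Fin k) ℂ)) :
    saVolume S = volume {u : I × Fin k × Fin k → ℝ | hermTuple u ∈ S} := by
  rw [saVolume, ← measurePreserving_uncurryCoords.measure_preimage_equiv]
  rfl

end Coordinates

/-! ### The Gaussian unitary ensemble -/

section GUE

open MvPolynomial

variable {n k : ℕ}

/-- The matrix of `hermTuple`, with polynomials in the coordinates as entries. -/
def guePoly (n k : ℕ) (j : Fin n) :
    Matrix (Fin k) (Fin k) (MvPolynomial (Fin n × Fin k × Fin k) ℂ) :=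
  Matrix.of fun a b =>
    if a = b then X (j, a, a)
    else if a < b then C ((√2 : ℝ) : ℂ)⁻¹ * (X (j, a, b) + C Complex.I * X (j, b, a))
    else C ((√2 : ℝ) : ℂ)⁻¹ * (X (j, b, a) - C Complex.I * X (j, a, b))

lemma evalReal_guePoly (u : Fin n × Fin k × Fin k → ℝ) (j : Fin n) (a b : Fin k) :
    evalReal u (guePoly n k j a b) = hermTuple u j a b := by
  simp only [guePoly, hermTuple, hermitianOfCoords, Matrix.of_apply]
  split_ifs <;> simp <;> ring

/-- The derivation dual to the matrix entries of `guePoly`: it maps the entry `(c, d)` of the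
matrix `j` to one if `(c, d) = (b, a)`, and to zero otherwise. -/
def gueDeriv (j : Fin n) (a b : Fin k) :
    Derivation ℂ (MvPolynomial (Fin n × Fin k × Fin k) ℂ)
      (MvPolynomial (Fin n × Fin k × Fin k) ℂ) :=
  if a = b then pderiv (j, a, a)
  else if a < b then ((√2 : ℝ) : ℂ)⁻¹ • (pderiv (j, a, b) + Complex.I • pderiv (j, b, a))
  else ((√2 : ℝ) : ℂ)⁻¹ • (pderiv (j, b, a) - Complex.I • pderiv (j, a, b))

lemma gueDeriv_guePoly (j : Fin n) (a b : Fin k) (j' : Fin n) (c d : Fin k) :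
    gueDeriv j a b (guePoly n k j' c d) = if j' = j ∧ c = b ∧ d = a then 1 else 0 := by
  have hI : (C Complex.I * C Complex.I : MvPolynomial (Fin n × Fin k × Fin k) ℂ) = -1 := by
    rw [← C_mul, Complex.I_mul_I, C_neg, C_1]
  have hs : (C ((√2 : ℝ) : ℂ)⁻¹ * C ((√2 : ℝ) : ℂ)⁻¹ :
      MvPolynomial (Fin n × Fin k × Fin k) ℂ) * 2 = 1 := by
    rw [← C_mul, inv_sqrt_two_mul_self, show (2 : MvPolynomial (Fin n × Fin k × Fin k) ℂ) = C 2
      from (map_ofNat C 2).symm, ← C_mul, inv_mul_cancel₀ two_ne_zero, C_1]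
  by_cases hj : j' = j
  · subst hj
    have hX : ∀ x y : Fin k × Fin k, pderiv (R := ℂ) (j', x) (X (j', y)) =
        if y.1 = x.1 ∧ y.2 = x.2 then 1 else 0 := fun x y => by
      simp [pderiv_X, Pi.single_apply, Prod.ext_iff]
    by_cases hab : a = b
    · subst hab
      simp only [gueDeriv, guePoly, Matrix.of_apply, true_and, if_true]
      by_cases hc : c = a <;> by_cases hd : d = a <;> by_cases hcd : c = d <;>
        first
        | omega
        | split_ifs <;> simp_all
    · have hba : ¬ b = a := fun h => hab h.symm
      simp only [gueDeriv, guePoly, Matrix.of_apply, true_and, hab, if_false]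
      by_cases h1 : c = a <;> by_cases h2 : c = b <;> by_cases h3 : d = a <;>
        by_cases h4 : d = b <;> split_ifs <;> first
        | omega
        | (simp only [smul_eq_C_mul, Derivation.smul_apply, Derivation.add_apply,
            Derivation.sub_apply, pderiv_C_mul, map_add, map_sub, hX, h1, h2, h3, h4, hab, hba,
            and_true, and_false, and_self, if_true, if_false]
           first
           | ring1
           | linear_combination (C ((√2 : ℝ) : ℂ)⁻¹ * C ((√2 : ℝ) : ℂ)⁻¹) * hI
           | linear_combination hs - (C ((√2 : ℝ) : ℂ)⁻¹ * C ((√2 : ℝ) : ℂ)⁻¹) * hI)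
  · have hj' : ∀ x y : Fin k × Fin k, pderiv (R := ℂ) (j, x) (X (j', y)) = 0 := fun x y =>
      pderiv_X_of_ne (by simp [hj])
    simp only [gueDeriv, guePoly, Matrix.of_apply, hj, false_and, if_false]
    split_ifs <;> simp [hj']

lemma gaussExp_guePoly_mul {v : ℝ≥0} (hv : v ≠ 0) (j : Fin n) (a b : Fin k)
    (P : MvPolynomial (Fin n × Fin k × Fin k) ℂ) :
    gaussExp _ hv (guePoly n k j a b * P) = v * gaussExp _ hv (gueDeriv j a b P) := by
  simp only [gueDeriv, guePoly, Matrix.of_apply]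
  split_ifs
  · exact gaussExp_X_mul hv _ _
  all_goals
    simp only [← smul_eq_C_mul, smul_mul_assoc, add_mul, sub_mul, map_smul, map_add, map_sub,
      gaussExp_X_mul, Derivation.smul_apply, Derivation.add_apply, Derivation.sub_apply, smul_eq_mul]
    ring

end GUE

/-! ### The filter of microstates -/

section MicFilter

variable {N : Type*} [Ring N] [Algebra ℂ N] {I : Type*} {ψ : N →ₗ[ℂ] ℂ} {x : I → N}

lemma ofFn_comp_getElem {α β : Type*} (f : α → β) (w : List α) :
    (List.ofFn fun j : Fin w.length => f w[j]) = w.map f := by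
  rw [← Function.comp_def f, ← List.map_ofFn]
  simp

lemma mem_microstates_iff {m k : ℕ} {γ : ℝ} {A : I → Matrix (Fin k) (Fin k) ℂ} :
    A ∈ microstates ψ x m k γ ↔ (∀ j, (A j).IsHermitian) ∧
      ∀ w : List I, 1 ≤ w.length → w.length ≤ m →
        ‖ntr (wordProd A w) - ψ (wordProd x w)‖ < γ := by
  refine and_congr_right fun _ => ⟨fun h w h1 h2 => ?_, fun h p h1 h2 i => ?_⟩
  · have := h w.length h1 h2 fun j => w[j]
    rwa [ofFn_comp_getElem, ofFn_comp_getElem] at this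
  · have := h (List.ofFn i) (by simpa) (by simpa)
    simpa [wordProd, List.map_ofFn, Function.comp_def, normTrace_eq_ntr] using this

lemma microstates_mono {m m' k : ℕ} {γ γ' : ℝ} (hm : m ≤ m') (hγ : γ' ≤ γ) :
    microstates ψ x m' k γ' ⊆ microstates ψ x m k γ := fun _ hA =>
  ⟨hA.1, fun p h1 h2 i => (hA.2 p h1 (h2.trans hm) i).trans_le hγ⟩

/-- The filter on tuples of matrices of arbitrary size along which the size tends to infinity and
the mixed moments converge to those of `x`. It is generated by the microstate spaces, with
`m → ∞` and `γ → 0`. -/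
def micFilter (ψ : N →ₗ[ℂ] ℂ) (x : I → N) : Filter (Σ k : ℕ, I → Matrix (Fin k) (Fin k) ℂ) :=
  ⨅ m : ℕ, 𝓟 {z | m ≤ z.1 ∧ z.2 ∈ microstates ψ x m z.1 (1 / ((m : ℝ) + 1))}

lemma hasBasis_micFilter (ψ : N →ₗ[ℂ] ℂ) (x : I → N) : (micFilter ψ x).HasBasis
    (fun _ : ℕ => True) fun m => {z | m ≤ z.1 ∧ z.2 ∈ microstates ψ x m z.1 (1 / ((m : ℝ) + 1))} := by
  refine hasBasis_iInf_principal (directed_of_isDirected_le fun m m' hm z hz => ?_)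
  exact ⟨hm.trans hz.1, microstates_mono hm (Nat.one_div_le_one_div hm) hz.2⟩

lemma exists_of_eventually_micFilter {p : (Σ k : ℕ, I → Matrix (Fin k) (Fin k) ℂ) → Prop}
    (h : ∀ᶠ z in micFilter ψ x, p z) : ∃ (m : ℕ) (γ : ℝ), 0 < γ ∧
      ∀ k ≥ m, ∀ A ∈ microstates ψ x m k γ, p ⟨k, A⟩ := by
  obtain ⟨m, -, hm⟩ := (hasBasis_micFilter ψ x).mem_iff.1 h
  exact ⟨m, 1 / ((m : ℝ) + 1), by positivity, fun k hk A hA => hm ⟨hk, hA⟩⟩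

lemma eventually_mem_microstates (m : ℕ) {γ : ℝ} (hγ : 0 < γ) :
    ∀ᶠ z in micFilter ψ x, z.2 ∈ microstates ψ x m z.1 γ := by
  obtain ⟨m', hm'⟩ := exists_nat_one_div_lt hγ
  refine (hasBasis_micFilter ψ x).mem_iff.2 ⟨max m m', trivial, fun z hz => ?_⟩
  exact microstates_mono (le_max_left _ _)
    ((Nat.one_div_le_one_div (le_max_right _ _)).trans hm'.le) hz.2

lemma tendsto_fst_micFilter : Tendsto (fun z => z.1) (micFilter ψ x) atTop :=
  tendsto_atTop.2 fun m => (hasBasis_micFilter ψ x).mem_iff.2 ⟨m, trivial, fun _ hz => hz.1⟩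

lemma tendsto_ntr_wordProd (hψ : ψ 1 = 1) (w : List I) :
    Tendsto (fun z => ntr (wordProd z.2 w)) (micFilter ψ x) (𝓝 (ψ (wordProd x w))) := by
  rcases w.eq_nil_or_concat with rfl | ⟨w', a, hw⟩
  · refine tendsto_const_nhds.congr' ?_
    filter_upwards [tendsto_fst_micFilter.eventually_ge_atTop 1] with z hz
    have : (z.1 : ℂ) ≠ 0 := by exact_mod_cast (by omega : z.1 ≠ 0)
    simp [ntr, Matrix.trace_one, hψ, this]
  · refine Metric.tendsto_nhds.2 fun γ hγ => ?_
    filter_upwards [eventually_mem_microstates w.length hγ] with z hz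
    rw [dist_eq_norm]
    exact (mem_microstates_iff.1 hz).2 w (by simp [hw]) le_rfl

/-- Convergence of all mixed moments is membership in the microstate spaces, eventually. -/
lemma eventually_mem_microstates_of_tendsto {ι N' I' : Type*} [Ring N'] [Algebra ℂ N'] [Finite I']
    {ψ' : N' →ₗ[ℂ] ℂ} {y : I' → N'} {l : Filter ι} {k : ι → ℕ}
    {B : ∀ z, I' → Matrix (Fin (k z)) (Fin (k z)) ℂ}
    (hB : ∀ᶠ z in l, ∀ j, (B z j).IsHermitian)
    (h : ∀ w, Tendsto (fun z => ntr (wordProd (B z) w)) l (𝓝 (ψ' (wordProd y w))))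
    (m : ℕ) {γ : ℝ} (hγ : 0 < γ) : ∀ᶠ z in l, B z ∈ microstates ψ' y m (k z) γ := by
  have hfin : {w : List I' | w.length ≤ m}.Finite := List.finite_length_le I' m
  have : ∀ᶠ z in l, ∀ w ∈ {w : List I' | w.length ≤ m},
      ‖ntr (wordProd (B z) w) - ψ' (wordProd y w)‖ < γ :=
    (eventually_all_finite hfin).2 fun w _ => by
      simpa only [dist_eq_norm] using Metric.tendsto_nhds.1 (h w) γ hγ
  filter_upwards [hB, this] with z h1 h2
  exact mem_microstates_iff.2 ⟨h1, fun w _ hw => h2 w hw⟩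

end MicFilter

/-! ### Mixed moments of Gaussian and deterministic matrices -/

section GUEMoments

variable {n k : ℕ}

/-- The variance `1 / k` of the coordinates of the Gaussian unitary ensemble of size `k`. -/
abbrev gueVar (k : ℕ) : ℝ≥0 := (k : ℝ≥0)⁻¹

lemma gueVar_ne_zero (hk : 0 < k) : gueVar k ≠ 0 := by
  have : (k : ℝ≥0) ≠ 0 := by exact_mod_cast hk.ne'
  simpa [gueVar] using hk.ne'

/-- The expectation of a product of normalized traces of words in the deterministic matrices `A`
(left letters) and independent Gaussian matrices (right letters). -/
def gueMoment (A : Fin n → Matrix (Fin k) (Fin k) ℂ) (L : List (List (Fin n ⊕ Fin n))) : ℂ :=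
  ∫ u, trProd (Sum.elim A (hermTuple u)) L ∂gaussMeasure (Fin n × Fin k × Fin k) (gueVar k)

/-- The deterministic matrices `A` and the Gaussian matrices, with polynomials in the coordinates of
the latter as entries. -/
def gueLetters (A : Fin n → Matrix (Fin k) (Fin k) ℂ) :
    Fin n ⊕ Fin n → Matrix (Fin k) (Fin k) (MvPolynomial (Fin n × Fin k × Fin k) ℂ) :=
  Sum.elim (fun j => (A j).map MvPolynomial.C) (guePoly n k)

lemma evalReal_ntr (u : Fin n × Fin k × Fin k → ℝ)
    (P : Matrix (Fin k) (Fin k) (MvPolynomial (Fin n × Fin k × Fin k) ℂ)) :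
    evalReal u (ntr P) = ntr ((evalReal u).mapMatrix P) := by
  simp [ntr, Matrix.trace, map_sum]

lemma evalReal_ntr_gueLetters (A : Fin n → Matrix (Fin k) (Fin k) ℂ)
    (u : Fin n × Fin k × Fin k → ℝ) (w : List (Fin n ⊕ Fin n)) :
    evalReal u (ntr (wordProd (gueLetters A) w)) =
      ntr (wordProd (Sum.elim A (hermTuple u)) w) := by
  rw [evalReal_ntr, map_wordProd]
  congr 2
  funext j
  ext a b
  rcases j with j | j
  · simp [gueLetters]
  · simp only [gueLetters, Sum.elim_inr, AlgHom.mapMatrix_apply, Matrix.map_apply]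
    exact evalReal_guePoly u j a b

lemma evalReal_trProd_gueLetters (A : Fin n → Matrix (Fin k) (Fin k) ℂ)
    (u : Fin n × Fin k × Fin k → ℝ) (L : List (List (Fin n ⊕ Fin n))) :
    evalReal u (trProd (gueLetters A) L) = trProd (Sum.elim A (hermTuple u)) L := by
  induction L with
  | nil => simp
  | cons w L ih => rw [trProd_cons, trProd_cons, map_mul, ih, evalReal_ntr_gueLetters]

lemma gueMoment_eq (hk : 0 < k) (A : Fin n → Matrix (Fin k) (Fin k) ℂ)
    (L : List (List (Fin n ⊕ Fin n))) :
    gueMoment A L = gaussExp _ (gueVar_ne_zero hk) (trProd (gueLetters A) L) := by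
  rw [gaussExp_apply, gueMoment]
  simp_rw [evalReal_trProd_gueLetters]

lemma integrable_trProd (hk : 0 < k) (A : Fin n → Matrix (Fin k) (Fin k) ℂ)
    (L : List (List (Fin n ⊕ Fin n))) :
    Integrable (fun u => trProd (Sum.elim A (hermTuple u)) L)
      (gaussMeasure (Fin n × Fin k × Fin k) (gueVar k)) := by
  simpa only [evalReal_trProd_gueLetters] using
    integrable_evalReal (gueVar_ne_zero hk) (trProd (gueLetters A) L)

lemma gueMoment_schwingerDyson (hk : 0 < k) (A : Fin n → Matrix (Fin k) (Fin k) ℂ) (i : Fin n)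
    (w : List (Fin n ⊕ Fin n)) (L : List (List (Fin n ⊕ Fin n))) :
    gueMoment A ((Sum.inr i :: w) :: L) =
      splitSum (Sum.inr i) (fun U V => gueMoment A (U :: V :: L)) w +
      ((k : ℂ)⁻¹) ^ 2 * ∑ r ∈ Finset.range L.length,
        splitSum (Sum.inr i) (fun U V => gueMoment A ((w ++ V ++ U) :: L.eraseIdx r))
          (L.getD r []) := by
  simp_rw [gueMoment_eq hk]
  refine schwingerDyson _ _ (gueDeriv i) (fun a b j c d => ?_) (fun a b P => ?_) w L
  · rcases j with j | j
    · simp only [gueLetters, Sum.elim_inl, Matrix.map_apply, reduceCtorEq, false_and, if_false]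
      rw [← MvPolynomial.algebraMap_eq, Derivation.map_algebraMap]
    · simp only [gueLetters, Sum.elim_inr, gueDeriv_guePoly, Sum.inr.injEq]
  · simp only [gueLetters, Sum.elim_inr, gaussExp_guePoly_mul]
    simp

lemma gueMoment_perm (A : Fin n → Matrix (Fin k) (Fin k) ℂ) {L L' : List (List (Fin n ⊕ Fin n))}
    (h : L.Perm L') : gueMoment A L = gueMoment A L' := by
  simp_rw [gueMoment, trProd_perm _ h]

lemma gueMoment_rotate (A : Fin n → Matrix (Fin k) (Fin k) ℂ) (U V : List (Fin n ⊕ Fin n))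
    (L : List (List (Fin n ⊕ Fin n))) : gueMoment A ((U ++ V) :: L) = gueMoment A ((V ++ U) :: L) := by
  simp_rw [gueMoment, trProd_cons, wordProd_append, ntr_mul_comm]

lemma sum_map_eraseIdx {α : Type*} (f : α → ℕ) (L : List α) (r : ℕ) (hr : r < L.length) (d : α) :
    f (L.getD r d) + ((L.eraseIdx r).map f).sum = (L.map f).sum := by
  induction L generalizing r with
  | nil => simp at hr
  | cons a L ih =>
    cases r with
    | zero => simp
    | succ r =>
      have := ih r (by simpa using hr)
      simp only [List.getD_cons_succ, List.eraseIdx_cons_succ, List.map_cons, List.sum_cons]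
      omega

variable {N : Type*} [Ring N] [Algebra ℂ N] {ψ : N →ₗ[ℂ] ℂ} {x s : Fin n → N}

/-- Asymptotic freeness: the expected products of normalized traces of words in microstates of `x`
and independent Gaussian matrices converge to the products of the mixed moments of `x` and `s`, if
the latter satisfy the Schwinger–Dyson equations of the limit. The induction is on the number of
Gaussian letters. -/
lemma tendsto_gueMoment (hψ : ψ 1 = 1) (htr : ∀ a b, ψ (a * b) = ψ (b * a))
    (hSD : ∀ i w, ψ (wordProd (Sum.elim x s) (Sum.inr i :: w)) = splitSum (Sum.inr i)
      (fun U V => ψ (wordProd (Sum.elim x s) U) * ψ (wordProd (Sum.elim x s) V)) w)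
    (L : List (List (Fin n ⊕ Fin n))) :
    Tendsto (fun z => gueMoment z.2 L) (micFilter ψ x)
      (𝓝 (L.map fun w => ψ (wordProd (Sum.elim x s) w)).prod) := by
  set c : List (Fin n ⊕ Fin n) → ℕ := fun w => w.countP Sum.isRight with hc
  set e := Sum.elim x s with he
  induction hd : (L.map c).sum using Nat.strong_induction_on generalizing L with
  | _ d ih =>
  subst hd
  have hk : ∀ᶠ z in micFilter ψ x, 0 < z.1 := tendsto_fst_micFilter.eventually_gt_atTop 0
  by_cases hL : ∃ W ∈ L, ∃ i, Sum.inr i ∈ W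
  · obtain ⟨W, hWL, i, hi⟩ := hL
    obtain ⟨U, V, rfl⟩ := List.append_of_mem hi
    obtain ⟨L₁, L₂, hL₁₂⟩ := List.append_of_mem hWL
    obtain ⟨L', hperm⟩ : ∃ L', L.Perm ((U ++ Sum.inr i :: V) :: L') :=
      ⟨L₁ ++ L₂, hL₁₂ ▸ List.perm_middle⟩
    set w := V ++ U
    have hcount : (L.map c).sum = 1 + c w + (L'.map c).sum := by
      rw [(hperm.map c).sum_eq]
      simp [hc, w, List.countP_cons]
      omega
    have hmom : ∀ z : Σ k : ℕ, Fin n → Matrix (Fin k) (Fin k) ℂ,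
        gueMoment z.2 L = gueMoment z.2 ((Sum.inr i :: w) :: L') := fun z => by
      rw [gueMoment_perm _ hperm, gueMoment_rotate, List.cons_append]
    have hlim : (L.map fun w => ψ (wordProd e w)).prod =
        splitSum (Sum.inr i) (fun U V =>
          ψ (wordProd e U) * (ψ (wordProd e V) * (L'.map fun w => ψ (wordProd e w)).prod)) w +
        0 * ∑ r ∈ Finset.range L'.length, splitSum (Sum.inr i) (fun U V =>
          (((w ++ V ++ U) :: L'.eraseIdx r).map fun w => ψ (wordProd e w)).prod)
            (L'.getD r []) := by
      rw [(hperm.map _).prod_eq, List.map_cons, List.prod_cons, wordProd_append, htr,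
        ← wordProd_append, List.cons_append, hSD, zero_mul, add_zero, splitSum_mul]
      simp_rw [mul_assoc]
      rfl
    rw [hlim]
    have hk2 : Tendsto (fun z : Σ k : ℕ, Fin n → Matrix (Fin k) (Fin k) ℂ => ((z.1 : ℂ)⁻¹) ^ 2)
        (micFilter ψ x) (𝓝 0) := by
      have : Tendsto (fun k : ℕ => ((k : ℂ)⁻¹) ^ 2) atTop (𝓝 0) := by
        simpa using (tendsto_inv_atTop_nhds_zero_nat (𝕜 := ℂ)).pow 2
      exact this.comp tendsto_fst_micFilter
    refine Tendsto.congr' (hk.mono fun z hz =>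
      ((hmom z).trans (gueMoment_schwingerDyson hz _ _ _ _)).symm) ?_
    refine (tendsto_splitSum fun U V hw => ?_).add (hk2.mul (tendsto_finsetSum _ fun r hr =>
      tendsto_splitSum fun U V hw => ?_))
    · have h := ih _ ?_ (U :: V :: L') rfl
      · simpa using h
      · rw [hcount, hw]
        simp [hc, List.countP_cons]
        omega
    · refine ih _ ?_ ((w ++ V ++ U) :: L'.eraseIdx r) rfl
      rw [hcount, ← sum_map_eraseIdx c L' r (Finset.mem_range.1 hr) [], hw]
      simp [hc, List.countP_cons]
      omega
  · push Not at hL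
    have hw : ∀ W ∈ L, ∃ W' : List (Fin n), W = W'.map Sum.inl := by
      intro W hW
      have : ∀ j ∈ W, ∃ i : Fin n, Sum.inl i = j := fun j hj => by
        rcases j with j | j
        · exact ⟨j, rfl⟩
        · exact absurd hj (hL W hW j)
      obtain ⟨W', h⟩ : W ∈ Set.range (List.map (Sum.inl : Fin n → Fin n ⊕ Fin n)) := by
        rw [Set.range_list_map]
        exact this
      exact ⟨W', h.symm⟩
    have hconst : ∀ k (A : Fin n → Matrix (Fin k) (Fin k) ℂ), 0 < k → gueMoment A L =
        (L.map fun w => ntr (wordProd (Sum.elim A A) w)).prod := by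
      intro k A hk
      have : ∀ u, trProd (Sum.elim A (hermTuple u)) L =
          (L.map fun w => ntr (wordProd (Sum.elim A A) w)).prod := fun u => by
        rw [trProd]
        congr 1
        refine List.map_congr_left fun W hW => ?_
        obtain ⟨W', rfl⟩ := hw W hW
        simp [wordProd_map]
      simp_rw [gueMoment, this]
      rw [integral_const, measureReal_def, gaussMeasure_univ (gueVar_ne_zero hk)]
      simp
    refine Tendsto.congr' (hk.mono fun z hz => (hconst z.1 z.2 hz).symm) ?_
    refine tendsto_list_prod _ fun W hW => ?_
    obtain ⟨W', rfl⟩ := hw W hW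
    simpa [wordProd_map, he] using tendsto_ntr_wordProd (x := x) hψ W'

end GUEMoments

/-! ### The moments of the semicircle law -/

section Semicircle

/-- The moments of the standard semicircle law. -/
def semicircleMoment (p : ℕ) : ℝ :=
  (2 * Real.pi)⁻¹ * ∫ t in (-2 : ℝ)..2, t ^ p * √(4 - t ^ 2)

lemma semicircleMoment_zero : semicircleMoment 0 = 1 := by
  have h := intervalIntegral.mul_integral_comp_mul_left (a := -1) (b := 1)
    (f := fun t : ℝ => √(4 - t ^ 2)) 2
  have h2 : ∀ t : ℝ, √(4 - (2 * t) ^ 2) = 2 * √(1 - t ^ 2) := fun t => by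
    rw [show 4 - (2 * t) ^ 2 = 2 ^ 2 * (1 - t ^ 2) by ring, Real.sqrt_mul (by norm_num),
      Real.sqrt_sq (by norm_num)]
  simp_rw [h2, intervalIntegral.integral_const_mul, integral_sqrt_one_sub_sq] at h
  norm_num at h
  have := Real.pi_ne_zero
  simp only [semicircleMoment, pow_zero, one_mul, ← h]
  field_simp

lemma semicircleMoment_odd (p : ℕ) : semicircleMoment (2 * p + 1) = 0 := by
  have h := intervalIntegral.integral_comp_neg (a := -2) (b := 2)
    (fun t : ℝ => t ^ (2 * p + 1) * √(4 - t ^ 2))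
  have h2 : ∀ t : ℝ, (-t) ^ (2 * p + 1) * √(4 - (-t) ^ 2) =
      -(t ^ (2 * p + 1) * √(4 - t ^ 2)) := fun t => by
    rw [Odd.neg_pow ⟨p, rfl⟩, neg_sq]
    ring
  simp_rw [h2, intervalIntegral.integral_neg, neg_neg] at h
  rw [semicircleMoment, show ∫ t in (-2 : ℝ)..2, t ^ (2 * p + 1) * √(4 - t ^ 2) = 0 by linarith,
    mul_zero]

/-- The recursion comes from the derivative of `t ^ (p + 1) (4 - t ^ 2) ^ (3 / 2)`. -/
lemma semicircleMoment_add_two (p : ℕ) :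
    (p + 4) * semicircleMoment (p + 2) = 4 * (p + 1) * semicircleMoment p := by
  have hint : ∀ q : ℕ, IntervalIntegrable (fun t : ℝ => t ^ q * √(4 - t ^ 2)) volume (-2) 2 :=
    fun q => (by fun_prop : Continuous fun t : ℝ => t ^ q * √(4 - t ^ 2)).intervalIntegrable _ _
  have h := intervalIntegral.integral_eq_sub_of_hasDerivAt_of_le (a := -2) (b := 2)
    (f := fun t : ℝ => t ^ (p + 1) * ((4 - t ^ 2) * √(4 - t ^ 2)))
    (f' := fun t => 4 * (p + 1) * (t ^ p * √(4 - t ^ 2)) -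
      (p + 4) * (t ^ (p + 2) * √(4 - t ^ 2))) (by norm_num)
    (by fun_prop) (fun t ht => by
      have hpos : 0 < 4 - t ^ 2 := by nlinarith [ht.1, ht.2]
      have hs : √(4 - t ^ 2) ^ 2 = 4 - t ^ 2 := Real.sq_sqrt hpos.le
      have hs0 : √(4 - t ^ 2) ≠ 0 := (Real.sqrt_pos.2 hpos).ne'
      have h1 : HasDerivAt (fun t : ℝ => 4 - t ^ 2) (-(2 * t)) t := by
        simpa using (hasDerivAt_pow 2 t).const_sub 4
      refine ((hasDerivAt_pow (p + 1) t).mul (h1.mul (h1.sqrt hpos.ne'))).congr_deriv ?_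
      simp only [Pi.mul_apply, Nat.add_sub_cancel]
      push_cast
      generalize √(4 - t ^ 2) = q at hs hs0
      rw [← hs]
      field_simp
      have ht2 : t ^ 2 = 4 - q ^ 2 := by linarith
      rw [show t ^ (p + 1) = t ^ p * t by ring, show t ^ (p + 2) = t ^ p * t ^ 2 by ring, ht2]
      linear_combination (t ^ p * (-3)) * ht2)
    (((hint p).const_mul _).sub ((hint (p + 2)).const_mul _))
  rw [intervalIntegral.integral_sub ((hint p).const_mul _) ((hint (p + 2)).const_mul _),
    intervalIntegral.integral_const_mul, intervalIntegral.integral_const_mul] at h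
  norm_num at h
  simp only [semicircleMoment]
  linear_combination -(2 * Real.pi)⁻¹ * h

lemma semicircleMoment_even (p : ℕ) : semicircleMoment (2 * p) = catalan p := by
  induction p with
  | zero => simp [semicircleMoment_zero]
  | succ p ih =>
    have h := semicircleMoment_add_two (2 * p)
    rw [ih] at h
    have h1 : ((p : ℝ) + 1) * catalan p = p.centralBinom := by
      exact_mod_cast succ_mul_catalan_eq_centralBinom p
    have h2 : ((p : ℝ) + 1 + 1) * catalan (p + 1) = (p + 1).centralBinom := by
      exact_mod_cast succ_mul_catalan_eq_centralBinom (p + 1)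
    have h3 : ((p : ℝ) + 1) * (p + 1).centralBinom = 2 * (2 * p + 1) * p.centralBinom := by
      exact_mod_cast Nat.succ_mul_centralBinom_succ p
    have hp : ((p : ℝ) + 1) * (2 * (p + 2)) ≠ 0 := by positivity
    rw [mul_add, mul_one]
    refine mul_left_cancel₀ hp ?_
    push_cast at h
    linear_combination (p + 1 : ℝ) * h - 2 * (p + 1 : ℝ) * h2 - 2 * h3
      + 4 * (2 * p + 1) * h1

lemma sum_range_odd_eq {f : ℕ → ℝ} (hf : ∀ i, f (2 * i + 1) = 0) (q : ℕ) :
    ∑ t ∈ Finset.range (2 * q + 1), f t = ∑ i ∈ Finset.range (q + 1), f (2 * i) := by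
  induction q with
  | zero => simp
  | succ q ih =>
    rw [Finset.sum_range_succ _ (q + 1), ← ih, show 2 * (q + 1) + 1 = 2 * q + 1 + 1 + 1 by ring,
      Finset.sum_range_succ, Finset.sum_range_succ _ (2 * q + 1), hf, add_zero]
    rfl

lemma semicircleMoment_succ (r : ℕ) : semicircleMoment (r + 1) =
    ∑ t ∈ Finset.range r, semicircleMoment t * semicircleMoment (r - 1 - t) := by
  rcases r.even_or_odd' with ⟨q, rfl | rfl⟩
  · rw [semicircleMoment_odd, Finset.sum_eq_zero fun t ht => ?_]
    have ht := Finset.mem_range.1 ht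
    rcases t.even_or_odd' with ⟨i, rfl | rfl⟩
    · rw [show 2 * q - 1 - 2 * i = 2 * (q - 1 - i) + 1 by omega, semicircleMoment_odd, mul_zero]
    · rw [semicircleMoment_odd, zero_mul]
  · rw [show 2 * q + 1 + 1 = 2 * (q + 1) by ring, semicircleMoment_even, catalan_succ',
      Finset.Nat.sum_antidiagonal_eq_sum_range_succ (fun i j => catalan i * catalan j),
      sum_range_odd_eq fun i => by rw [semicircleMoment_odd, zero_mul]]
    push_cast
    refine Finset.sum_congr rfl fun i hi => ?_
    rw [semicircleMoment_even, show 2 * q - 2 * i = 2 * (q - i) by omega,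
      semicircleMoment_even]

end Semicircle

/-! ### Schwinger–Dyson equations for free families -/

section FreeSD

open scoped TensorProduct

variable {N : Type*} [Ring N] [Algebra ℂ N] (ψ : N →ₗ[ℂ] ℂ)

lemma IsFreeFamily.apply_list_prod {I : Type*} {A : I → Subalgebra ℂ N} {ψ : N →ₗ[ℂ] ℂ}
    (hA : IsFreeFamily ψ A) {l : List (I × N)} (hl : l ≠ [])
    (hchain : l.IsChain fun p q => p.1 ≠ q.1) (hmem : ∀ p ∈ l, p.2 ∈ A p.1)
    (h0 : ∀ p ∈ l, ψ p.2 = 0) : ψ (l.map Prod.snd).prod = 0 := by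
  obtain ⟨a, l, rfl⟩ := List.exists_cons_of_ne_nil hl
  have h := hA l.length (fun j => ((a :: l)[j]).1) (fun j => ((a :: l)[j]).2) (fun j => ?_)
    (fun j => hmem _ (List.getElem_mem _)) (fun j => h0 _ (List.getElem_mem _))
  · rwa [show (List.ofFn fun j : Fin (l.length + 1) => ((a :: l)[j]).2) = (a :: l).map Prod.snd
      from ofFn_comp_getElem Prod.snd (a :: l)] at h
  · exact List.isChain_iff_getElem.1 hchain j.1 (by simp)

variable {J : Type*} [DecidableEq J] (e : J → N) (j₀ : J)

/-- Evaluation of a noncommutative polynomial at the letters `e`. -/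
abbrev freeEval : FreeAlgebra ℂ J →ₐ[ℂ] N := FreeAlgebra.lift ℂ e

/-- The homomorphism to upper triangular matrices over `N ⊗ N` whose upper right corner is the free
difference quotient. -/
def triangularEval : FreeAlgebra ℂ J →ₐ[ℂ] Matrix (Fin 2) (Fin 2) (N ⊗[ℂ] N) :=
  FreeAlgebra.lift ℂ fun j => !![e j ⊗ₜ 1, if j = j₀ then 1 else 0; 0, 1 ⊗ₜ e j]

/-- The free difference quotient with respect to the letter `j₀`, evaluated at the letters `e`. -/
def freeDiff (f : FreeAlgebra ℂ J) : N ⊗[ℂ] N := triangularEval e j₀ f 0 1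

lemma triangularEval_eq (f : FreeAlgebra ℂ J) : triangularEval e j₀ f =
    !![freeEval e f ⊗ₜ 1, freeDiff e j₀ f; 0, 1 ⊗ₜ freeEval e f] := by
  suffices h : triangularEval e j₀ f 0 0 = freeEval e f ⊗ₜ 1 ∧ triangularEval e j₀ f 1 0 = 0 ∧
      triangularEval e j₀ f 1 1 = 1 ⊗ₜ freeEval e f by
    ext a b
    fin_cases a <;> fin_cases b <;> simp [h, freeDiff]
  induction f using FreeAlgebra.induction with
  | grade0 r =>
    simp only [AlgHom.commutes, Matrix.algebraMap_matrix_apply]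
    simp [Algebra.algebraMap_eq_smul_one, Algebra.TensorProduct.one_def, TensorProduct.smul_tmul']
  | grade1 j => simp [triangularEval]
  | mul f g hf hg =>
    simp [Matrix.mul_apply, Fin.sum_univ_two, hf, hg]
  | add f g hf hg =>
    simp [hf, hg, TensorProduct.add_tmul, TensorProduct.tmul_add]

lemma freeDiff_one : freeDiff e j₀ 1 = 0 := by simp [freeDiff]

lemma freeDiff_ι (j : J) : freeDiff e j₀ (FreeAlgebra.ι ℂ j) = if j = j₀ then 1 else 0 := by
  simp [freeDiff, triangularEval]

lemma freeDiff_mul (f g : FreeAlgebra ℂ J) : freeDiff e j₀ (f * g) =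
    (freeEval e f ⊗ₜ 1) * freeDiff e j₀ g + freeDiff e j₀ f * (1 ⊗ₜ freeEval e g) := by
  rw [freeDiff, map_mul, triangularEval_eq, triangularEval_eq]
  simp [Matrix.mul_apply, Fin.sum_univ_two]

/-- The free difference quotient as a linear map. -/
def freeDiffLin : FreeAlgebra ℂ J →ₗ[ℂ] N ⊗[ℂ] N where
  toFun := freeDiff e j₀
  map_add' f g := by simp [freeDiff]
  map_smul' c f := by simp [freeDiff]

/-- The functional `ψ ⊗ ψ`. -/
def tensorSq : N ⊗[ℂ] N →ₗ[ℂ] ℂ := LinearMap.mul' ℂ ℂ ∘ₗ TensorProduct.map ψ ψ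

@[simp] lemma tensorSq_tmul (a b : N) : tensorSq ψ (a ⊗ₜ b) = ψ a * ψ b := by simp [tensorSq]

/-- A word as a noncommutative polynomial. -/
abbrev freeWord (w : List J) : FreeAlgebra ℂ J := wordProd (FreeAlgebra.ι ℂ) w

omit [DecidableEq J] in
lemma freeEval_freeWord (w : List J) : freeEval e (freeWord w) = wordProd e w := by
  simp [map_wordProd]

lemma freeDiff_freeWord (w : List J) : freeDiff e j₀ (freeWord w) =
    splitSum j₀ (fun U V => wordProd e U ⊗ₜ wordProd e V) w := by
  induction w with
  | nil => exact freeDiff_one e j₀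
  | cons j w ih =>
    rw [freeWord, wordProd_cons, freeDiff_mul, ← freeWord, ih, freeDiff_ι, freeEval_freeWord,
      splitSum_cons, mul_splitSum, add_comm]
    congr 1
    · split_ifs <;> simp
    · simp

variable {I : Type*} (β : J → I)

/-- The span of the words in the letters of the block `i`. -/
def blockSpan (i : I) : Submodule ℂ (FreeAlgebra ℂ J) :=
  Submodule.span ℂ {f | ∃ w : List J, (∀ j ∈ w, β j = i) ∧ freeWord w = f}

omit [DecidableEq J] in
lemma freeWord_mem_blockSpan {w : List J} {i : I} (h : ∀ j ∈ w, β j = i) :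
    freeWord w ∈ blockSpan β i := Submodule.subset_span ⟨w, h, rfl⟩

omit [DecidableEq J] in
lemma one_mem_blockSpan (i : I) : (1 : FreeAlgebra ℂ J) ∈ blockSpan β i :=
  freeWord_mem_blockSpan β (w := []) (by simp)

omit [DecidableEq J] in
lemma ι_mul_mem_blockSpan {c : FreeAlgebra ℂ J} {j : J} (hc : c ∈ blockSpan β (β j)) :
    FreeAlgebra.ι ℂ j * c ∈ blockSpan β (β j) := by
  induction hc using Submodule.span_induction with
  | mem c hc =>
    obtain ⟨w, hw, rfl⟩ := hc
    exact freeWord_mem_blockSpan β (w := j :: w) (by simpa using hw)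
  | zero => simp
  | add c d _ _ hc hd => rw [mul_add]; exact add_mem hc hd
  | smul r c _ hc => rw [mul_smul_comm]; exact Submodule.smul_mem _ _ hc

/-- A list of centred polynomials from the blocks, neighbours from different blocks. -/
structure IsAlternating (l : List (I × FreeAlgebra ℂ J)) : Prop where
  chain : l.IsChain fun p q => p.1 ≠ q.1
  mem : ∀ p ∈ l, p.2 ∈ blockSpan β p.1
  centred : ∀ p ∈ l, ψ (freeEval e p.2) = 0

/-- The product of the polynomials of a list. -/
abbrev altProd (l : List (I × FreeAlgebra ℂ J)) : FreeAlgebra ℂ J := (l.map Prod.snd).prod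

omit [DecidableEq J] in
lemma altProd_cons (p : I × FreeAlgebra ℂ J) (l : List (I × FreeAlgebra ℂ J)) :
    altProd (p :: l) = p.2 * altProd l := by simp [altProd]

omit [DecidableEq J] in
lemma altProd_concat (p : I × FreeAlgebra ℂ J) (l : List (I × FreeAlgebra ℂ J)) :
    altProd (l ++ [p]) = altProd l * p.2 := by simp [altProd]

variable {ψ e j₀ β} {A : I → Subalgebra ℂ N}

omit [DecidableEq J] in
lemma freeEval_mem {i : I} {c : FreeAlgebra ℂ J} (he : ∀ j, e j ∈ A (β j))
    (hc : c ∈ blockSpan β i) : freeEval e c ∈ A i := by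
  induction hc using Submodule.span_induction with
  | mem c hc =>
    obtain ⟨w, hw, rfl⟩ := hc
    rw [freeEval_freeWord]
    refine Subalgebra.list_prod_mem _ fun a ha => ?_
    obtain ⟨j, hj, rfl⟩ := List.mem_map.1 ha
    exact hw j hj ▸ he j
  | zero => simp
  | add c d _ _ hc hd => rw [map_add]; exact add_mem hc hd
  | smul r c _ hc => rw [map_smul]; exact Subalgebra.smul_mem _ hc _

omit [DecidableEq J] in
lemma IsAlternating.apply_eq_zero (he : ∀ j, e j ∈ A (β j)) (hA : IsFreeFamily ψ A)
    {l : List (I × FreeAlgebra ℂ J)} (hl : IsAlternating ψ e β l) (hne : l ≠ []) :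
    ψ (freeEval e (altProd l)) = 0 := by
  have h := hA.apply_list_prod (l := l.map fun p => (p.1, freeEval e p.2)) (by simpa)
    ((List.isChain_map _).2 hl.chain) (fun p hp => ?_) (fun p hp => ?_)
  · rw [List.map_map] at h
    rwa [altProd, map_list_prod, List.map_map]
  · obtain ⟨q, hq, rfl⟩ := List.mem_map.1 hp
    exact freeEval_mem he (hl.mem q hq)
  · obtain ⟨q, hq, rfl⟩ := List.mem_map.1 hp
    exact hl.centred q hq

/-- The centred part of a polynomial. -/
def centre (ψ : N →ₗ[ℂ] ℂ) (e : J → N) (c : FreeAlgebra ℂ J) : FreeAlgebra ℂ J :=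
  c - ψ (freeEval e c) • 1

omit [DecidableEq J] in
lemma eq_centre_add (ψ : N →ₗ[ℂ] ℂ) (e : J → N) (c : FreeAlgebra ℂ J) :
    c = centre ψ e c + ψ (freeEval e c) • 1 := by simp [centre]

omit [DecidableEq J] in
lemma centre_mem {i : I} {c : FreeAlgebra ℂ J} (hc : c ∈ blockSpan β i) :
    centre ψ e c ∈ blockSpan β i :=
  sub_mem hc (Submodule.smul_mem _ _ (one_mem_blockSpan β i))

omit [DecidableEq J] in
lemma apply_centre (hψ : ψ 1 = 1) (c : FreeAlgebra ℂ J) : ψ (freeEval e (centre ψ e c)) = 0 := by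
  simp [centre, hψ]

omit [DecidableEq J] in
/-- The alternating products span all noncommutative polynomials. -/
lemma freeWord_mem_span_altProd (hψ : ψ 1 = 1) (w : List J) :
    freeWord w ∈ Submodule.span ℂ (altProd '' {l | IsAlternating ψ e β l}) := by
  set S := Submodule.span ℂ (altProd '' {l | IsAlternating ψ e β l})
  have hS : ∀ {l}, IsAlternating ψ e β l → altProd l ∈ S := fun {l} hl =>
    Submodule.subset_span ⟨l, hl, rfl⟩
  suffices h : ∀ (j : J) f, f ∈ S → FreeAlgebra.ι ℂ j * f ∈ S by
    induction w with
    | nil => exact hS (l := []) ⟨by simp, by simp, by simp⟩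
    | cons j w ih => exact h j _ ih
  intro j f hf
  induction hf using Submodule.span_induction with
  | mem f hf =>
    obtain ⟨l, hl, rfl⟩ := hf
    have hj : FreeAlgebra.ι ℂ j ∈ blockSpan β (β j) := by
      simpa using ι_mul_mem_blockSpan β (one_mem_blockSpan β (β j))
    have key : ∀ (c : FreeAlgebra ℂ J) l', c ∈ blockSpan β (β j) → IsAlternating ψ e β l' →
        (∀ p ∈ l'.head?, β j ≠ p.1) → c * altProd l' ∈ S := by
      intro c l' hc hl' hhead
      rw [eq_centre_add ψ e c, add_mul, smul_mul_assoc, one_mul]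
      refine add_mem (hS (l := (β j, centre ψ e c) :: l') ⟨?_, ?_, ?_⟩)
        (Submodule.smul_mem _ _ (hS hl'))
      · exact List.isChain_cons.2 ⟨hhead, hl'.chain⟩
      · simpa using ⟨centre_mem hc, fun a b h => hl'.mem (a, b) h⟩
      · simpa using ⟨apply_centre hψ c, fun a b h => hl'.centred (a, b) h⟩
    rcases l with _ | ⟨⟨i, c⟩, l⟩
    · exact key _ [] hj hl (by simp)
    · by_cases hi : β j = i
      · subst hi
        have hl' : IsAlternating ψ e β l := ⟨hl.chain.tail, fun p hp => hl.mem p (by simp [hp]),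
          fun p hp => hl.centred p (by simp [hp])⟩
        have := key (FreeAlgebra.ι ℂ j * c) l
          (ι_mul_mem_blockSpan β (hl.mem (β j, c) (by simp))) hl' (List.isChain_cons.1 hl.chain).1
        rwa [altProd_cons, ← mul_assoc]
      · exact key _ _ hj hl (by simpa using hi)
  | zero => simp
  | add c d _ _ hc hd => rw [mul_add]; exact add_mem hc hd
  | smul r c _ hc => rw [mul_smul_comm]; exact Submodule.smul_mem _ _ hc

omit [DecidableEq J] in
/-- If the last factor of an alternating product is replaced by an arbitrary polynomial from its
block, the functional still vanishes, as the product of the other factors is centred too. -/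
lemma IsAlternating.apply_mul_eq_zero (hψ : ψ 1 = 1) (he : ∀ j, e j ∈ A (β j))
    (hA : IsFreeFamily ψ A) {l : List (I × FreeAlgebra ℂ J)} {i : I} {c u : FreeAlgebra ℂ J}
    (hl : IsAlternating ψ e β (l ++ [(i, c)])) (hne : l ≠ []) (hu : u ∈ blockSpan β i) :
    ψ (freeEval e (altProd l) * freeEval e u) = 0 := by
  have h1 : IsAlternating ψ e β l := ⟨(List.isChain_append.1 hl.chain).1,
    fun p hp => hl.mem p (by simp [hp]), fun p hp => hl.centred p (by simp [hp])⟩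
  have h2 : IsAlternating ψ e β (l ++ [(i, centre ψ e u)]) := by
    have hch := List.isChain_append.1 hl.chain
    refine ⟨List.isChain_append.2 ⟨hch.1, by simp, ?_⟩, fun p hp => ?_, fun p hp => ?_⟩
    · simpa using hch.2.2
    · rcases List.mem_append.1 hp with hp | hp
      · exact h1.mem p hp
      · rw [List.mem_singleton.1 hp]
        exact centre_mem hu
    · rcases List.mem_append.1 hp with hp | hp
      · exact h1.centred p hp
      · rw [List.mem_singleton.1 hp]
        exact apply_centre hψ u
  have h3 := h2.apply_eq_zero he hA (by simp)
  have h4 := h1.apply_eq_zero he hA hne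
  rw [altProd_concat, map_mul] at h3
  rw [eq_centre_add ψ e u, map_add, mul_add, map_add]
  simpa [h4] using h3

omit [DecidableEq J] in
/-- The same for the first factor of an alternating product. -/
lemma IsAlternating.apply_mul_eq_zero' (hψ : ψ 1 = 1) (he : ∀ j, e j ∈ A (β j))
    (hA : IsFreeFamily ψ A) {l : List (I × FreeAlgebra ℂ J)} {i : I} {c u : FreeAlgebra ℂ J}
    (hl : IsAlternating ψ e β ((i, c) :: l)) (hne : l ≠ []) (hu : u ∈ blockSpan β i) :
    ψ (freeEval e u * freeEval e (altProd l)) = 0 := by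
  have h1 : IsAlternating ψ e β l := ⟨hl.chain.tail,
    fun p hp => hl.mem p (by simp [hp]), fun p hp => hl.centred p (by simp [hp])⟩
  have h2 : IsAlternating ψ e β ((i, centre ψ e u) :: l) := by
    have hch := List.isChain_cons.1 hl.chain
    refine ⟨List.isChain_cons.2 ⟨hch.1, hch.2⟩, fun p hp => ?_, fun p hp => ?_⟩
    · rcases List.mem_cons.1 hp with rfl | hp
      · exact centre_mem hu
      · exact h1.mem p hp
    · rcases List.mem_cons.1 hp with rfl | hp
      · exact apply_centre hψ u
      · exact h1.centred p hp
  have h3 := h2.apply_eq_zero he hA (by simp)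
  have h4 := h1.apply_eq_zero he hA hne
  rw [altProd_cons, map_mul] at h3
  rw [eq_centre_add ψ e u, map_add, add_mul, map_add]
  simpa [h4] using h3

/-- The functional `ψ ⊗ ψ` kills the free difference quotient of an alternating product, unless this
has a single factor, from the block of `j₀`. -/
lemma IsAlternating.tensorSq_freeDiff (hψ : ψ 1 = 1) (he : ∀ j, e j ∈ A (β j))
    (hA : IsFreeFamily ψ A) (l₁ l₂ : List (I × FreeAlgebra ℂ J))
    (hl : IsAlternating ψ e β (l₁ ++ l₂)) (hne : ∀ c, l₁ ++ l₂ ≠ [(β j₀, c)]) :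
    tensorSq ψ ((freeEval e (altProd l₁) ⊗ₜ 1) * freeDiff e j₀ (altProd l₂)) = 0 := by
  induction l₂ generalizing l₁ with
  | nil => rw [show altProd ([] : List (I × FreeAlgebra ℂ J)) = 1 from rfl, freeDiff_one, mul_zero, map_zero]
  | cons p l₂ ih =>
    obtain ⟨i, c⟩ := p
    have hassoc : l₁ ++ (i, c) :: l₂ = (l₁ ++ [(i, c)]) ++ l₂ := by simp
    have h1 := ih (l₁ ++ [(i, c)]) (hassoc ▸ hl) fun c' => hassoc ▸ hne c'
    rw [altProd_cons, freeDiff_mul, mul_add, map_add]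
    rw [altProd_concat, map_mul (freeEval e)] at h1
    rw [← mul_assoc, Algebra.TensorProduct.tmul_mul_tmul, mul_one, h1, zero_add]
    have hl₁ : IsAlternating ψ e β (l₁ ++ [(i, c)]) := by
      rw [hassoc] at hl
      exact ⟨(List.isChain_append.1 hl.chain).1, fun p hp => hl.mem p (List.mem_append_left _ hp),
        fun p hp => hl.centred p (List.mem_append_left _ hp)⟩
    have hl₂ : IsAlternating ψ e β ((i, c) :: l₂) :=
      ⟨(List.isChain_append.1 hl.chain).2.1, fun p hp => hl.mem p (List.mem_append_right _ hp),
        fun p hp => hl.centred p (List.mem_append_right _ hp)⟩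
    have hc : c ∈ blockSpan β i := hl₁.mem (i, c) (by simp)
    change tensorSq ψ ((freeEval e (altProd l₁) ⊗ₜ 1) *
      (freeDiffLin e j₀ c * (1 ⊗ₜ freeEval e (altProd l₂)))) = 0
    clear h1 ih hassoc
    have hne' : ∀ (w U V : List J), (∀ j ∈ w, β j = i) → w = U ++ j₀ :: V →
        ψ (freeEval e (altProd l₁) * wordProd e U) *
          ψ (wordProd e V * freeEval e (altProd l₂)) = 0 := by
      intro w U V hw hUV
      have hi : β j₀ = i := hw j₀ (by simp [hUV])
      rw [← freeEval_freeWord, ← freeEval_freeWord]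
      rcases eq_or_ne l₁ [] with h₁ | h₁
      · rcases eq_or_ne l₂ [] with h₂ | h₂
        · exact absurd (by simp [h₁, h₂, hi]) (hne c)
        · rw [hl₂.apply_mul_eq_zero' hψ he hA h₂
            (freeWord_mem_blockSpan β fun j hj => hw j (by simp [hUV, hj])), mul_zero]
      · rw [hl₁.apply_mul_eq_zero hψ he hA h₁
          (freeWord_mem_blockSpan β fun j hj => hw j (by simp [hUV, hj])), zero_mul]
    clear hl hl₁ hl₂ hne
    induction hc using Submodule.span_induction with
    | mem c hc =>
      obtain ⟨w, hw, rfl⟩ := hc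
      rw [show freeDiffLin e j₀ (freeWord w) = freeDiff e j₀ (freeWord w) from rfl,
        freeDiff_freeWord, splitSum_mul, mul_splitSum, map_splitSum,
        splitSum_congr (g := fun _ _ => 0) fun U V hUV => ?_]
      · simp [splitSum]
      · simpa using hne' w U V hw hUV
    | zero => simp
    | add c d _ _ hc hd => rw [map_add, add_mul, mul_add, map_add, hc, hd, add_zero]
    | smul r c _ hc => rw [map_smul, smul_mul_assoc, mul_smul_comm, map_smul, hc, smul_zero]

/-- The Schwinger–Dyson equation of a letter `j₀` for all words, from that for the words in the
block of `j₀`, if the algebras generated by the blocks of letters are free. -/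
theorem schwingerDyson_of_isFreeFamily (hψ : ψ 1 = 1) (he : ∀ j, e j ∈ A (β j))
    (hA : IsFreeFamily ψ A)
    (hblock : ∀ w : List J, (∀ j ∈ w, β j = β j₀) → ψ (wordProd e (j₀ :: w)) =
      splitSum j₀ (fun U V => ψ (wordProd e U) * ψ (wordProd e V)) w) (w : List J) :
    ψ (wordProd e (j₀ :: w)) =
      splitSum j₀ (fun U V => ψ (wordProd e U) * ψ (wordProd e V)) w := by
  have hword : ∀ w, tensorSq ψ (freeDiff e j₀ (freeWord w)) =
      splitSum j₀ (fun U V => ψ (wordProd e U) * ψ (wordProd e V)) w := fun w => by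
    rw [freeDiff_freeWord, map_splitSum]
    simp_rw [tensorSq_tmul]
  have h0 : ψ (e j₀) = 0 := by simpa using hblock [] (by simp)
  set G₁ : FreeAlgebra ℂ J →ₗ[ℂ] ℂ :=
    ψ ∘ₗ LinearMap.mulLeft ℂ (e j₀) ∘ₗ (freeEval e).toLinearMap
  set G₂ : FreeAlgebra ℂ J →ₗ[ℂ] ℂ := tensorSq ψ ∘ₗ freeDiffLin e j₀
  have hG₁ : ∀ f, G₁ f = ψ (e j₀ * freeEval e f) := fun _ => rfl
  have hG₂ : ∀ f, G₂ f = tensorSq ψ (freeDiff e j₀ f) := fun _ => rfl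
  have hG₁w : ∀ w, G₁ (freeWord w) = ψ (wordProd e (j₀ :: w)) := fun w => by
    rw [hG₁, freeEval_freeWord, wordProd_cons]
  have hb : Set.EqOn G₁ G₂ (blockSpan β (β j₀)) := by
    refine LinearMap.eqOn_span ?_
    rintro _ ⟨w, hw, rfl⟩
    rw [hG₁w, hblock w hw, hG₂, hword]
  have hall : Set.EqOn G₁ G₂ (Submodule.span ℂ (altProd '' {l | IsAlternating ψ e β l})) := by
    refine LinearMap.eqOn_span ?_
    rintro _ ⟨l, hl, rfl⟩
    by_cases hne : ∃ c, l = [(β j₀, c)]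
    · obtain ⟨c, rfl⟩ := hne
      have := hb (hl.mem (β j₀, c) (by simp))
      simpa [altProd] using this
    · push Not at hne
      have h2 := hl.tensorSq_freeDiff hψ he hA [] l hne
      rw [altProd, List.map_nil, List.prod_nil, map_one, ← Algebra.TensorProduct.one_def,
        one_mul] at h2
      rw [hG₂, h2, hG₁]
      have hι : FreeAlgebra.lift ℂ e (FreeAlgebra.ι ℂ j₀) = e j₀ := by simp
      rcases l with _ | ⟨⟨i, c⟩, l⟩
      · simpa [altProd] using h0
      · by_cases hi : i = β j₀
        · subst hi
          have := hl.apply_mul_eq_zero' hψ he hA (fun h => hne c (by rw [h]))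
            (ι_mul_mem_blockSpan β (hl.mem (β j₀, c) (by simp)))
          rwa [map_mul (freeEval e), hι, mul_assoc, ← map_mul (freeEval e), ← altProd_cons (β j₀, c)] at this
        · have hι' : FreeAlgebra.ι ℂ j₀ ∈ blockSpan β (β j₀) := by
            simpa using ι_mul_mem_blockSpan β (one_mem_blockSpan β (β j₀))
          have hl' : IsAlternating ψ e β ((β j₀, FreeAlgebra.ι ℂ j₀) :: (i, c) :: l) := by
            refine ⟨List.isChain_cons.2 ⟨by simpa using Ne.symm hi, hl.chain⟩, fun p hp => ?_,
              fun p hp => ?_⟩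
            · rcases List.mem_cons.1 hp with rfl | hp
              · exact hι'
              · exact hl.mem p hp
            · rcases List.mem_cons.1 hp with rfl | hp
              · simpa using h0
              · exact hl.centred p hp
          have := hl'.apply_eq_zero he hA (by simp)
          rwa [altProd_cons, map_mul, hι] at this
  rw [← hG₁w, hall (freeWord_mem_span_altProd hψ w), hG₂, hword]

omit [DecidableEq J] in
lemma splitSum_map {J' γ : Type*} [DecidableEq J] [DecidableEq J'] [AddCommMonoid γ] {g : J' → J}
    (hg : Function.Injective g) (j : J') (f : List J → List J → γ) (w : List J') :
    splitSum (g j) f (w.map g) = splitSum j (fun U V => f (U.map g) (V.map g)) w := by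
  induction w generalizing f with
  | nil => rfl
  | cons a w ih => simp [splitSum_cons, ih, hg.eq_iff]

omit [DecidableEq J] in
lemma splitSum_replicate {γ : Type*} [DecidableEq J] [AddCommMonoid γ] (j : J)
    (f : List J → List J → γ) (r : ℕ) : splitSum j f (List.replicate r j) =
      ∑ t ∈ Finset.range r, f (List.replicate t j) (List.replicate (r - 1 - t) j) := by
  simp only [splitSum, List.length_replicate, List.take_replicate, List.drop_replicate]
  refine Finset.sum_congr rfl fun t ht => ?_
  have ht := Finset.mem_range.1 ht
  rw [List.getElem?_replicate, if_pos ht, if_pos rfl, min_eq_left ht.le,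
    show r - (t + 1) = r - 1 - t by omega]

/-- The Schwinger–Dyson equations of a semicircular family that is free from `x`. -/
theorem schwingerDyson_semicircular {n : ℕ} [StarRing N] (hψ : ψ 1 = 1) {x s : Fin n → N}
    (hs : IsSemicircularFamily ψ s) (hfree : AreFree ψ x s) (i : Fin n) (w : List (Fin n ⊕ Fin n)) :
    ψ (wordProd (Sum.elim x s) (Sum.inr i :: w)) = splitSum (Sum.inr i)
      (fun U V => ψ (wordProd (Sum.elim x s) U) * ψ (wordProd (Sum.elim x s) V)) w := by
  have hmom : ∀ i p, ψ (s i ^ p) = semicircleMoment p := fun i p => (hs.1 i).2 p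
  have hsingle : ∀ (i : Fin n) (w : List (Fin n)), ψ (wordProd s (i :: w)) =
      splitSum i (fun U V => ψ (wordProd s U) * ψ (wordProd s V)) w := by
    intro i
    refine schwingerDyson_of_isFreeFamily (β := id) hψ
      (fun j => Algebra.self_mem_adjoin_singleton ℂ (s j)) hs.2 fun w hw => ?_
    rw [List.eq_replicate_of_mem (fun j hj => hw j hj : ∀ j ∈ w, j = i)]
    generalize w.length = r
    have hpow : ∀ p, wordProd s (List.replicate p i) = s i ^ p := fun p => by simp [wordProd]
    simp only [id_eq, splitSum_replicate, wordProd_cons, hpow, ← pow_succ', hmom,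
      semicircleMoment_succ]
    push_cast
    rfl
  refine schwingerDyson_of_isFreeFamily (β := Sum.elim (fun _ => (0 : Fin 2)) fun _ => 1) hψ
    (fun j => ?_) hfree (fun w hw => ?_) w
  · rcases j with j | j
    · exact Algebra.subset_adjoin ⟨j, rfl⟩
    · exact Algebra.subset_adjoin ⟨j, rfl⟩
  · obtain ⟨w', rfl⟩ : w ∈ Set.range (List.map (Sum.inr : Fin n → Fin n ⊕ Fin n)) := by
      rw [Set.range_list_map]
      intro j hj
      rcases j with j | j
      · simpa using hw _ hj
      · exact ⟨j, rfl⟩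
    rw [splitSum_map Sum.inr_injective, ← List.map_cons]
    simp only [wordProd_map, Sum.elim_inr]
    exact hsingle i w'

end FreeSD

/-! ### Operator norm and Hilbert–Schmidt norm -/

section MatrixNorms

open scoped Matrix.Norms.L2Operator

variable {k : ℕ}

lemma opNorm_eq (A : Matrix (Fin k) (Fin k) ℂ) : opNorm A = ‖A‖ := by
  rw [opNorm, Matrix.l2_opNorm_toEuclideanCLM]

/-- The square of the (non-normalized) Hilbert–Schmidt norm. -/
def hsSq (A : Matrix (Fin k) (Fin k) ℂ) : ℝ := ∑ a, ∑ b, Complex.normSq (A a b)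

lemma hsSq_nonneg (A : Matrix (Fin k) (Fin k) ℂ) : 0 ≤ hsSq A :=
  Finset.sum_nonneg fun _ _ => Finset.sum_nonneg fun _ _ => Complex.normSq_nonneg _

lemma trace_conjTranspose_mul_self (A : Matrix (Fin k) (Fin k) ℂ) :
    (A.conjTranspose * A).trace = (hsSq A : ℂ) := by
  rw [hsSq, Finset.sum_comm, Matrix.trace]
  push_cast
  refine Finset.sum_congr rfl fun a _ => ?_
  rw [Matrix.diag_apply, Matrix.mul_apply]
  refine Finset.sum_congr rfl fun b _ => ?_
  rw [Complex.normSq_eq_conj_mul_self]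
  rfl

lemma norm_trace_mul_le (A B : Matrix (Fin k) (Fin k) ℂ) :
    ‖(A * B).trace‖ ≤ √(hsSq A) * √(hsSq B) := by
  have h1 : ‖(A * B).trace‖ ≤ ∑ c : Fin k × Fin k, ‖A c.1 c.2‖ * ‖B c.2 c.1‖ := by
    rw [Matrix.trace, Fintype.sum_prod_type]
    refine (norm_sum_le _ _).trans (Finset.sum_le_sum fun a _ => ?_)
    rw [Matrix.diag_apply, Matrix.mul_apply]
    exact (norm_sum_le _ _).trans (Finset.sum_le_sum fun b _ => (norm_mul _ _).le)
  refine h1.trans ((Real.sum_mul_le_sqrt_mul_sqrt _ _ _).trans_eq ?_)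
  congr 2
  · rw [hsSq, Fintype.sum_prod_type]
    simp [Complex.normSq_eq_norm_sq]
  · rw [hsSq, Fintype.sum_prod_type, Finset.sum_comm]
    simp [Complex.normSq_eq_norm_sq]

lemma hsSq_eq_sum_col (A : Matrix (Fin k) (Fin k) ℂ) :
    hsSq A = ∑ b, ‖WithLp.toLp 2 (fun a => A a b)‖ ^ 2 := by
  rw [hsSq, Finset.sum_comm]
  simp_rw [EuclideanSpace.norm_sq_eq, Complex.normSq_eq_norm_sq]

lemma hsSq_mul_le (A B : Matrix (Fin k) (Fin k) ℂ) : hsSq (A * B) ≤ ‖A‖ ^ 2 * hsSq B := by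
  rw [hsSq_eq_sum_col, hsSq_eq_sum_col, Finset.mul_sum]
  refine Finset.sum_le_sum fun b _ => ?_
  rw [← mul_pow]
  refine pow_le_pow_left₀ (norm_nonneg _) ?_ 2
  exact A.l2_opNorm_mulVec (WithLp.toLp 2 fun a => B a b)

lemma hsSq_one : hsSq (1 : Matrix (Fin k) (Fin k) ℂ) = k := by
  have := trace_conjTranspose_mul_self (1 : Matrix (Fin k) (Fin k) ℂ)
  simp only [Matrix.conjTranspose_one, mul_one, Matrix.trace_one, Fintype.card_fin] at this
  exact_mod_cast this.symm

lemma norm_sq_le_hsSq (A : Matrix (Fin k) (Fin k) ℂ) : ‖A‖ ^ 2 ≤ hsSq A := by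
  have h : ‖A‖ ≤ √(hsSq A) := by
    rw [Matrix.l2_opNorm_def]
    refine ContinuousLinearMap.opNorm_le_bound _ (Real.sqrt_nonneg _) fun v => ?_
    rw [EuclideanSpace.norm_eq, EuclideanSpace.norm_eq, ← Real.sqrt_mul (hsSq_nonneg A)]
    refine Real.sqrt_le_sqrt ?_
    rw [hsSq, Finset.sum_mul]
    refine Finset.sum_le_sum fun a _ => ?_
    have h1 : ‖∑ b, A a b * v b‖ ≤ √(∑ b, ‖A a b‖ ^ 2) * √(∑ b, ‖v b‖ ^ 2) :=
      (norm_sum_le _ _).trans ((Finset.sum_le_sum fun b _ => (norm_mul _ _).le).trans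
        (Real.sum_mul_le_sqrt_mul_sqrt _ _ _))
    have h2 := pow_le_pow_left₀ (norm_nonneg _) h1 2
    rw [mul_pow, Real.sq_sqrt (by positivity), Real.sq_sqrt (by positivity)] at h2
    simp_rw [Complex.normSq_eq_norm_sq]
    exact h2
  calc ‖A‖ ^ 2 ≤ √(hsSq A) ^ 2 := pow_le_pow_left₀ (norm_nonneg _) h 2
    _ = hsSq A := Real.sq_sqrt (hsSq_nonneg A)

/-- For the exponents `2 ^ r` the `C*`-identity gives the norm of a power. -/
lemma norm_pow_le_trace {A : Matrix (Fin k) (Fin k) ℂ} (hA : A.IsHermitian) (r : ℕ) :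
    ‖A‖ ^ (2 * 2 ^ r) ≤ (A ^ (2 * 2 ^ r)).trace.re := by
  have hsa : IsSelfAdjoint A := hA
  have h1 : ‖A ^ 2 ^ r‖ = ‖A‖ ^ 2 ^ r := congrArg NNReal.toReal (hsa.nnnorm_pow_two_pow r)
  have h2 := trace_conjTranspose_mul_self (A ^ 2 ^ r)
  rw [Matrix.conjTranspose_pow, hA.eq, ← pow_add, ← two_mul] at h2
  rw [h2, Complex.ofReal_re, mul_comm, pow_mul, ← h1]
  exact norm_sq_le_hsSq _

end MatrixNorms

/-! ### The norm of Gaussian matrices -/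

section GUENorm

variable {n k : ℕ}

lemma one_le_catalan (p : ℕ) : 1 ≤ catalan p := by
  rcases Nat.eq_zero_or_pos (catalan p) with h | h
  · have := succ_mul_catalan_eq_centralBinom p
    rw [h, mul_zero] at this
    exact absurd this.symm (Nat.centralBinom_ne_zero p)
  · exact h

lemma catalan_le_four_pow (p : ℕ) : catalan p ≤ 4 ^ p := by
  have h1 := succ_mul_catalan_eq_centralBinom p
  have h2 : p.centralBinom ≤ 4 ^ p := by
    rw [show 4 = 2 ^ 2 by norm_num, ← pow_mul]
    exact Nat.choose_le_two_pow _ _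
  nlinarith [Nat.zero_le (p * catalan p)]

lemma catalan_le_succ (p : ℕ) : catalan p ≤ catalan (p + 1) := by
  rw [catalan_succ']
  have := Finset.single_le_sum (f := fun ij : ℕ × ℕ => catalan ij.1 * catalan ij.2)
    (fun _ _ => Nat.zero_le _) (Finset.HasAntidiagonal.mem_antidiagonal.2 (show ((0, p) : ℕ × ℕ).1 + (0, p).2 = p by simp))
  simpa using this

/-- The bound for the moments of order `p` of a Gaussian matrix. The factor `2 ^ p` gives room in the
Catalan recursion for the corrections of order `k⁻²` in the Schwinger–Dyson equations. -/
def momentBound (p : ℕ) : ℝ := catalan p * 2 ^ p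

lemma momentBound_pos (p : ℕ) : 0 < momentBound p := by
  have : (0 : ℝ) < catalan p := by exact_mod_cast one_le_catalan p
  unfold momentBound
  positivity

/-- The main term of the Schwinger–Dyson equation for a moment of order `p + 1` takes up a quarter
of its bound. -/
lemma sum_momentBound_le (p : ℕ) :
    ∑ t ∈ Finset.range p, momentBound t * momentBound (p - 1 - t) ≤ momentBound (p + 1) / 4 := by
  rcases p with _ | p
  · simpa using (div_pos (momentBound_pos 1) four_pos).le
  · have h : ∑ t ∈ Finset.range (p + 1), momentBound t * momentBound (p + 1 - 1 - t) =
        catalan (p + 1) * 2 ^ p := by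
      rw [catalan_succ', Finset.Nat.sum_antidiagonal_eq_sum_range_succ
        (fun i j => catalan i * catalan j)]
      push_cast
      rw [Finset.sum_mul]
      refine Finset.sum_congr rfl fun t ht => ?_
      have ht := Finset.mem_range.1 ht
      rw [momentBound, momentBound]
      have hp : (2 : ℝ) ^ p = 2 ^ t * 2 ^ (p - t) := by
        rw [← pow_add, Nat.add_sub_cancel' (by omega)]
      rw [hp]
      ring
    have hc : (catalan (p + 1) : ℝ) ≤ catalan (p + 2) := by exact_mod_cast catalan_le_succ _
    rw [h, momentBound, pow_succ, pow_succ]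
    have : (0 : ℝ) < 2 ^ p := by positivity
    nlinarith

/-- A correction term of the Schwinger–Dyson equation, in which two traces are joined, in terms of
the bounds for these traces. -/
lemma momentBound_add_le {p q D : ℕ} (hq : 0 < q) (hD : p + q ≤ D) :
    momentBound (p + q - 1) ≤ 4 ^ D * (momentBound (p + 1) * momentBound q) / 4 := by
  have h1 : (catalan (p + q - 1) : ℝ) ≤ 4 ^ D := by
    exact_mod_cast (catalan_le_four_pow _).trans (Nat.pow_le_pow_right (by norm_num) (by omega))
  have h2 : (1 : ℝ) ≤ catalan (p + 1) := by exact_mod_cast one_le_catalan _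
  have h3 : (1 : ℝ) ≤ catalan q := by exact_mod_cast one_le_catalan _
  have h4 : (2 : ℝ) ^ (p + 1) * 2 ^ q / 4 = 2 ^ (p + q - 1) := by
    rw [← pow_add, show p + 1 + q = p + q - 1 + 2 by omega, pow_add]
    norm_num
  have h5 : (1 : ℝ) ≤ catalan (p + 1) * catalan q := by nlinarith
  calc momentBound (p + q - 1) ≤ 4 ^ D * 2 ^ (p + q - 1) := by
        unfold momentBound
        gcongr
    _ ≤ 4 ^ D * 2 ^ (p + q - 1) * (catalan (p + 1) * catalan q) :=
        le_mul_of_one_le_right (by positivity) h5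
    _ = _ := by
        rw [← h4]
        unfold momentBound
        ring

lemma gueMoment_nil (hk : 0 < k) (A : Fin n → Matrix (Fin k) (Fin k) ℂ) :
    gueMoment A [] = 1 := by
  rw [gueMoment_eq hk, trProd_nil, gaussExp_one]

lemma gueMoment_nil_cons (hk : 0 < k) (A : Fin n → Matrix (Fin k) (Fin k) ℂ)
    (L : List (List (Fin n ⊕ Fin n))) : gueMoment A ([] :: L) = gueMoment A L := by
  have : (k : ℂ) ≠ 0 := by exact_mod_cast hk.ne'
  simp_rw [gueMoment, trProd_cons, wordProd_nil, ntr, Matrix.trace_one]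
  simp [this]

lemma sum_range_getD (L : List ℕ) : ∑ r ∈ Finset.range L.length, L.getD r 0 = L.sum := by
  induction L with
  | nil => simp
  | cons a L ih =>
    rw [List.length_cons, Finset.sum_range_succ', List.sum_cons, ← ih, add_comm]
    rfl

/-- The moments of a Gaussian matrix of size `k`, up to an order that is logarithmic in `k`, are at
most exponential in the order. This follows from the Schwinger–Dyson equations, in which the
corrections to the Catalan recursion are negligible for such orders. -/
lemma norm_gueMoment_replicate_le (hk : 0 < k) (A : Fin n → Matrix (Fin k) (Fin k) ℂ) (j : Fin n)
    {D : ℕ} (hD : (D : ℝ) * 4 ^ D ≤ (k : ℝ) ^ 2) (L : List ℕ) (hL : L.sum ≤ D) :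
    ‖gueMoment A (L.map fun p => List.replicate p (Sum.inr j))‖ ≤ (L.map momentBound).prod := by
  have hkr : (0 : ℝ) < k := by exact_mod_cast hk
  induction hd : L.sum + L.length using Nat.strong_induction_on generalizing L with
  | _ d ih =>
  subst hd
  have hpos : ∀ L : List ℕ, 0 < (L.map momentBound).prod := fun L =>
    List.prod_pos fun a ha => by
      obtain ⟨p, -, rfl⟩ := List.mem_map.1 ha
      exact momentBound_pos p
  rcases L with _ | ⟨_ | p, L⟩
  · simp [gueMoment_nil hk]
  · rw [List.map_cons, List.replicate_zero, gueMoment_nil_cons hk]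
    have := ih _ (by simp) L (by simpa using hL) rfl
    simpa [momentBound] using this
  · rw [List.sum_cons] at hL
    set rep : ℕ → List (Fin n ⊕ Fin n) := fun p => List.replicate p (Sum.inr j) with hrep
    set W := (L.map momentBound).prod with hW
    rw [List.map_cons, List.map_cons, List.prod_cons, hrep]
    simp only
    rw [List.replicate_succ, gueMoment_schwingerDyson hk, splitSum_replicate, List.length_map]
    have hmain : ‖∑ t ∈ Finset.range p, gueMoment A (List.replicate t (Sum.inr j) ::
        List.replicate (p - 1 - t) (Sum.inr j) :: L.map rep)‖ ≤ momentBound (p + 1) / 4 * W := by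
      refine (norm_sum_le _ _).trans ?_
      refine le_trans ?_ (mul_le_mul_of_nonneg_right (sum_momentBound_le p) (hpos L).le)
      rw [Finset.sum_mul]
      refine Finset.sum_le_sum fun t ht => ?_
      have ht := Finset.mem_range.1 ht
      have := ih _ (by simp; omega) (t :: (p - 1 - t) :: L) (by simp; omega) rfl
      simpa [mul_assoc] using this
    have hcorr : ∀ r ∈ Finset.range L.length,
        ‖splitSum (Sum.inr j) (fun U V => gueMoment A ((List.replicate p (Sum.inr j) ++ V ++ U) ::
          (L.map rep).eraseIdx r)) ((L.map rep).getD r [])‖ ≤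
        (L.getD r 0 : ℝ) * (4 ^ D / 4 * (momentBound (p + 1) * W)) := by
      intro r hr
      have hr := Finset.mem_range.1 hr
      have hget : (L.map rep).getD r [] = List.replicate (L.getD r 0) (Sum.inr j) :=
        List.getD_map L 0 rep (n := r)
      have hsum := sum_map_eraseIdx id L r hr 0
      simp only [id_eq, List.map_id] at hsum
      rw [hget, splitSum_replicate, List.eraseIdx_map]
      refine (norm_sum_le _ _).trans ((Finset.sum_le_card_nsmul _ _ _ fun t ht => ?_).trans_eq
        (by rw [Finset.card_range, nsmul_eq_mul]))
      have ht := Finset.mem_range.1 ht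
      set q := L.getD r 0
      have hlist : List.replicate p (Sum.inr j : Fin n ⊕ Fin n) ++
          List.replicate (q - 1 - t) (Sum.inr j) ++ List.replicate t (Sum.inr j) =
          rep (p + q - 1) := by
        simp only [hrep, ← List.replicate_add]
        congr 1
        omega
      have hprod : momentBound q * ((L.eraseIdx r).map momentBound).prod = W := by
        have hp := ((List.getElem_cons_eraseIdx_perm hr).map momentBound).prod_eq
        rw [List.map_cons, List.prod_cons] at hp
        rw [hW, ← hp]
        congr 2
        exact List.getD_eq_getElem _ _ hr
      have := ih _ (by
        simp only [List.sum_cons, List.length_cons, List.length_eraseIdx, hr, if_true]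
        omega) ((p + q - 1) :: L.eraseIdx r) (by simp only [List.sum_cons]; omega) rfl
      rw [hlist, ← List.map_cons]
      refine this.trans ?_
      rw [List.map_cons, List.prod_cons, ← hprod]
      have h1 := momentBound_add_le (p := p) (q := q) (D := D) (by omega) (by omega)
      refine (mul_le_mul_of_nonneg_right h1 (hpos _).le).trans_eq ?_
      ring
    refine (norm_add_le _ _).trans ?_
    rw [norm_mul, norm_pow, norm_inv, Complex.norm_natCast]
    have hcorr' : ‖∑ r ∈ Finset.range L.length, splitSum (Sum.inr j) (fun U V =>
        gueMoment A ((List.replicate p (Sum.inr j) ++ V ++ U) :: (L.map rep).eraseIdx r))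
          ((L.map rep).getD r [])‖ ≤ (k : ℝ) ^ 2 / 4 * (momentBound (p + 1) * W) := by
      refine (norm_sum_le _ _).trans ((Finset.sum_le_sum hcorr).trans ?_)
      rw [← Finset.sum_mul, ← Nat.cast_sum, sum_range_getD]
      have h1 : (L.sum : ℝ) ≤ D := by exact_mod_cast (by omega : L.sum ≤ D)
      have h2 := mul_pos (momentBound_pos (p + 1)) (hpos L)
      calc (L.sum : ℝ) * (4 ^ D / 4 * (momentBound (p + 1) * W))
          ≤ D * (4 ^ D / 4 * (momentBound (p + 1) * W)) := by gcongr
        _ = (D * 4 ^ D) / 4 * (momentBound (p + 1) * W) := by ring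
        _ ≤ _ := by gcongr
    calc _ ≤ momentBound (p + 1) / 4 * W +
          (k : ℝ)⁻¹ ^ 2 * ((k : ℝ) ^ 2 / 4 * (momentBound (p + 1) * W)) := by gcongr
      _ = momentBound (p + 1) * W / 2 := by
        field_simp
        ring
      _ ≤ _ := by
        have := mul_pos (momentBound_pos (p + 1)) (hpos L)
        linarith

/-- Independent Gaussian matrices are bounded in norm, independently of their size, with
probability at least `3 / 4`. -/
lemma gaussMeasure_opNorm_le (hk : 8 ≤ k) :
    gaussMeasure (Fin n × Fin k × Fin k) (gueVar k)
      {u | ∃ j, 256 * ((n : ℝ) + 1) < opNorm (hermTuple u j)} ≤ 4⁻¹ := by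
  have hk0 : 0 < k := by omega
  have hkr : (0 : ℝ) < k := by exact_mod_cast hk0
  have : NeZero (gueVar k) := ⟨gueVar_ne_zero hk0⟩
  set μ := gaussMeasure (Fin n × Fin k × Fin k) (gueVar k)
  set R : ℝ := 256 * ((n : ℝ) + 1)
  have hR : 0 < R := by positivity
  -- The largest `r` with `8 ^ 2 ^ r ≤ k`.
  obtain ⟨r, hr1, hr2⟩ : ∃ r, 8 ^ 2 ^ r ≤ k ∧ k < 8 ^ (2 * 2 ^ r) := by
    have hex : ∃ r, k < 8 ^ 2 ^ r := ⟨k, (Nat.lt_two_pow_self).trans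
      ((Nat.lt_two_pow_self).trans_le (Nat.pow_le_pow_left (by norm_num) _))⟩
    have h0 : Nat.find hex ≠ 0 := fun h => by
      have := Nat.find_spec hex
      rw [h] at this
      omega
    obtain ⟨r, hr⟩ := Nat.exists_eq_succ_of_ne_zero h0
    refine ⟨r, not_lt.1 (Nat.find_min hex (by omega)), ?_⟩
    have := Nat.find_spec hex
    rwa [hr, Nat.succ_eq_add_one, pow_succ'] at this
  set D := 2 * 2 ^ r with hDdef
  have hDpos : 0 < D := by positivity
  have hD : (D : ℝ) * 4 ^ D ≤ (k : ℝ) ^ 2 := by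
    have h1 : D * 4 ^ D ≤ k ^ 2 := by
      calc D * 4 ^ D ≤ 2 ^ D * 4 ^ D := Nat.mul_le_mul_right _ Nat.lt_two_pow_self.le
        _ = (8 ^ 2 ^ r) ^ 2 := by rw [← mul_pow, ← pow_mul, hDdef, mul_comm (2 ^ r) 2]; norm_num
        _ ≤ k ^ 2 := Nat.pow_le_pow_left hr1 2
    exact_mod_cast h1
  have hone : ∀ j : Fin n, μ {u | R < opNorm (hermTuple u j)} ≤
      ENNReal.ofReal (1 / (4 * (n + 1))) := by
    intro j
    set f : (Fin n × Fin k × Fin k → ℝ) → ℝ := fun u => (hermTuple u j ^ D).trace.re with hf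
    have hfeq : ∀ u, trProd (Sum.elim (fun _ : Fin n => (0 : Matrix (Fin k) (Fin k) ℂ)) (hermTuple u))
        [List.replicate D (Sum.inr j)] = (k : ℂ)⁻¹ * (hermTuple u j ^ D).trace := fun u => by
      simp [trProd, wordProd, ntr]
    have hint0 := integrable_trProd hk0 (fun _ : Fin n => 0) [List.replicate D (Sum.inr j)]
    simp_rw [hfeq] at hint0
    have hfre : ∀ u, f u = k * ((k : ℂ)⁻¹ * (hermTuple u j ^ D).trace).re := fun u => by
      rw [← Complex.re_ofReal_mul, ← mul_assoc]
      have : (k : ℂ) ≠ 0 := by exact_mod_cast hk0.ne'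
      simp [hf, this]
    have hfint : Integrable f μ := by
      simp_rw [funext hfre]
      exact hint0.re.const_mul _
    have hfge : ∀ u, opNorm (hermTuple u j) ^ D ≤ f u := fun u => by
      rw [opNorm_eq]
      exact norm_pow_le_trace (isHermitian_hermTuple u j) r
    have hnn : ∀ u : Fin n × Fin k × Fin k → ℝ, 0 ≤ opNorm (hermTuple u j) := fun u => norm_nonneg _
    have hmarkov := mul_meas_ge_le_integral_of_nonneg (μ := μ) (f := f)
      (Eventually.of_forall fun u => (pow_nonneg (hnn u) D).trans (hfge u)) hfint (R ^ D)
    have hbound : ∫ u, f u ∂μ ≤ 64 ^ D := by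
      have h1 : ∫ u, f u ∂μ = k * (gueMoment (fun _ : Fin n => (0 : Matrix (Fin k) (Fin k) ℂ))
          ([D].map fun p => List.replicate p (Sum.inr j))).re := by
        simp_rw [funext hfre, integral_const_mul]
        rw [List.map_singleton, gueMoment]
        simp_rw [hfeq]
        congr 1
        exact integral_re hint0
      have h2 := norm_gueMoment_replicate_le hk0 (fun _ : Fin n => 0) j hD [D] (by simp)
      have h3 : momentBound D ≤ 8 ^ D := by
        have : (catalan D : ℝ) ≤ 4 ^ D := by exact_mod_cast catalan_le_four_pow D
        calc momentBound D ≤ 4 ^ D * 2 ^ D := by unfold momentBound; gcongr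
          _ = 8 ^ D := by rw [← mul_pow]; norm_num
      have h4 : (k : ℝ) ≤ 8 ^ D := by exact_mod_cast hr2.le
      rw [h1]
      calc _ ≤ (k : ℝ) * momentBound D := by
            gcongr
            exact (Complex.re_le_norm _).trans (by simpa using h2)
        _ ≤ 8 ^ D * 8 ^ D := mul_le_mul h4 h3 (momentBound_pos D).le (by positivity)
        _ = 64 ^ D := by rw [← mul_pow]; norm_num
    have hreal : μ.real {u | R ^ D ≤ f u} ≤ 1 / (4 * (n + 1)) := by
      have h1 : μ.real {u | R ^ D ≤ f u} ≤ (64 / R) ^ D := by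
        rw [div_pow, le_div_iff₀ (by positivity), mul_comm]
        exact hmarkov.trans hbound
      have h64 : 64 / R = 1 / (4 * (n + 1)) := by
        simp only [R]
        field_simp
        norm_num
      rw [h64] at h1
      refine h1.trans (pow_le_of_le_one (by positivity) ?_ hDpos.ne')
      rw [div_le_one (by positivity)]
      have : (0 : ℝ) ≤ n := n.cast_nonneg
      linarith
    calc μ {u | R < opNorm (hermTuple u j)} ≤ μ {u | R ^ D ≤ f u} :=
          measure_mono fun u hu => (pow_le_pow_left₀ hR.le (le_of_lt hu) D).trans (hfge u)
      _ = ENNReal.ofReal (μ.real {u | R ^ D ≤ f u}) := by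
          rw [ofReal_measureReal]
      _ ≤ _ := ENNReal.ofReal_le_ofReal hreal
  have hset : {u : Fin n × Fin k × Fin k → ℝ | ∃ j, R < opNorm (hermTuple u j)} =
      ⋃ j, {u | R < opNorm (hermTuple u j)} := by
    ext u
    simp
  rw [hset]
  refine (measure_iUnion_fintype_le _ _).trans ((Finset.sum_le_sum fun j _ => hone j).trans ?_)
  rw [Finset.sum_const, Finset.card_univ, Fintype.card_fin, ← ENNReal.ofReal_nsmul,
    show (4 : ℝ≥0∞)⁻¹ = ENNReal.ofReal 4⁻¹ by
      rw [ENNReal.ofReal_inv_of_pos (by norm_num)]; norm_num]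
  refine ENNReal.ofReal_le_ofReal ?_
  rw [nsmul_eq_mul]
  field_simp
  linarith

end GUENorm

/-! ### Concentration of the mixed moments -/

section Concentration

variable {n k : ℕ}

lemma star_ntr_wordProd {J : Type*} {Y : J → Matrix (Fin k) (Fin k) ℂ}
    (hY : ∀ j, (Y j).IsHermitian) (w : List J) :
    starRingEnd ℂ (ntr (wordProd Y w)) = ntr (wordProd Y w.reverse) := by
  have h := star_wordProd (e := Y) (fun j => hY j) w
  rw [← h, Matrix.star_eq_conjTranspose, ntr, ntr, Matrix.trace_conjTranspose, map_mul]
  simp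

/-- The second moment of the deviation of a mixed moment from a constant, in terms of moments. -/
lemma integral_norm_sq_sub (hk : 0 < k) {A : Fin n → Matrix (Fin k) (Fin k) ℂ}
    (hA : ∀ j, (A j).IsHermitian) (w : List (Fin n ⊕ Fin n)) (c : ℂ) :
    Integrable (fun u => ‖ntr (wordProd (Sum.elim A (hermTuple u)) w) - c‖ ^ 2)
      (gaussMeasure (Fin n × Fin k × Fin k) (gueVar k)) ∧
    ∫ u, ‖ntr (wordProd (Sum.elim A (hermTuple u)) w) - c‖ ^ 2
      ∂gaussMeasure (Fin n × Fin k × Fin k) (gueVar k) =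
    (gueMoment A [w, w.reverse] - starRingEnd ℂ c * gueMoment A [w] -
      c * gueMoment A [w.reverse] + c * starRingEnd ℂ c).re := by
  set μ := gaussMeasure (Fin n × Fin k × Fin k) (gueVar k)
  have : NeZero (gueVar k) := ⟨gueVar_ne_zero hk⟩
  have hherm : ∀ u : Fin n × Fin k × Fin k → ℝ, ∀ j, (Sum.elim A (hermTuple u) j).IsHermitian :=
    fun u j => by
      rcases j with j | j
      · exact hA j
      · exact isHermitian_hermTuple u j
  set g : (Fin n × Fin k × Fin k → ℝ) → ℂ := fun u =>
    trProd (Sum.elim A (hermTuple u)) [w, w.reverse] -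
      starRingEnd ℂ c * trProd (Sum.elim A (hermTuple u)) [w] -
      c * trProd (Sum.elim A (hermTuple u)) [w.reverse] + c * starRingEnd ℂ c
  have h1 : ∀ u, ‖ntr (wordProd (Sum.elim A (hermTuple u)) w) - c‖ ^ 2 = (g u).re := fun u => by
    have : ((‖ntr (wordProd (Sum.elim A (hermTuple u)) w) - c‖ ^ 2 : ℝ) : ℂ) = g u := by
      rw [← Complex.normSq_eq_norm_sq, ← Complex.mul_conj, map_sub, star_ntr_wordProd (hherm u)]
      simp only [g, trProd_cons, trProd_nil, mul_one]
      ring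
    rw [← this, Complex.ofReal_re]
  have hi := fun L => integrable_trProd hk A L
  have h2 : Integrable (fun u => trProd (Sum.elim A (hermTuple u)) [w, w.reverse] -
      starRingEnd ℂ c * trProd (Sum.elim A (hermTuple u)) [w]) μ :=
    (hi _).sub ((hi _).const_mul _)
  have h3 : Integrable (fun u => trProd (Sum.elim A (hermTuple u)) [w, w.reverse] -
      starRingEnd ℂ c * trProd (Sum.elim A (hermTuple u)) [w] -
      c * trProd (Sum.elim A (hermTuple u)) [w.reverse]) μ := h2.sub ((hi _).const_mul _)
  have hg : Integrable g μ := h3.add (integrable_const _)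
  simp_rw [h1]
  refine ⟨hg.re, (integral_re hg).trans (congrArg Complex.re ?_)⟩
  simp only [g]
  rw [integral_add h3 (integrable_const _), integral_sub h2 ((hi _).const_mul _),
    integral_sub (hi _) ((hi _).const_mul _), integral_const_mul, integral_const_mul,
    integral_const, measureReal_def, gaussMeasure_univ (gueVar_ne_zero hk)]
  simp [gueMoment, μ]

variable {N : Type*} [Ring N] [Algebra ℂ N] {ψ : N →ₗ[ℂ] ℂ} {x s : Fin n → N}

/-- By Chebyshev's inequality: the variance of a mixed moment is a combination of expected products
of traces, and these factorize in the limit. -/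
lemma tendsto_gaussMeasure_deviation (hψ : ψ 1 = 1) (htr : ∀ a b, ψ (a * b) = ψ (b * a))
    (hSD : ∀ i w, ψ (wordProd (Sum.elim x s) (Sum.inr i :: w)) = splitSum (Sum.inr i)
      (fun U V => ψ (wordProd (Sum.elim x s) U) * ψ (wordProd (Sum.elim x s) V)) w)
    (w : List (Fin n ⊕ Fin n)) {γ : ℝ} (hγ : 0 < γ) :
    Tendsto (fun z => gaussMeasure (Fin n × Fin z.1 × Fin z.1) (gueVar z.1)
      {u | γ ≤ ‖ntr (wordProd (Sum.elim z.2 (hermTuple u)) w) -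
        ψ (wordProd (Sum.elim x s) w)‖}) (micFilter ψ x) (𝓝 0) := by
  set c := ψ (wordProd (Sum.elim x s) w)
  have hlim : Tendsto (fun z => (gueMoment z.2 [w, w.reverse] - starRingEnd ℂ c * gueMoment z.2 [w] -
      c * gueMoment z.2 [w.reverse] + c * starRingEnd ℂ c).re) (micFilter ψ x) (𝓝 0) := by
    have h := fun L => tendsto_gueMoment hψ htr hSD L
    have h' := (((h [w, w.reverse]).sub ((h [w]).const_mul (starRingEnd ℂ c))).sub
      ((h [w.reverse]).const_mul c)).add_const (c * starRingEnd ℂ c)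
    have h0 : ([w, w.reverse].map fun w => ψ (wordProd (Sum.elim x s) w)).prod -
        starRingEnd ℂ c * ([w].map fun w => ψ (wordProd (Sum.elim x s) w)).prod -
        c * ([w.reverse].map fun w => ψ (wordProd (Sum.elim x s) w)).prod +
        c * starRingEnd ℂ c = 0 := by
      simp only [List.map_cons, List.map_nil, List.prod_cons, List.prod_nil, mul_one]
      ring
    rw [h0] at h'
    have h'' := (Complex.continuous_re.tendsto _).comp h'
    rwa [Complex.zero_re] at h''
  have hlim2 := ENNReal.tendsto_ofReal ((hlim.const_mul (γ ^ 2)⁻¹))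
  rw [mul_zero, ENNReal.ofReal_zero] at hlim2
  refine tendsto_of_tendsto_of_tendsto_of_le_of_le' tendsto_const_nhds hlim2
    (Eventually.of_forall fun _ => zero_le) ?_
  filter_upwards [tendsto_fst_micFilter.eventually_gt_atTop 0,
    eventually_mem_microstates (ψ := ψ) (x := x) 0 one_pos] with z hz hzA
  have : NeZero (gueVar z.1) := ⟨gueVar_ne_zero hz⟩
  set μ := gaussMeasure (Fin n × Fin z.1 × Fin z.1) (gueVar z.1)
  obtain ⟨hint, heq⟩ := integral_norm_sq_sub hz hzA.1 w c
  have h := mul_meas_ge_le_integral_of_nonneg (μ := μ)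
    (Eventually.of_forall fun u => sq_nonneg ‖ntr (wordProd (Sum.elim z.2 (hermTuple u)) w) - c‖)
    hint (γ ^ 2)
  rw [heq, ← le_inv_mul_iff₀ (by positivity)] at h
  calc _ ≤ μ {u | γ ^ 2 ≤ ‖ntr (wordProd (Sum.elim z.2 (hermTuple u)) w) - c‖ ^ 2} :=
        measure_mono fun u hu => pow_le_pow_left₀ hγ.le hu 2
    _ = ENNReal.ofReal (μ.real _) := by rw [ofReal_measureReal]
    _ ≤ _ := ENNReal.ofReal_le_ofReal h

/-- Along microstates of `x`, independent Gaussian matrices extend them to microstates of `(x, s)`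
of bounded norm, with probability at least `1 / 2`. -/
lemma eventually_le_gaussMeasure (hψ : ψ 1 = 1) (htr : ∀ a b, ψ (a * b) = ψ (b * a))
    (hSD : ∀ i w, ψ (wordProd (Sum.elim x s) (Sum.inr i :: w)) = splitSum (Sum.inr i)
      (fun U V => ψ (wordProd (Sum.elim x s) U) * ψ (wordProd (Sum.elim x s) V)) w)
    (m : ℕ) {γ : ℝ} (hγ : 0 < γ) : ∀ᶠ z in micFilter ψ x,
      2⁻¹ ≤ gaussMeasure (Fin n × Fin z.1 × Fin z.1) (gueVar z.1)
        {u | Sum.elim z.2 (hermTuple u) ∈ microstates ψ (Sum.elim x s) m z.1 γ ∧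
          ∀ j, opNorm (hermTuple u j) ≤ 256 * ((n : ℝ) + 1)} := by
  have hfin : {w : List (Fin n ⊕ Fin n) | w.length ≤ m}.Finite := List.finite_length_le _ m
  have hsum := tendsto_finsetSum hfin.toFinset fun w _ =>
    tendsto_gaussMeasure_deviation hψ htr hSD w hγ
  rw [Finset.sum_const_zero] at hsum
  filter_upwards [hsum.eventually (gt_mem_nhds (show (0 : ℝ≥0∞) < 4⁻¹ by simp)),
    tendsto_fst_micFilter.eventually_ge_atTop 8,
    eventually_mem_microstates (ψ := ψ) (x := x) 0 one_pos] with z h1 hz hzA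
  set μ := gaussMeasure (Fin n × Fin z.1 × Fin z.1) (gueVar z.1)
  set G := {u : Fin n × Fin z.1 × Fin z.1 → ℝ |
    Sum.elim z.2 (hermTuple u) ∈ microstates ψ (Sum.elim x s) m z.1 γ ∧
      ∀ j, opNorm (hermTuple u j) ≤ 256 * ((n : ℝ) + 1)}
  set B₁ := ⋃ w ∈ hfin.toFinset, {u : Fin n × Fin z.1 × Fin z.1 → ℝ |
    γ ≤ ‖ntr (wordProd (Sum.elim z.2 (hermTuple u)) w) - ψ (wordProd (Sum.elim x s) w)‖}
  set B₂ := {u : Fin n × Fin z.1 × Fin z.1 → ℝ |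
    ∃ j, 256 * ((n : ℝ) + 1) < opNorm (hermTuple u j)}
  have hcover : (Set.univ : Set (Fin n × Fin z.1 × Fin z.1 → ℝ)) ⊆ G ∪ (B₁ ∪ B₂) := by
    intro u _
    by_cases hB₁ : u ∈ B₁
    · exact Or.inr (Or.inl hB₁)
    by_cases hB₂ : u ∈ B₂
    · exact Or.inr (Or.inr hB₂)
    refine Or.inl ⟨mem_microstates_iff.2 ⟨fun j => ?_, fun w _ hw => ?_⟩, fun j => ?_⟩
    · rcases j with j | j
      · exact hzA.1 j
      · exact isHermitian_hermTuple u j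
    · by_contra hcon
      exact hB₁ (Set.mem_biUnion (hfin.mem_toFinset.2 hw) (not_lt.1 hcon))
    · by_contra hcon
      exact hB₂ ⟨j, not_le.1 hcon⟩
  have hle : 1 ≤ μ G + (4⁻¹ + 4⁻¹) := by
    rw [← gaussMeasure_univ (σ := Fin n × Fin z.1 × Fin z.1) (gueVar_ne_zero (by omega : 0 < z.1))]
    refine (measure_mono hcover).trans ((measure_union_le _ _).trans ?_)
    gcongr
    refine (measure_union_le _ _).trans (add_le_add ?_ (gaussMeasure_opNorm_le hz))
    exact (measure_biUnion_finset_le _ _).trans h1.le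
  have h4 : (4⁻¹ + 4⁻¹ : ℝ≥0∞) = 2⁻¹ := by
    rw [show (4 : ℝ≥0∞) = 2 * 2 by norm_num, ENNReal.mul_inv (by simp) (by simp), ← mul_add,
      ENNReal.inv_two_add_inv_two, mul_one]
  rw [h4, ← ENNReal.inv_two_add_inv_two] at hle
  exact (ENNReal.add_le_add_iff_right (by simp)).1 hle

end Concentration

/-! ### Polynomial images of microstates -/

section Polynomials

variable {N : Type*} [Ring N] [Algebra ℂ N] {ψ : N →ₗ[ℂ] ℂ} {I I' : Type*} {y : I → N}

lemma mem_blockSpan_const (f : FreeAlgebra ℂ I) : f ∈ blockSpan (fun _ : I => ()) () := by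
  induction f using FreeAlgebra.induction with
  | grade0 r =>
    rw [Algebra.algebraMap_eq_smul_one]
    exact Submodule.smul_mem _ _ (one_mem_blockSpan _ ())
  | grade1 j => simpa using ι_mul_mem_blockSpan (fun _ : I => ()) (j := j) (one_mem_blockSpan _ ())
  | mul f g hf hg =>
    induction hf using Submodule.span_induction with
    | mem f hf =>
      obtain ⟨w, -, rfl⟩ := hf
      induction w with
      | nil => simpa using hg
      | cons j w ih =>
        rw [freeWord, wordProd_cons, mul_assoc]
        exact ι_mul_mem_blockSpan (fun _ : I => ()) ih
    | zero => simp
    | add f f' _ _ hf hf' => rw [add_mul]; exact add_mem hf hf'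
    | smul r f _ hf => rw [smul_mul_assoc]; exact Submodule.smul_mem _ _ hf
  | add f g hf hg => exact add_mem hf hg

lemma ntr_add {k : ℕ} (A B : Matrix (Fin k) (Fin k) ℂ) : ntr (A + B) = ntr A + ntr B := by
  simp [ntr, mul_add]

lemma ntr_smul {k : ℕ} (c : ℂ) (A : Matrix (Fin k) (Fin k) ℂ) : ntr (c • A) = c * ntr A := by
  simp [ntr, mul_left_comm]

lemma tendsto_ntr_freeEval (hψ : ψ 1 = 1) (f : FreeAlgebra ℂ I) :
    Tendsto (fun z => ntr (freeEval z.2 f)) (micFilter ψ y) (𝓝 (ψ (freeEval y f))) := by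
  have hf := mem_blockSpan_const f
  induction hf using Submodule.span_induction with
  | mem f hf =>
    obtain ⟨w, -, rfl⟩ := hf
    simp_rw [freeEval_freeWord]
    exact tendsto_ntr_wordProd hψ w
  | zero => simpa [ntr] using tendsto_const_nhds
  | add f g _ _ hf hg => simpa only [map_add, ntr_add] using hf.add hg
  | smul r f _ hf => simpa only [map_smul, ntr_smul, smul_eq_mul] using hf.const_mul r

/-- Self-adjoint polynomials map microstates to microstates. -/
lemma exists_freeEval_mem_microstates [Finite I'] (hψ : ψ 1 = 1) (P : I' → FreeAlgebra ℂ I)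
    (hP : ∀ (k : ℕ) (C : I → Matrix (Fin k) (Fin k) ℂ), (∀ j, (C j).IsHermitian) →
      ∀ j, (freeEval C (P j)).IsHermitian) (m : ℕ) {γ : ℝ} (hγ : 0 < γ) :
    ∃ (m' : ℕ) (γ' : ℝ), 0 < γ' ∧ ∀ k ≥ m', ∀ C ∈ microstates ψ y m' k γ',
      (fun j => freeEval C (P j)) ∈ microstates ψ (fun j => freeEval y (P j)) m k γ := by
  refine exists_of_eventually_micFilter (p := fun z => (fun j => freeEval z.2 (P j)) ∈
    microstates ψ (fun j => freeEval y (P j)) m z.1 γ) ?_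
  refine eventually_mem_microstates_of_tendsto ?_ (fun w => ?_) m hγ
  · filter_upwards [eventually_mem_microstates (ψ := ψ) (x := y) 0 one_pos] with z hz
    exact hP _ _ hz.1
  · simp_rw [← map_wordProd]
    exact tendsto_ntr_freeEval hψ _

end Polynomials

/-! ### Truncation of microstates -/

section Truncation

open scoped Matrix.Norms.L2Operator

/-- Even moments are bounded by powers of the norm, by positivity of the state. -/
lemma IsTracialState.re_pow_le {M : Type*} [CStarAlgebra M] {φ : M →ₗ[ℂ] ℂ}
    (hφ : IsTracialState φ) {a : M} (ha : IsSelfAdjoint a) {q : ℕ} (hq : 0 < q) :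
    (φ (a ^ (2 * q))).re ≤ ‖a‖ ^ (2 * q) := by
  let _ : PartialOrder M := CStarAlgebra.spectralOrder M
  have _ : StarOrderedRing M := CStarAlgebra.spectralOrderedRing M
  have h1 : star (a ^ q) * a ^ q ≤ algebraMap ℝ M (‖a ^ q‖ ^ 2) :=
    CStarAlgebra.star_mul_le_algebraMap_norm_sq
  obtain ⟨c, hc⟩ := CStarAlgebra.nonneg_iff_eq_star_mul_self.1 (sub_nonneg.2 h1)
  have h2 := hφ.nonneg c
  rw [← hc, map_sub, star_pow, ha.star_eq, ← pow_add, ← two_mul,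
    Algebra.algebraMap_eq_smul_one, ← Complex.coe_smul, map_smul, hφ.map_one, smul_eq_mul,
    mul_one] at h2
  have h3 := (Complex.le_def.1 h2).1
  rw [Complex.zero_re, Complex.sub_re, Complex.ofReal_re, sub_nonneg] at h3
  refine h3.trans ?_
  rw [mul_comm 2 q, pow_mul]
  exact pow_le_pow_left₀ (norm_nonneg _) (norm_pow_le' a hq) 2

variable {k : ℕ}

/-- The clamping of a number `t` to `[-R, R]` matters only if `R ≤ |t|`. -/
lemma sq_sub_clamp_mul_le {R : ℝ} (hR : 0 < R) (t : ℝ) {q : ℕ} (hq : 0 < q) :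
    (t - max (-R) (min R t)) ^ 2 * R ^ (2 * (q - 1)) ≤ t ^ (2 * q) := by
  have hpow : t ^ (2 * q) = t ^ 2 * (t ^ 2) ^ (q - 1) := by
    rw [← pow_succ', Nat.sub_add_cancel hq, pow_mul]
  rw [hpow, pow_mul R]
  rcases le_or_gt (|t|) R with h | h
  · rw [min_eq_right (abs_le.1 h).2, max_eq_right (abs_le.1 h).1, sub_self]
    simpa using by positivity
  · have h2 : R ^ 2 ≤ t ^ 2 := by
      rw [← sq_abs t]
      exact pow_le_pow_left₀ hR.le h.le 2
    have h1 : (t - max (-R) (min R t)) ^ 2 ≤ t ^ 2 := by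
      rcases lt_abs.1 h with h | h
      · rw [min_eq_left h.le, max_eq_right (by linarith)]
        nlinarith
      · rw [min_eq_right (by linarith), max_eq_left (by linarith)]
        nlinarith
    gcongr

/-- The truncation of the spectrum of a self-adjoint matrix to `[-R, R]` changes it little in the
Hilbert–Schmidt norm, if it has small moments compared to `R`. -/
lemma exists_truncation {A : Matrix (Fin k) (Fin k) ℂ} (hA : A.IsHermitian) {R : ℝ} (hR : 0 < R) :
    ∃ B : Matrix (Fin k) (Fin k) ℂ, B.IsHermitian ∧ ‖B‖ ≤ R ∧
      ∀ q, 0 < q → hsSq (A - B) * R ^ (2 * (q - 1)) ≤ (A ^ (2 * q)).trace.re := by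
  set U : Matrix (Fin k) (Fin k) ℂ := (hA.eigenvectorUnitary : Matrix (Fin k) (Fin k) ℂ) with hU
  have hUU : star U * U = 1 := Unitary.coe_star_mul_self hA.eigenvectorUnitary
  have hUU' : U * star U = 1 := Unitary.coe_mul_star_self hA.eigenvectorUnitary
  set F : (Fin k → ℝ) → Matrix (Fin k) (Fin k) ℂ := fun v =>
    U * Matrix.diagonal (fun i => (v i : ℂ)) * star U with hF
  have hFmul : ∀ v w, F v * F w = F (fun i => v i * w i) := fun v w => by
    calc F v * F w = U * Matrix.diagonal (fun i => (v i : ℂ)) * (star U * U) *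
          Matrix.diagonal (fun i => (w i : ℂ)) * star U := by simp only [hF, mul_assoc]
      _ = F (fun i => v i * w i) := by
          rw [hUU, mul_one, mul_assoc U, Matrix.diagonal_mul_diagonal]
          simp [hF]
  have hFpow : ∀ v (p : ℕ), F v ^ p = F (fun i => v i ^ p) := fun v p => by
    induction p with
    | zero => simp [hF, hUU']
    | succ p ih =>
      rw [pow_succ, ih, hFmul]
      simp only [pow_succ]
  have hFtr : ∀ v, (F v).trace.re = ∑ i, v i := fun v => by
    rw [hF]
    simp only
    rw [Matrix.trace_mul_comm, ← mul_assoc, hUU, one_mul, Matrix.trace_diagonal]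
    simp
  have hFherm : ∀ v, (F v).IsHermitian := fun v => by
    simp only [hF, Matrix.IsHermitian, Matrix.conjTranspose_mul, Matrix.star_eq_conjTranspose,
      Matrix.conjTranspose_conjTranspose, Matrix.diagonal_conjTranspose, mul_assoc]
    congr 3
    ext i
    simp
  have hFsub : ∀ v w, F v - F w = F (fun i => v i - w i) := fun v w => by
    simp only [hF, ← sub_mul, ← mul_sub, Matrix.diagonal_sub]
    simp
  have hAF : A = F hA.eigenvalues := by
    conv_lhs => rw [hA.spectral_theorem]
    rfl
  set lam := hA.eigenvalues
  set f : Fin k → ℝ := fun i => max (-R) (min R (lam i)) with hf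
  refine ⟨F f, hFherm f, ?_, fun q hq => ?_⟩
  · have h1 : ‖F f‖ = ‖Matrix.diagonal fun i => (f i : ℂ)‖ := by
      simp only [hF]
      rw [hU, ← Unitary.coe_star, CStarRing.norm_mul_coe_unitary, CStarRing.norm_coe_unitary_mul]
    rw [h1, Matrix.l2_opNorm_diagonal]
    refine (pi_norm_le_iff_of_nonneg hR.le).2 fun i => ?_
    rw [Complex.norm_real, Real.norm_eq_abs, abs_le]
    exact ⟨le_max_left _ _, max_le (by linarith) (min_le_left _ _)⟩
  · have h1 : hsSq (A - F f) = ∑ i, (lam i - f i) ^ 2 := by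
      have h2 := trace_conjTranspose_mul_self (A - F f)
      rw [(hA.sub (hFherm f)).eq] at h2
      rw [← Complex.ofReal_re (hsSq (A - F f)), ← h2, hAF, hFsub, hFmul, hFtr]
      simp only [sq]
    rw [h1, hAF, hFpow, hFtr, Finset.sum_mul]
    exact Finset.sum_le_sum fun i _ => sq_sub_clamp_mul_le hR _ hq

lemma dist₂_eq {I : Type*} [Fintype I] {A B : I → Matrix (Fin k) (Fin k) ℂ}
    (hA : ∀ j, (A j).IsHermitian) (hB : ∀ j, (B j).IsHermitian) :
    dist₂ A B = √(∑ j, (k : ℝ)⁻¹ * hsSq (A j - B j)) := by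
  rw [dist₂]
  simp_rw [re_normTrace_sq ((hA _).sub (hB _))]
  rfl

lemma hsSq_wordProd_mul_le {I : Type*} {B : I → Matrix (Fin k) (Fin k) ℂ} {R : ℝ}
    (hB : ∀ j, ‖B j‖ ≤ R) (u : List I) (D : Matrix (Fin k) (Fin k) ℂ) :
    hsSq (wordProd B u * D) ≤ (R ^ 2) ^ u.length * hsSq D := by
  induction u with
  | nil => simp
  | cons j u ih =>
    rw [wordProd_cons, mul_assoc, List.length_cons, pow_succ', mul_assoc]
    refine (hsSq_mul_le _ _).trans (mul_le_mul ?_ ih (hsSq_nonneg _) (sq_nonneg _))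
    exact pow_le_pow_left₀ (norm_nonneg _) (hB j) 2

/-- Microstates without bound on the norm are close to microstates with norm at most `R`, if `R`
exceeds the norms of the `x j`. -/
lemma exists_close_microstatesCutoff {M : Type*} [CStarAlgebra M] {φ : M →ₗ[ℂ] ℂ}
    (hφ : IsTracialState φ) {I : Type*} [Fintype I] {x : I → M} (hx : ∀ j, IsSelfAdjoint (x j))
    {R : ℝ} (hR : 0 < R) (hxR : ∀ j, ‖x j‖ < R) (m : ℕ) {γ η : ℝ} (hγ : 0 < γ) (hη : 0 < η) :
    ∃ (m' : ℕ) (γ' : ℝ), 0 < γ' ∧ ∀ k ≥ m', ∀ A ∈ microstates φ x m' k γ',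
      ∃ B ∈ microstatesCutoff φ x R m k γ, dist₂ A B < η := by
  have hex : ∀ (k : ℕ) (A : Matrix (Fin k) (Fin k) ℂ), ∃ B : Matrix (Fin k) (Fin k) ℂ,
      A.IsHermitian → B.IsHermitian ∧ ‖B‖ ≤ R ∧
        ∀ q, 0 < q → hsSq (A - B) * R ^ (2 * (q - 1)) ≤ (A ^ (2 * q)).trace.re := fun k A => by
    by_cases hA : A.IsHermitian
    · obtain ⟨B, hB⟩ := exists_truncation hA hR
      exact ⟨B, fun _ => hB⟩
    · exact ⟨0, fun h => absurd h hA⟩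
  choose T hT using hex
  set F := micFilter φ x
  have hherm : ∀ᶠ z in F, ∀ j, (z.2 j).IsHermitian :=
    (eventually_mem_microstates 0 one_pos).mono fun z hz => hz.1
  have hk : ∀ᶠ z in F, 0 < z.1 := tendsto_fst_micFilter.eventually_gt_atTop 0
  have hψ := hφ.map_one
  set δ : (Σ k : ℕ, I → Matrix (Fin k) (Fin k) ℂ) → I → ℝ := fun z j =>
    (z.1 : ℝ)⁻¹ * hsSq (z.2 j - T z.1 (z.2 j)) with hδ
  have hδ0 : ∀ z j, 0 ≤ δ z j := fun z j => mul_nonneg (by positivity) (hsSq_nonneg _)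
  have hδlim : ∀ j, Tendsto (fun z => δ z j) F (𝓝 0) := by
    intro j
    refine tendsto_order.2 ⟨fun a ha => Eventually.of_forall fun z => ha.trans_le (hδ0 z j),
      fun a ha => ?_⟩
    -- The truncation error is at most `R ^ 2 (‖x j‖ / R) ^ (2 q)` in the limit.
    obtain ⟨q, hq0, hq⟩ : ∃ q : ℕ, 0 < q ∧ ‖x j‖ ^ (2 * q) < a * R ^ (2 * (q - 1)) := by
      have hlt : (‖x j‖ / R) ^ 2 < 1 := by
        rw [sq_lt_one_iff₀ (by positivity), div_lt_one hR]
        exact hxR j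
      obtain ⟨q, hq⟩ := exists_pow_lt_of_lt_one (show 0 < a / R ^ 2 by positivity) hlt
      refine ⟨q + 1, by omega, ?_⟩
      have h1 : ((‖x j‖ / R) ^ 2) ^ (q + 1) < a / R ^ 2 :=
        (pow_le_pow_of_le_one (by positivity) hlt.le (by omega)).trans_lt hq
      rw [← pow_mul, div_pow, div_lt_div_iff₀ (by positivity) (by positivity)] at h1
      have hRp : R ^ (2 * (q + 1)) = R ^ (2 * q) * R ^ 2 := by ring
      rw [hRp, ← mul_assoc] at h1
      simpa using lt_of_mul_lt_mul_right h1 (by positivity)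
    have hlim := (Complex.continuous_re.tendsto _).comp
      (tendsto_ntr_wordProd (x := x) hψ (List.replicate (2 * q) j))
    rw [show wordProd x (List.replicate (2 * q) j) = x j ^ (2 * q) by simp [wordProd]] at hlim
    have hlt := (hφ.re_pow_le (hx j) hq0).trans_lt hq
    filter_upwards [hlim.eventually (gt_mem_nhds hlt), hherm] with z hz hzA
    have h1 := (hT z.1 (z.2 j) (hzA j)).2.2 q hq0
    have h2 : (ntr (wordProd z.2 (List.replicate (2 * q) j))).re =
        (z.1 : ℝ)⁻¹ * (z.2 j ^ (2 * q)).trace.re := by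
      rw [show wordProd z.2 (List.replicate (2 * q) j) = z.2 j ^ (2 * q) by simp [wordProd], ntr,
        ← Complex.re_ofReal_mul]
      simp
    simp only [Function.comp_apply, h2] at hz
    have h3 : δ z j * R ^ (2 * (q - 1)) < a * R ^ (2 * (q - 1)) := by
      refine lt_of_le_of_lt ?_ hz
      rw [hδ]
      simp only
      rw [mul_assoc]
      gcongr
    exact lt_of_mul_lt_mul_right h3 (by positivity)
  set B : ∀ z : (Σ k : ℕ, I → Matrix (Fin k) (Fin k) ℂ), I → Matrix (Fin z.1) (Fin z.1) ℂ :=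
    fun z j => T z.1 (z.2 j) with hB
  -- The letters of a word are replaced by their truncations one after another.
  have hrepl : ∀ w u : List I, Tendsto (fun z => ntr (wordProd (B z) u * wordProd z.2 w) -
      ntr (wordProd (B z) (u ++ w))) F (𝓝 0) := by
    intro w
    induction w with
    | nil =>
      intro u
      simpa using tendsto_const_nhds
    | cons j w ih =>
      intro u
      have hbound : Tendsto (fun z => R ^ u.length * (√(δ z j) *
          √(ntr (wordProd z.2 (w.reverse ++ w))).re)) F (𝓝 0) := by
        have h1 := (Real.continuous_sqrt.tendsto _).comp (hδlim j)
        have h2 := (Real.continuous_sqrt.tendsto _).comp ((Complex.continuous_re.tendsto _).comp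
          (tendsto_ntr_wordProd (x := x) hψ (w.reverse ++ w)))
        have h3 := (h1.mul h2).const_mul (R ^ u.length)
        simpa using h3
      have hfirst : Tendsto (fun z => ntr (wordProd (B z) u * (z.2 j - B z j) * wordProd z.2 w)) F
          (𝓝 0) := by
        refine squeeze_zero_norm' ?_ hbound
        filter_upwards [hherm, hk] with z hz hzk
        have hzk' : (0 : ℝ) < z.1 := by exact_mod_cast hzk
        have hw : (ntr (wordProd z.2 (w.reverse ++ w))).re = (z.1 : ℝ)⁻¹ * hsSq (wordProd z.2 w) := by
          rw [wordProd_append, ← star_wordProd (e := z.2) fun j => hz j,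
            Matrix.star_eq_conjTranspose, ntr, trace_conjTranspose_mul_self]
          simp [← Complex.ofReal_natCast, ← Complex.ofReal_inv, ← Complex.ofReal_mul]
        have h1 := norm_trace_mul_le (wordProd (B z) u * (z.2 j - B z j)) (wordProd z.2 w)
        have h2 := hsSq_wordProd_mul_le (B := B z) (R := R)
          (fun j => (hT z.1 (z.2 j) (hz j)).2.1) u (z.2 j - B z j)
        have h3 : √(hsSq (wordProd (B z) u * (z.2 j - B z j))) ≤
            R ^ u.length * √(hsSq (z.2 j - B z j)) := by
          refine (Real.sqrt_le_sqrt h2).trans_eq ?_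
          rw [Real.sqrt_mul (by positivity), ← pow_mul, mul_comm 2, pow_mul,
            Real.sqrt_sq (by positivity)]
        rw [hw, ntr, norm_mul, Algebra.algebraMap_self, RingHom.id_apply,
          norm_inv, Complex.norm_natCast]
        simp only [hδ]
        rw [Real.sqrt_mul (by positivity), Real.sqrt_mul (by positivity)]
        calc (z.1 : ℝ)⁻¹ * _ ≤ (z.1 : ℝ)⁻¹ * (R ^ u.length * √(hsSq (z.2 j - B z j)) *
              √(hsSq (wordProd z.2 w))) := by
              gcongr
              exact h1.trans (by gcongr)
          _ = R ^ u.length * (√(z.1 : ℝ)⁻¹ * √(z.1 : ℝ)⁻¹ * √(hsSq (z.2 j - B z j)) *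
              √(hsSq (wordProd z.2 w))) := by
              rw [Real.mul_self_sqrt (by positivity)]
              ring
          _ = _ := by ring
      have hsum := hfirst.add (ih (u ++ [j]))
      rw [add_zero] at hsum
      refine hsum.congr fun z => ?_
      have hsplit : wordProd (B z) u * wordProd z.2 (j :: w) =
          wordProd (B z) u * (z.2 j - B z j) * wordProd z.2 w +
            wordProd (B z) (u ++ [j]) * wordProd z.2 w := by
        simp only [wordProd_cons, wordProd_append, wordProd_nil, mul_one]
        noncomm_ring
      rw [hsplit, ntr_add, List.append_assoc, List.singleton_append]
      ring
  have hmom : ∀ w, Tendsto (fun z => ntr (wordProd (B z) w)) F (𝓝 (φ (wordProd x w))) := by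
    intro w
    have h := (tendsto_ntr_wordProd (x := x) hψ w).sub (hrepl w [])
    rw [sub_zero] at h
    refine h.congr fun z => ?_
    simp
  have hBherm : ∀ᶠ z in F, ∀ j, (B z j).IsHermitian :=
    hherm.mono fun z hz j => (hT z.1 (z.2 j) (hz j)).1
  have hmic := eventually_mem_microstates_of_tendsto hBherm hmom m hγ
  have hdist : Tendsto (fun z => √(∑ j, δ z j)) F (𝓝 0) := by
    have h := (Real.continuous_sqrt.tendsto _).comp (tendsto_finsetSum Finset.univ fun j _ => hδlim j)
    simp only [Finset.sum_const_zero, Real.sqrt_zero] at h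
    exact h
  obtain ⟨m', γ', hγ', h⟩ := exists_of_eventually_micFilter (p := fun z =>
    ∃ B ∈ microstatesCutoff φ x R m z.1 γ, dist₂ z.2 B < η) (by
      filter_upwards [hmic, hdist.eventually (gt_mem_nhds hη), hherm, hBherm] with z h1 h2 h3 h4
      refine ⟨B z, ⟨h1, fun j => ?_⟩, ?_⟩
      · rw [opNorm_eq]
        exact (hT z.1 (z.2 j) (h3 j)).2.1
      · rwa [dist₂_eq h3 h4])
  exact ⟨m', γ', hγ', h⟩

end Truncation

/-! ### Packing and covering numbers -/

section Metric

variable {α : Type*} {d : α → α → ℝ} {S S' : Set α} {ε : ℝ}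

/-- The function `d` is a pseudometric on the set `S`; nothing is required outside of `S`. -/
structure IsDistOn (d : α → α → ℝ) (S : Set α) : Prop where
  self : ∀ a ∈ S, d a a = 0
  symm : ∀ a ∈ S, ∀ b ∈ S, d a b = d b a
  triangle : ∀ a ∈ S, ∀ b ∈ S, ∀ c ∈ S, d a c ≤ d a b + d b c

lemma IsDistOn.mono (h : IsDistOn d S') (hS : S ⊆ S') : IsDistOn d S :=
  ⟨fun a ha => h.self a (hS ha), fun a ha b hb => h.symm a (hS ha) b (hS hb),
    fun a ha b hb c hc => h.triangle a (hS ha) b (hS hb) c (hS hc)⟩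

lemma IsDistOn.le_of_pairwiseDisjoint (hd : IsDistOn d S) (hε : 0 < ε) {T : Set α} (hT : T ⊆ S)
    (hdisj : T.PairwiseDisjoint (ballIn d S ε)) {a b : α} (ha : a ∈ T) (hb : b ∈ T)
    (hab : a ≠ b) : ε ≤ d a b := by
  by_contra! h
  have hb' : b ∈ ballIn d S ε b := ⟨hT hb, by rwa [hd.self b (hT hb)]⟩
  exact Set.disjoint_left.1 (hdisj ha hb hab) (show b ∈ ballIn d S ε a from ⟨hT hb, h⟩) hb'

/-- A maximal family of disjoint balls yields a cover by balls of twice the radius. -/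
lemma IsDistOn.coveringNumber_le_packingNumber (hd : IsDistOn d S) (hε : 0 < ε) :
    coveringNumber d S (2 * ε) ≤ packingNumber d S ε := by
  obtain ⟨T, hT⟩ := zorn_subset {T : Set α | T ⊆ S ∧ T.PairwiseDisjoint (ballIn d S ε)} (by
    intro c hc hchain
    refine ⟨⋃₀ c, ⟨Set.sUnion_subset fun t ht => (hc ht).1, ?_⟩,
      fun s hs => Set.subset_sUnion_of_mem hs⟩
    exact (Set.pairwiseDisjoint_sUnion hchain.directedOn).2 fun t ht => (hc ht).2)
  obtain ⟨hTS, hdisj⟩ := hT.prop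
  have hcover : S ⊆ ⋃ a ∈ T, ballIn d S (2 * ε) a := by
    intro b hb
    by_contra hnot
    simp only [Set.mem_iUnion, not_exists] at hnot
    have hfar : ∀ a ∈ T, 2 * ε ≤ d a b := fun a ha => by
      by_contra! h
      exact hnot a ha ⟨hb, h⟩
    have hins : insert b T ∈ {T : Set α | T ⊆ S ∧ T.PairwiseDisjoint (ballIn d S ε)} := by
      refine ⟨Set.insert_subset hb hTS, hdisj.insert fun a ha _ => ?_⟩
      refine Set.disjoint_left.2 fun c hc hc' => ?_
      have h1 := hd.triangle a (hTS ha) c hc.1 b hb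
      rw [hd.symm c hc.1 b hb] at h1
      linarith [hfar a ha, hc.2, hc'.2]
    have hbT : b ∈ T := hT.le_of_ge hins (Set.subset_insert b T) (Set.mem_insert b T)
    have := hfar b hbT
    rw [hd.self b hb] at this
    linarith
  exact (iInf₂_le_of_le T hTS (iInf_le _ hcover)).trans
    (le_iSup₂_of_le T hTS (le_iSup (fun _ : T.PairwiseDisjoint (ballIn d S ε) => T.encard) hdisj))

/-- Two centres of disjoint `ε`-balls do not lie in one `ε / 2`-ball. -/
lemma IsDistOn.packingNumber_le_coveringNumber (hd : IsDistOn d S) (hε : 0 < ε) :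
    packingNumber d S ε ≤ coveringNumber d S (ε / 2) := by
  refine iSup₂_le fun T hTS => iSup_le fun hdisj => le_iInf₂ fun C hCS => le_iInf fun hC => ?_
  have hex : ∀ a : α, ∃ c, a ∈ T → c ∈ C ∧ d c a < ε / 2 := fun a => by
    by_cases ha : a ∈ T
    · have := hC (hTS ha)
      simp only [Set.mem_iUnion] at this
      obtain ⟨c, hc, h⟩ := this
      exact ⟨c, fun _ => ⟨hc, h.2⟩⟩
    · exact ⟨a, fun h => absurd h ha⟩
  choose f hf using hex
  refine Set.encard_le_encard_of_injOn (f := f) (fun a ha => (hf a ha).1) fun a ha b hb hab => ?_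
  by_contra hne
  have h1 := hd.le_of_pairwiseDisjoint hε hTS hdisj ha hb hne
  have hfa := hCS (hf a ha).1
  have h2 := hd.triangle a (hTS ha) (f a) hfa b (hTS hb)
  rw [hd.symm a (hTS ha) (f a) hfa] at h2
  have h3 := (hf b hb).2
  rw [← hab] at h3
  linarith [(hf a ha).2]

/-- Disjoint balls in `S` give disjoint smaller balls in any `S'` that comes close to all points
of `S`. -/
lemma IsDistOn.packingNumber_le_of_close (hd : IsDistOn d (S ∪ S')) (hε : 0 < ε)
    (hclose : ∀ a ∈ S, ∃ b ∈ S', d a b < ε / 4) :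
    packingNumber d S ε ≤ packingNumber d S' (ε / 4) := by
  refine iSup₂_le fun T hTS => iSup_le fun hdisj => ?_
  have hex : ∀ a : α, ∃ b, a ∈ T → b ∈ S' ∧ d a b < ε / 4 := fun a => by
    by_cases ha : a ∈ T
    · obtain ⟨b, hb⟩ := hclose a (hTS ha)
      exact ⟨b, fun _ => hb⟩
    · exact ⟨a, fun h => absurd h ha⟩
  choose f hf using hex
  have hfS : ∀ a ∈ T, f a ∈ S ∪ S' := fun a ha => Or.inr (hf a ha).1
  have hTS' : ∀ a ∈ T, a ∈ S ∪ S' := fun a ha => Or.inl (hTS ha)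
  have hfar : ∀ a ∈ T, ∀ b ∈ T, a ≠ b → ε / 2 < d (f a) (f b) := fun a ha b hb hab => by
    have h1 := (hd.mono Set.subset_union_left).le_of_pairwiseDisjoint hε hTS hdisj ha hb hab
    have h2 := hd.triangle a (hTS' a ha) (f a) (hfS a ha) b (hTS' b hb)
    have h3 := hd.triangle (f a) (hfS a ha) (f b) (hfS b hb) b (hTS' b hb)
    rw [hd.symm (f b) (hfS b hb) b (hTS' b hb)] at h3
    linarith [(hf a ha).2, (hf b hb).2]
  have hinj : Set.InjOn f T := fun a ha b hb hab => by
    by_contra hne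
    have := hfar a ha b hb hne
    rw [hab, hd.self _ (hfS b hb)] at this
    linarith
  rw [← hinj.encard_image]
  have hsub : f '' T ⊆ S' := by
    rintro _ ⟨a, ha, rfl⟩
    exact (hf a ha).1
  have hdisj' : (f '' T).PairwiseDisjoint (ballIn d S' (ε / 4)) := by
    rintro _ ⟨a, ha, rfl⟩ _ ⟨b, hb, rfl⟩ hab
    refine Set.disjoint_left.2 fun c hc hc' => ?_
    have hcS : c ∈ S ∪ S' := Or.inr hc.1
    have h1 := hfar a ha b hb fun h => hab (by rw [h])
    have h2 := hd.triangle (f a) (hfS a ha) c hcS (f b) (hfS b hb)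
    rw [hd.symm c hcS (f b) (hfS b hb)] at h2
    linarith [hc.2, hc'.2]
  exact le_iSup₂_of_le (f '' T) hsub
    (le_iSup (fun _ : (f '' T).PairwiseDisjoint (ballIn d S' (ε / 4)) => (f '' T).encard) hdisj')

end Metric

section Comparison

variable {I : Type*} [Fintype I]

lemma isDistOn_dist₂ (k : ℕ) :
    IsDistOn dist₂ {A : I → Matrix (Fin k) (Fin k) ℂ | ∀ j, (A j).IsHermitian} := by
  have key : ∀ u w : I × Fin k × Fin k → ℝ, dist₂ (hermTuple u) (hermTuple w) =
      √((k : ℝ)⁻¹) * dist (WithLp.toLp 2 u) (WithLp.toLp 2 w) := fun u w => by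
    rw [dist₂_hermTuple, Real.sqrt_mul (by positivity), EuclideanSpace.dist_eq]
    simp [Real.dist_eq]
  refine ⟨fun A hA => ?_, fun A hA B hB => ?_, fun A hA B hB C hC => ?_⟩
  · obtain ⟨u, rfl⟩ := exists_hermTuple_eq hA
    rw [key, dist_self, mul_zero]
  · obtain ⟨u, rfl⟩ := exists_hermTuple_eq hA
    obtain ⟨v, rfl⟩ := exists_hermTuple_eq hB
    rw [key, key, dist_comm]
  · obtain ⟨u, rfl⟩ := exists_hermTuple_eq hA
    obtain ⟨v, rfl⟩ := exists_hermTuple_eq hB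
    obtain ⟨w, rfl⟩ := exists_hermTuple_eq hC
    rw [key, key, key, ← mul_add]
    gcongr
    exact dist_triangle _ _ _

lemma growthRate_mono {N N' : ℕ → ℕ∞} (h : ∀ᶠ k in atTop, N k ≤ N' k) :
    growthRate N ≤ growthRate N' := by
  refine limsup_le_limsup (h.mono fun k hk => ?_)
  have : ENNReal.log (N k : ℝ≥0∞) ≤ ENNReal.log (N' k : ℝ≥0∞) :=
    ENNReal.log_le_log (by exact_mod_cast hk)
  exact mul_le_mul_of_nonneg_left this (by exact_mod_cast (by positivity))

variable {M : Type*}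

section Ring

variable [Ring M] [Algebra ℂ M] {φ : M →ₗ[ℂ] ℂ} {x : I → M} {ε : ℝ}

lemma isDistOn_microstates (m k : ℕ) (γ : ℝ) : IsDistOn dist₂ (microstates φ x m k γ) :=
  (isDistOn_dist₂ k).mono fun _ hA => hA.1

lemma isDistOn_microstatesCutoff (R : ℝ) (m k : ℕ) (γ : ℝ) :
    IsDistOn dist₂ (microstatesCutoff φ x R m k γ) :=
  (isDistOn_dist₂ k).mono fun _ hA => hA.1.1

lemma coveringInfty_le_packingInfty (hε : 0 < ε) :
    coveringInfty φ x (2 * ε) ≤ packingInfty φ x ε :=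
  iInf₂_mono fun m γ => iInf_mono fun _ => growthRate_mono <| Eventually.of_forall fun k =>
    (isDistOn_microstates m k γ).coveringNumber_le_packingNumber hε

lemma packingInfty_le_coveringInfty (hε : 0 < ε) :
    packingInfty φ x ε ≤ coveringInfty φ x (ε / 2) :=
  iInf₂_mono fun m γ => iInf_mono fun _ => growthRate_mono <| Eventually.of_forall fun k =>
    (isDistOn_microstates m k γ).packingNumber_le_coveringNumber hε

lemma covering_le_packing (hε : 0 < ε) : covering φ x (2 * ε) ≤ packing φ x ε :=
  iSup₂_mono fun R _ => iInf₂_mono fun m γ => iInf_mono fun _ => growthRate_mono <|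
    Eventually.of_forall fun k =>
      (isDistOn_microstatesCutoff R m k γ).coveringNumber_le_packingNumber hε

lemma packing_le_covering (hε : 0 < ε) : packing φ x ε ≤ covering φ x (ε / 2) :=
  iSup₂_mono fun R _ => iInf₂_mono fun m γ => iInf_mono fun _ => growthRate_mono <|
    Eventually.of_forall fun k =>
      (isDistOn_microstatesCutoff R m k γ).packingNumber_le_coveringNumber hε

lemma packing_le_packingInfty (hε : 0 < ε) : packing φ x ε ≤ packingInfty φ x (ε / 4) := by
  refine iSup₂_le fun R _ => iInf₂_mono fun m γ => iInf_mono fun _ => growthRate_mono <|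
    Eventually.of_forall fun k => ?_
  refine IsDistOn.packingNumber_le_of_close ?_ hε fun A hA => ⟨A, hA.1, ?_⟩
  · exact (isDistOn_microstates m k γ).mono (Set.union_subset (fun A hA => hA.1) subset_rfl)
  · rw [(isDistOn_microstates m k γ).self A hA.1]
    positivity

end Ring

lemma norm_lt_sum_norm_add_one {E : Type*} [SeminormedAddGroup E] (x : I → E) (j : I) :
    ‖x j‖ < ∑ i, ‖x i‖ + 1 :=
  (Finset.single_le_sum (f := fun i => ‖x i‖) (fun _ _ => norm_nonneg _)
    (Finset.mem_univ j)).trans_lt (lt_add_one _)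

/-- Truncation at a level above the norms of the `x j` does not decrease packing numbers much. -/
lemma packingInfty_le_packingCutoff [CStarAlgebra M] {φ : M →ₗ[ℂ] ℂ} (hφ : IsTracialState φ)
    {x : I → M} (hx : ∀ j, IsSelfAdjoint (x j)) {R ε : ℝ} (hR : 0 < R) (hxR : ∀ j, ‖x j‖ < R)
    (hε : 0 < ε) : packingInfty φ x ε ≤ packingCutoff φ x R (ε / 4) := by
  refine le_iInf₂ fun m γ => le_iInf fun hγ => ?_
  obtain ⟨m', γ', hγ', h⟩ := exists_close_microstatesCutoff hφ hx hR hxR m hγ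
    (show 0 < ε / 4 by positivity)
  refine iInf₂_le_of_le m' γ' (iInf_le_of_le hγ' ?_)
  refine growthRate_mono ((eventually_ge_atTop m').mono fun k hk => ?_)
  refine IsDistOn.packingNumber_le_of_close ?_ hε (h k hk)
  exact (isDistOn_dist₂ k).mono (Set.union_subset (fun A hA => hA.1) fun A hA => hA.1.1)

lemma packingInfty_le_packing [CStarAlgebra M] {φ : M →ₗ[ℂ] ℂ} (hφ : IsTracialState φ)
    {x : I → M} (hx : ∀ j, IsSelfAdjoint (x j)) {ε : ℝ} (hε : 0 < ε) :
    packingInfty φ x ε ≤ packing φ x (ε / 4) := by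
  have hR : 0 < ∑ i, ‖x i‖ + 1 := by positivity
  exact (packingInfty_le_packingCutoff hφ hx hR
    (norm_lt_sum_norm_add_one x) hε).trans
    (le_iSup₂ (f := fun R (_ : 0 < R) => packingCutoff φ x R (ε / 4)) _ hR)

end Comparison

section Asymptotics

variable {f g : ℝ → EReal}

lemma tendsto_abs_log_nhdsGT_zero : Tendsto (fun ε : ℝ => |Real.log ε|) (𝓝[>] 0) atTop :=
  tendsto_abs_atBot_atTop.comp Real.tendsto_log_nhdsGT_zero

/-- Neither a rescaling of `ε` nor a bounded error is seen by `limsup_{ε → 0} f(ε) / |log ε|`. -/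
lemma limsupDivLog_le {c : ℝ} (hc : 0 < c) (C : ℝ)
    (h : ∀ᶠ ε in 𝓝[>] (0 : ℝ), f ε ≤ g (c * ε) + C) : limsupDivLog f ≤ limsupDivLog g := by
  have hscale : Tendsto (fun ε : ℝ => c * ε) (𝓝[>] 0) (𝓝[>] 0) := by
    refine tendsto_nhdsWithin_iff.2 ⟨?_, ?_⟩
    · exact ((continuous_const_mul c).tendsto' 0 0 (mul_zero c)).mono_left nhdsWithin_le_nhds
    · filter_upwards [self_mem_nhdsWithin] with ε (hε : 0 < ε)
      exact mul_pos hc hε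
  have hpos : ∀ᶠ ε in 𝓝[>] (0 : ℝ), 0 < |Real.log ε| :=
    tendsto_abs_log_nhdsGT_zero.eventually_gt_atTop 0
  refine EReal.le_of_forall_lt_iff_le.1 fun b hb => ?_
  have hev : ∀ᶠ ε in 𝓝[>] (0 : ℝ), g (c * ε) ≤ ((|Real.log (c * ε)| * b : ℝ) : EReal) := by
    filter_upwards [hscale.eventually (eventually_lt_of_limsup_lt hb), hscale.eventually hpos]
      with ε h1 h2
    rw [EReal.coe_mul]
    exact (EReal.div_le_iff_le_mul (by exact_mod_cast h2) (EReal.coe_ne_top _)).1 h1.le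
  have hlim : Tendsto (fun ε : ℝ => (|Real.log (c * ε)| * b + C) / |Real.log ε|) (𝓝[>] 0)
      (𝓝 b) := by
    have h1 : Tendsto (fun ε : ℝ => ((-Real.log c * b + C) / |Real.log ε| + b)) (𝓝[>] 0)
        (𝓝 b) := by
      simpa using (tendsto_abs_log_nhdsGT_zero.const_div_atTop (-Real.log c * b + C)).add_const b
    refine h1.congr' ?_
    have hneg : ∀ᶠ ε in 𝓝[>] (0 : ℝ), Real.log ε < 0 :=
      Real.tendsto_log_nhdsGT_zero.eventually_lt_atBot 0
    filter_upwards [hneg, hscale.eventually hneg, self_mem_nhdsWithin] with ε h1 h2 (h3 : 0 < ε)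
    rw [abs_of_neg h2, abs_of_neg h1, Real.log_mul hc.ne' h3.ne']
    have h4 := h1.ne
    field_simp
    ring
  have hlim' := (continuous_coe_real_ereal.tendsto _).comp hlim
  rw [← hlim'.limsup_eq]
  refine limsup_le_limsup ?_
  filter_upwards [hev, h, hpos] with ε h1 h2 h3
  rw [Function.comp_apply, EReal.coe_div]
  refine EReal.div_le_div_right_of_nonneg (by positivity) (h2.trans ?_)
  rw [EReal.coe_add]
  gcongr

lemma limsupDivLog_add_mul_abs_log (n : ℕ) :
    limsupDivLog (fun ε => f ε + ((n * |Real.log ε| : ℝ) : EReal)) = n + limsupDivLog f := by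
  have hcongr : ∀ (a : ℝ) (f : ℝ → EReal),
      (fun ε : ℝ => (f ε + ((a * |Real.log ε| : ℝ) : EReal)) / ((|Real.log ε| : ℝ) : EReal))
        =ᶠ[𝓝[>] 0] (fun _ => (a : EReal)) + fun ε => f ε / ((|Real.log ε| : ℝ) : EReal) := by
    intro a f
    filter_upwards [tendsto_abs_log_nhdsGT_zero.eventually_gt_atTop 0] with ε hε
    rw [EReal.add_div_of_nonneg_right (by positivity), ← EReal.coe_div,
      mul_div_cancel_right₀ _ hε.ne', add_comm, Pi.add_apply]
  have hle : ∀ (a : ℝ) (f : ℝ → EReal),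
      limsupDivLog (fun ε => f ε + ((a * |Real.log ε| : ℝ) : EReal)) ≤ a + limsupDivLog f := by
    intro a f
    rw [limsupDivLog, limsup_congr (hcongr a f)]
    refine (EReal.limsup_add_le (Or.inl ?_) (Or.inl ?_)).trans_eq ?_ <;> simp [limsupDivLog]
  refine le_antisymm (by simpa using hle n f) ?_
  have h := hle (-n) fun ε => f ε + ((n * |Real.log ε| : ℝ) : EReal)
  have hcancel : (fun ε => f ε + ((n * |Real.log ε| : ℝ) : EReal) +
      ((-n * |Real.log ε| : ℝ) : EReal)) = f := by
    funext ε
    rw [add_assoc, ← EReal.coe_add]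
    simp
  rw [hcancel] at h
  refine (add_le_add_right h (n : EReal)).trans_eq ?_
  have hn : (n : EReal) = ((n : ℝ) : EReal) := rfl
  rw [← add_assoc, hn, ← EReal.coe_add]
  simp

end Asymptotics

/-! ### Covering numbers bound the free entropy from above -/

section UpperBound

lemma exists_encard_le_coveringNumber {α : Type*} {d : α → α → ℝ} {S : Set α} {ε : ℝ}
    (h : coveringNumber d S ε ≠ ⊤) : ∃ T : Set α, T ⊆ S ∧ S ⊆ ⋃ a ∈ T, ballIn d S ε a ∧
      T.Finite ∧ T.encard ≤ coveringNumber d S ε := by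
  have h1 : coveringNumber d S ε < coveringNumber d S ε + 1 :=
    (ENat.lt_add_one_iff h).2 le_rfl
  conv_lhs at h1 => rw [coveringNumber]
  simp only [iInf_lt_iff] at h1
  obtain ⟨T, hTS, hT, hlt⟩ := h1
  exact ⟨T, hTS, hT, Set.encard_lt_top_iff.1 (hlt.trans_le le_top),
    (ENat.lt_add_one_iff h).1 hlt⟩

lemma inv_sq_mul_log_sqrt_pow (n : ℕ) {k : ℕ} (hk : 0 < k) {ε : ℝ} (hε : 0 < ε) :
    ((k : ℝ) ^ 2)⁻¹ * Real.log (√(2 * Real.pi * (ε ^ 2 / k)) ^ (n * (k * k))) +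
      (n : ℝ) / 2 * Real.log k = n * Real.log ε + (n : ℝ) / 2 * Real.log (2 * Real.pi) := by
  have hk' : (0 : ℝ) < k := by exact_mod_cast hk
  have hpi := Real.pi_pos
  rw [Real.log_pow, Real.log_sqrt (by positivity), Real.log_mul (by positivity) (by positivity),
    Real.log_div (by positivity) (by positivity), Real.log_pow]
  push_cast
  field_simp
  ring

/-- The scale `k⁻² log` of a product with a positive real factor. -/
lemma inv_sq_mul_log_mul_ofReal (k : ℕ) (a : ℝ≥0∞) {q : ℝ} (hq : 0 < q) :
    ((((k : ℝ) ^ 2)⁻¹ : ℝ) : EReal) * ENNReal.log (a * ENNReal.ofReal q) =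
      ((((k : ℝ) ^ 2)⁻¹ : ℝ) : EReal) * ENNReal.log a +
        ((((k : ℝ) ^ 2)⁻¹ * Real.log q : ℝ) : EReal) := by
  rw [ENNReal.log_mul_add, ENNReal.log_ofReal_of_pos hq,
    EReal.left_distrib_of_nonneg_of_ne_top (by exact_mod_cast (by positivity))
      (EReal.coe_ne_top _), EReal.coe_mul]

lemma inv_sq_mul_log_mono (k : ℕ) {a b : ℝ≥0∞} (h : a ≤ b) :
    ((((k : ℝ) ^ 2)⁻¹ : ℝ) : EReal) * ENNReal.log a ≤
      ((((k : ℝ) ^ 2)⁻¹ : ℝ) : EReal) * ENNReal.log b :=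
  mul_le_mul_of_nonneg_left (ENNReal.log_le_log h) (by exact_mod_cast (by positivity))

lemma limsup_le_limsup_add {u v : ℕ → EReal} (c : ℝ)
    (h : ∀ᶠ k in atTop, u k ≤ v k + (c : EReal)) :
    limsup u atTop ≤ limsup v atTop + (c : EReal) := by
  refine (limsup_le_limsup h).trans ((EReal.limsup_add_le (u := v) (v := fun _ => (c : EReal))
    (Or.inr ?_) (Or.inr ?_)).trans_eq ?_) <;> simp

variable {I : Type*} [Fintype I] {k : ℕ}

/-- The volume of a `|·|₂`-ball of radius `r ε`, compared to that of a Gaussian density of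
variance `ε ^ 2 / k`. -/
lemma saVolume_ball_le (hk : 0 < k) {ε : ℝ} (hε : 0 < ε) (r : ℝ)
    {a : I → Matrix (Fin k) (Fin k) ℂ} (ha : ∀ j, (a j).IsHermitian) :
    saVolume {B | dist₂ a B ≤ r * ε} ≤
      ENNReal.ofReal (√(2 * Real.pi * (ε ^ 2 / k)) ^ (Fintype.card I * (k * k)) *
        Real.exp ((k : ℝ) ^ 2 * (r ^ 2 / 2))) := by
  have hk' : (0 : ℝ) < k := by exact_mod_cast hk
  obtain ⟨u₀, rfl⟩ := exists_hermTuple_eq ha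
  have hv : (Real.toNNReal (ε ^ 2 / k)) ≠ 0 := by
    simpa using by positivity
  have h1 := volume_sum_sq_le (σ := I × Fin k × Fin k) hv (k * (r * ε) ^ 2)
  rw [Real.coe_toNNReal _ (by positivity), Fintype.card_prod, Fintype.card_prod,
    Fintype.card_fin] at h1
  have h2 : (k : ℝ) * (r * ε) ^ 2 / (2 * (ε ^ 2 / k)) = (k : ℝ) ^ 2 * (r ^ 2 / 2) := by
    field_simp
  rw [h2] at h1
  refine le_trans ?_ h1
  rw [saVolume_eq, ← (volume.measurePreserving_sub_left u₀).measure_preimage_equiv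
    (f := MeasurableEquiv.subLeft u₀)]
  refine measure_mono fun u hu => ?_
  have h3 : √((k : ℝ)⁻¹ * ∑ c, (u₀ c - (u₀ c - u c)) ^ 2) ≤ r * ε := by
    rw [← dist₂_hermTuple]
    exact hu
  have h4 := (Real.sqrt_le_iff.1 h3).2
  simp only [sub_sub_cancel] at h4
  rwa [inv_mul_le_iff₀ hk'] at h4

variable {n : ℕ} {N : Type*} [Ring N] [Algebra ℂ N] {ψ : N →ₗ[ℂ] ℂ}
  {y s : Fin n → N}

open scoped Matrix.Norms.L2Operator in
/-- Microstates `B` of `y + ε s` in the presence of `s` lie at distance `≤ √(2 n) ε` from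
microstates of `y`, namely `B - ε S`. -/
lemma exists_microstatesCutoff_dist₂_le (hψ : ψ 1 = 1) (hs : ∀ j, ψ (s j * s j) = 1) {ε : ℝ}
    (hε : 0 < ε) (R : ℝ) (m₀ : ℕ) {γ₀ : ℝ} (hγ₀ : 0 < γ₀) :
    ∃ (m : ℕ) (γ : ℝ), 0 < γ ∧ ∀ k ≥ m,
      ∀ B ∈ microstatesPresence ψ (fun i => y i + (ε : ℂ) • s i) s R m k γ,
      ∃ A ∈ microstatesCutoff ψ y ((1 + ε) * R) m₀ k γ₀, dist₂ A B ≤ √(2 * n) * ε := by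
  obtain ⟨m', γ', hγ', h⟩ := exists_freeEval_mem_microstates
    (y := Sum.elim (fun i => y i + (ε : ℂ) • s i) s) hψ
    (fun j : Fin n => FreeAlgebra.ι ℂ (Sum.inl j) - (ε : ℂ) • FreeAlgebra.ι ℂ (Sum.inr j))
    (fun k C hC j => by
      simp only [freeEval, map_sub, map_smul, FreeAlgebra.lift_ι_apply]
      refine (hC _).sub ?_
      rw [Matrix.IsHermitian, Matrix.conjTranspose_smul, (hC _).eq]
      simp) m₀ hγ₀
  refine ⟨max m' 2, min γ' 1, by positivity, ?_⟩
  rintro k hk _ ⟨C, ⟨hC, hCR⟩, rfl⟩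
  have h1 := h k ((le_max_left _ _).trans hk) C
    (microstates_mono (le_max_left _ _) (min_le_left _ _) hC)
  simp only [freeEval, map_sub, map_smul, FreeAlgebra.lift_ι_apply, Sum.elim_inl, Sum.elim_inr,
    add_sub_cancel_right] at h1
  refine ⟨_, ⟨h1, fun j => ?_⟩, ?_⟩
  · have hl := hCR (Sum.inl j)
    have hr := hCR (Sum.inr j)
    rw [opNorm_eq] at hl hr ⊢
    refine (norm_sub_le _ _).trans ?_
    rw [norm_smul, Complex.norm_real, Real.norm_of_nonneg hε.le]
    nlinarith
  · have hmom : ∀ j, (normTrace (C (Sum.inr j) ^ 2)).re ≤ 2 := fun j => by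
      have h2 := (mem_microstates_iff.1 hC).2 [Sum.inr j, Sum.inr j] (by simp) (by simp)
      simp only [wordProd_cons, wordProd_nil, mul_one, Sum.elim_inr, hs] at h2
      rw [sq, normTrace_eq_ntr]
      have h3 := (Complex.abs_re_le_norm _).trans_lt (h2.trans_le (min_le_right _ _))
      rw [Complex.sub_re, Complex.one_re] at h3
      linarith [(abs_lt.1 h3).2]
    have hroot : √(2 * n) * ε = √(2 * n * ε ^ 2) := by
      rw [Real.sqrt_mul (show (0 : ℝ) ≤ 2 * n by positivity), Real.sqrt_sq hε.le]
    rw [dist₂, hroot]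
    refine Real.sqrt_le_sqrt ?_
    calc _ = ∑ j, ε ^ 2 * (normTrace (C (Sum.inr j) ^ 2)).re := by
          refine Finset.sum_congr rfl fun j _ => ?_
          rw [sub_sub_cancel_left, neg_sq, smul_pow, normTrace_eq_ntr, ntr_smul,
            ← Complex.ofReal_pow, Complex.re_ofReal_mul]
          rfl
      _ ≤ ∑ _j : Fin n, ε ^ 2 * 2 := by
          gcongr
          exact hmom _
      _ = 2 * n * ε ^ 2 := by
          simp only [Finset.sum_const, Finset.card_univ, Fintype.card_fin, nsmul_eq_mul]
          ring

/-- The free entropy of `y + ε s` is bounded by the covering numbers at scale `ε`: the microstates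
of `y + ε s` lie in the `(√(2 n) + 1) ε`-balls about the centres of a cover. -/
lemma chi_le_covering (hψ : ψ 1 = 1) (hs : ∀ j, ψ (s j * s j) = 1) {ε : ℝ} (hε : 0 < ε) :
    chi ψ (fun i => y i + (ε : ℂ) • s i) s ≤ covering ψ y ε +
      ((n * Real.log ε + ((n : ℝ) / 2 * Real.log (2 * Real.pi) + (1 + √(2 * n)) ^ 2 / 2) : ℝ) :
        EReal) := by
  set c : ℝ := n * Real.log ε + ((n : ℝ) / 2 * Real.log (2 * Real.pi) + (1 + √(2 * n)) ^ 2 / 2)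
    with hc
  refine iSup₂_le fun R hR => ?_
  refine le_trans ?_ (add_le_add_left (le_iSup₂ (f := fun R (_ : 0 < R) => coveringCutoff ψ y R ε)
    ((1 + ε) * R) (by positivity)) _)
  refine (EReal.sub_le_iff_le_add (Or.inl (EReal.coe_ne_bot _)) (Or.inl (EReal.coe_ne_top _))).1 ?_
  refine le_iInf₂ fun m₀ γ₀ => le_iInf fun hγ₀ => ?_
  refine EReal.sub_le_of_le_add ?_
  obtain ⟨m, γ, hγ, h⟩ := exists_microstatesCutoff_dist₂_le (y := y) hψ hs hε R m₀ hγ₀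
  refine iInf₂_le_of_le m γ (iInf_le_of_le hγ (limsup_le_limsup_add c ?_))
  filter_upwards [eventually_ge_atTop m, eventually_gt_atTop 0] with k hkm hk
  set S := microstatesCutoff ψ y ((1 + ε) * R) m₀ k γ₀
  set r : ℝ := 1 + √(2 * n) with hr
  set q : ℝ := √(2 * Real.pi * (ε ^ 2 / k)) ^ (n * (k * k)) * Real.exp ((k : ℝ) ^ 2 * (r ^ 2 / 2))
    with hq
  have hk' : (0 : ℝ) < k := by exact_mod_cast hk
  have hpi := Real.pi_pos
  have hsq : 0 < √(2 * Real.pi * (ε ^ 2 / k)) ^ (n * (k * k)) := by positivity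
  have hq0 : 0 < q := by positivity
  have hvol : saVolume (microstatesPresence ψ (fun i => y i + (ε : ℂ) • s i) s R m k γ) ≤
      (coveringNumber dist₂ S ε : ℝ≥0∞) * ENNReal.ofReal q := by
    by_cases htop : coveringNumber dist₂ S ε = ⊤
    · rw [htop, ENat.toENNReal_top, ENNReal.top_mul (by simpa using hq0)]
      exact le_top
    obtain ⟨T, hTS, hcover, hfin, hcard⟩ := exists_encard_le_coveringNumber htop
    have hsub : microstatesPresence ψ (fun i => y i + (ε : ℂ) • s i) s R m k γ ⊆
        ⋃ a ∈ hfin.toFinset, {B | dist₂ a B ≤ r * ε} := by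
      intro B hB
      obtain ⟨A, hA, hAB⟩ := h k hkm B hB
      have hA' := hcover hA
      simp only [Set.mem_iUnion] at hA'
      obtain ⟨a, ha, -, haA⟩ := hA'
      simp only [Set.mem_iUnion]
      refine ⟨a, hfin.mem_toFinset.2 ha, ?_⟩
      have hBh : ∀ j, (B j).IsHermitian := by
        obtain ⟨C, hC, rfl⟩ := hB
        exact fun j => hC.1.1 (Sum.inl j)
      have htri := (isDistOn_dist₂ k).triangle a (hTS ha).1.1 A hA.1.1 B hBh
      change dist₂ a B ≤ r * ε
      rw [hr, add_mul, one_mul]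
      linarith
    calc _ ≤ saVolume (⋃ a ∈ hfin.toFinset, {B | dist₂ a B ≤ r * ε}) := by
          rw [saVolume_eq, saVolume_eq]
          exact measure_mono fun u hu => hsub hu
      _ ≤ ∑ a ∈ hfin.toFinset, saVolume {B | dist₂ a B ≤ r * ε} := by
          simp only [saVolume_eq]
          refine le_trans (measure_mono fun u hu => ?_) (measure_biUnion_finset_le _ _)
          simpa using hu
      _ ≤ ∑ _a ∈ hfin.toFinset, ENNReal.ofReal q := by
          refine Finset.sum_le_sum fun a ha => ?_
          have := saVolume_ball_le hk hε r (hTS (hfin.mem_toFinset.1 ha)).1.1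
          rwa [Fintype.card_fin] at this
      _ = (T.encard : ℝ≥0∞) * ENNReal.ofReal q := by
          rw [Finset.sum_const, nsmul_eq_mul, hfin.encard_eq_coe_toFinset_card]
          simp
      _ ≤ _ := by
          gcongr
  have hlog := inv_sq_mul_log_sqrt_pow n hk hε
  have hconst : ((k : ℝ) ^ 2)⁻¹ * Real.log q + (Fintype.card (Fin n) : ℝ) / 2 * Real.log k = c := by
    rw [hq, Real.log_mul hsq.ne' (Real.exp_ne_zero _), Real.log_exp, Fintype.card_fin, mul_add,
      inv_mul_cancel_left₀ (by positivity), hc]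
    linarith
  refine (add_le_add_left (inv_sq_mul_log_mono k hvol) _).trans_eq ?_
  rw [inv_sq_mul_log_mul_ofReal k _ hq0, add_assoc, ← EReal.coe_add, hconst]

end UpperBound

/-! ### Packing numbers bound the free entropy from below -/

section LowerBound

/-- Finite families of disjoint balls suffice to bound a packing number. -/
lemma packingNumber_le_of_forall_finset {α : Type*} {d : α → α → ℝ} {S : Set α} {ε : ℝ}
    {X : ℝ≥0∞} (h : ∀ T : Finset α, (T : Set α) ⊆ S →
      (T : Set α).PairwiseDisjoint (ballIn d S ε) → (T.card : ℝ≥0∞) ≤ X) :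
    (packingNumber d S ε : ℝ≥0∞) ≤ X := by
  by_cases hX : X = ⊤
  · simp [hX]
  have hle : packingNumber d S ε ≤ (⌊X.toReal⌋₊ : ℕ∞) := by
    refine iSup₂_le fun T hTS => iSup_le fun hdisj => ?_
    by_contra! hlt
    obtain ⟨T', hT', hcard⟩ := Set.exists_subset_encard_eq (Order.add_one_le_of_lt hlt)
    have hfin : T'.Finite := Set.encard_ne_top_iff.1 (by rw [hcard]; exact ENat.natCast_ne_top _)
    have h1 := h hfin.toFinset (by simpa using hT'.trans hTS)
      (by simpa using hdisj.subset hT')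
    have h2 : hfin.toFinset.card = ⌊X.toReal⌋₊ + 1 := by
      rw [hfin.encard_eq_coe_toFinset_card] at hcard
      exact_mod_cast hcard
    have h3 : ((⌊X.toReal⌋₊ + 1 : ℕ) : ℝ) ≤ X.toReal := by
      rw [← h2]
      simpa using ENNReal.toReal_mono hX h1
    push_cast at h3
    linarith [Nat.lt_floor_add_one X.toReal]
  calc (packingNumber d S ε : ℝ≥0∞) ≤ ((⌊X.toReal⌋₊ : ℕ∞) : ℝ≥0∞) := by
        exact_mod_cast hle
    _ = ENNReal.ofReal (⌊X.toReal⌋₊ : ℝ) := by simp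
    _ ≤ ENNReal.ofReal X.toReal :=
        ENNReal.ofReal_le_ofReal (Nat.floor_le ENNReal.toReal_nonneg)
    _ = X := ENNReal.ofReal_toReal hX

variable {n k : ℕ} {N : Type*} [Ring N] [Algebra ℂ N] {ψ : N →ₗ[ℂ] ℂ} {y s : Fin n → N}

open scoped Matrix.Norms.L2Operator in
lemma dist₂_le_of_opNorm_le {A B : Fin n → Matrix (Fin k) (Fin k) ℂ}
    (hA : ∀ j, (A j).IsHermitian) (hB : ∀ j, (B j).IsHermitian) {R : ℝ} (hR : 0 ≤ R)
    (hAR : ∀ j, opNorm (A j) ≤ R) (hBR : ∀ j, opNorm (B j) ≤ R) : dist₂ A B ≤ √n * (2 * R) := by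
  have hroot : √n * (2 * R) = √(n * (2 * R) ^ 2) := by
    rw [Real.sqrt_mul (by positivity), Real.sqrt_sq (by positivity)]
  rw [dist₂_eq hA hB, hroot]
  refine Real.sqrt_le_sqrt ?_
  calc ∑ j, (k : ℝ)⁻¹ * hsSq (A j - B j) ≤ ∑ _j : Fin n, (2 * R) ^ 2 := by
        refine Finset.sum_le_sum fun j _ => ?_
        have h1 := hsSq_mul_le (A j - B j) 1
        rw [mul_one, hsSq_one] at h1
        have h2 : ‖A j - B j‖ ≤ 2 * R := by
          have ha := hAR j
          have hb := hBR j
          rw [opNorm_eq] at ha hb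
          linarith [norm_sub_le (A j) (B j)]
        rcases k.eq_zero_or_pos with rfl | hk
        · simp
          positivity
        have hk' : (0 : ℝ) < k := by exact_mod_cast hk
        rw [inv_mul_le_iff₀ hk', mul_comm (k : ℝ)]
        exact h1.trans (by gcongr)
    _ = n * (2 * R) ^ 2 := by simp

lemma measurableSet_microstates_hermTuple (A : Fin n → Matrix (Fin k) (Fin k) ℂ)
    (x : Fin n ⊕ Fin n → N) (m : ℕ) (γ R : ℝ) :
    MeasurableSet {u : Fin n × Fin k × Fin k → ℝ | Sum.elim A (hermTuple u) ∈
      microstates ψ x m k γ ∧ ∀ j, opNorm (hermTuple u j) ≤ R} := by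
  have hcont : ∀ j, Continuous fun u : Fin n × Fin k × Fin k → ℝ =>
      Sum.elim A (hermTuple u) j := fun j => by
    rcases j with j | j
    · exact continuous_const
    · exact continuous_hermTuple j
  have hop : Continuous fun B : Matrix (Fin k) (Fin k) ℂ => opNorm B :=
    (LinearMap.continuous_of_finiteDimensional
      (Matrix.toEuclideanCLM (n := Fin k) (𝕜 := ℂ)).toAlgEquiv.toLinearMap).norm
  have h1 : IsClosed {u : Fin n × Fin k × Fin k → ℝ |
      ∀ j, (Sum.elim A (hermTuple u) j).IsHermitian} := by
    simp only [Matrix.IsHermitian, Set.ofPred_forall]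
    exact isClosed_iInter fun j => isClosed_eq (hcont j).matrix_conjTranspose (hcont j)
  have h2 : MeasurableSet {u : Fin n × Fin k × Fin k → ℝ | ∀ p : ℕ, 1 ≤ p → p ≤ m →
      ∀ i : Fin p → Fin n ⊕ Fin n,
      ‖normTrace (List.ofFn fun j => Sum.elim A (hermTuple u) (i j)).prod -
        ψ (List.ofFn fun j => x (i j)).prod‖ < γ} := by
    simp only [Set.ofPred_forall]
    refine MeasurableSet.iInter fun p => MeasurableSet.iInter fun _ => MeasurableSet.iInter
      fun _ => MeasurableSet.iInter fun i => (IsOpen.measurableSet ?_)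
    refine isOpen_lt (Continuous.norm (Continuous.sub ?_ continuous_const)) continuous_const
    simp only [normTrace, List.ofFn_eq_map]
    exact continuous_const.mul (continuous_list_prod _ fun j _ => hcont (i j)).matrix_trace
  have h3 : IsClosed {u : Fin n × Fin k × Fin k → ℝ | ∀ j, opNorm (hermTuple u j) ≤ R} := by
    simp only [Set.ofPred_forall]
    exact isClosed_iInter fun j => isClosed_le (hop.comp (continuous_hermTuple j)) continuous_const
  exact (h1.measurableSet.inter h2).inter h3.measurableSet

/-- The sets `A + ε S`, where `A` is a microstate of `y` and `S` runs through most semicircular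
microstates that are free from `A`, consist of microstates of `y + ε s` in the presence of `s`. -/
lemma exists_add_smul_mem_microstatesPresence (hψ : ψ 1 = 1) (htr : ∀ a b, ψ (a * b) = ψ (b * a))
    (hSD : ∀ i w, ψ (wordProd (Sum.elim y s) (Sum.inr i :: w)) = splitSum (Sum.inr i)
      (fun U V => ψ (wordProd (Sum.elim y s) U) * ψ (wordProd (Sum.elim y s) V)) w)
    {ε : ℝ} (hε : 0 ≤ ε) (hε1 : ε ≤ 1) {R : ℝ} (hR : 0 ≤ R) (m : ℕ) {γ : ℝ} (hγ : 0 < γ) :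
    ∃ (m' : ℕ) (γ' : ℝ), 0 < γ' ∧ ∀ k ≥ m', ∀ A ∈ microstatesCutoff ψ y R m' k γ',
      ∃ G : Set (Fin n × Fin k × Fin k → ℝ), MeasurableSet G ∧
        2⁻¹ ≤ gaussMeasure (Fin n × Fin k × Fin k) (gueVar k) G ∧
        (∀ u ∈ G, ∀ j, opNorm (hermTuple u j) ≤ 256 * ((n : ℝ) + 1)) ∧
        ∀ u ∈ G, (fun j => A j + (ε : ℂ) • hermTuple u j) ∈ microstatesPresence ψ
          (fun i => y i + (ε : ℂ) • s i) s (R + 256 * ((n : ℝ) + 1)) m k γ := by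
  obtain ⟨m₁, γ₁, hγ₁, h₁⟩ := exists_freeEval_mem_microstates (y := Sum.elim y s) hψ
    (Sum.elim (fun j : Fin n => FreeAlgebra.ι ℂ (Sum.inl j) + (ε : ℂ) • FreeAlgebra.ι ℂ (Sum.inr j))
      fun j => FreeAlgebra.ι ℂ (Sum.inr j))
    (fun k C hC j => by
      rcases j with j | j
      · simp only [Sum.elim_inl, freeEval, map_add, map_smul, FreeAlgebra.lift_ι_apply]
        refine (hC _).add ?_
        rw [Matrix.IsHermitian, Matrix.conjTranspose_smul, (hC _).eq]
        simp
      · simpa using hC _) m hγ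
  have hy : (fun j => freeEval (Sum.elim y s) (Sum.elim (fun j : Fin n =>
      FreeAlgebra.ι ℂ (Sum.inl j) + (ε : ℂ) • FreeAlgebra.ι ℂ (Sum.inr j))
      (fun j => FreeAlgebra.ι ℂ (Sum.inr j)) j)) = Sum.elim (fun i => y i + (ε : ℂ) • s i) s := by
    funext j
    rcases j with j | j <;>
      simp only [Sum.elim_inl, Sum.elim_inr, freeEval, map_add, map_smul, FreeAlgebra.lift_ι_apply]
  rw [hy] at h₁
  obtain ⟨m₂, γ₂, hγ₂, h₂⟩ := exists_of_eventually_micFilter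
    (eventually_le_gaussMeasure hψ htr hSD m₁ hγ₁)
  refine ⟨max m₁ m₂, γ₂, hγ₂, fun k hk A hA => ⟨_, measurableSet_microstates_hermTuple A _ m₁ γ₁ _,
    h₂ k ((le_max_right _ _).trans hk) A (microstates_mono (le_max_right _ _) le_rfl hA.1),
    fun u hu => hu.2, fun u hu => ?_⟩⟩
  have h3 := h₁ k ((le_max_left _ _).trans hk) _ hu.1
  refine ⟨_, ⟨h3, fun j => ?_⟩, ?_⟩
  · rcases j with j | j
    · simp only [Sum.elim_inl, freeEval, map_add, map_smul, FreeAlgebra.lift_ι_apply,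
        Sum.elim_inr]
      have ha := hA.2 j
      have hb := hu.2 j
      rw [opNorm] at ha hb ⊢
      rw [map_add, map_smul]
      refine (norm_add_le _ _).trans (add_le_add ha ?_)
      rw [norm_smul, Complex.norm_real, Real.norm_of_nonneg hε]
      exact (mul_le_of_le_one_left (norm_nonneg _) hε1).trans hb
    · simpa using (hu.2 j).trans (le_add_of_nonneg_left hR)
  · funext j
    simp only [Sum.elim_inl, Sum.elim_inr, freeEval, map_add, map_smul, FreeAlgebra.lift_ι_apply]

/-- The free entropy of `y + ε s` is bounded from below by the packing numbers at a multiple of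
the scale `ε`: around the centres of disjoint balls, the sets of the `A + ε S` are disjoint. -/
lemma packingCutoff_le_chi (hψ : ψ 1 = 1) (htr : ∀ a b, ψ (a * b) = ψ (b * a))
    (hSD : ∀ i w, ψ (wordProd (Sum.elim y s) (Sum.inr i :: w)) = splitSum (Sum.inr i)
      (fun U V => ψ (wordProd (Sum.elim y s) U) * ψ (wordProd (Sum.elim y s) V)) w)
    {ε : ℝ} (hε : 0 < ε) (hε1 : ε ≤ 1) {R : ℝ} (hR : 0 ≤ R) :
    packingCutoff ψ y R ((√n * (2 * (256 * ((n : ℝ) + 1))) + 1) * ε) ≤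
      chi ψ (fun i => y i + (ε : ℂ) • s i) s +
        ((-(n * Real.log ε) + (Real.log 2 - (n : ℝ) / 2 * Real.log (2 * Real.pi)) : ℝ) :
          EReal) := by
  -- `r` exceeds the `|·|₂`-diameter of the set of the matrices `S`.
  set r : ℝ := √n * (2 * (256 * ((n : ℝ) + 1))) + 1
  have hr0 : 0 < r := by positivity
  set c : ℝ := -(n * Real.log ε) + (Real.log 2 - (n : ℝ) / 2 * Real.log (2 * Real.pi)) with hc
  refine le_trans ?_ (add_le_add_left (le_iSup₂ (f := fun R (_ : 0 < R) => ⨅ (m : ℕ) (γ : ℝ)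
    (_ : 0 < γ), chiAux ψ (fun i => y i + (ε : ℂ) • s i) s R m γ)
    (R + 256 * ((n : ℝ) + 1)) (by positivity)) _)
  refine (EReal.sub_le_iff_le_add (Or.inl (EReal.coe_ne_bot _)) (Or.inl (EReal.coe_ne_top _))).1 ?_
  refine le_iInf₂ fun m γ => le_iInf fun hγ => ?_
  refine EReal.sub_le_of_le_add ?_
  obtain ⟨m', γ', hγ', h⟩ := exists_add_smul_mem_microstatesPresence hψ htr hSD hε.le hε1 hR m hγ
  refine iInf₂_le_of_le m' γ' (iInf_le_of_le hγ' (limsup_le_limsup_add c ?_))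
  filter_upwards [eventually_ge_atTop m', eventually_gt_atTop 0] with k hkm hk
  set S := microstatesCutoff ψ y R m' k γ'
  set Q := microstatesPresence ψ (fun i => y i + (ε : ℂ) • s i) s (R + 256 * ((n : ℝ) + 1)) m k γ
  set q : ℝ := √(2 * Real.pi * (ε ^ 2 / k)) ^ (n * (k * k)) * 2⁻¹ with hq
  have hk' : (0 : ℝ) < k := by exact_mod_cast hk
  have hpi := Real.pi_pos
  have hsq : 0 < √(2 * Real.pi * (ε ^ 2 / k)) ^ (n * (k * k)) := by positivity
  have hq0 : 0 < q := by positivity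
  choose! G hGm hG hGop hGmem using h k hkm
  have hpack : (packingNumber dist₂ S (r * ε) : ℝ≥0∞) * ENNReal.ofReal q ≤ saVolume Q := by
    rw [← ENNReal.le_div_iff_mul_le (Or.inl (by simpa using hq0)) (Or.inl ENNReal.ofReal_ne_top)]
    refine packingNumber_le_of_forall_finset fun T hTS hdisj => ?_
    rw [ENNReal.le_div_iff_mul_le (Or.inl (by simpa using hq0)) (Or.inl ENNReal.ofReal_ne_top)]
    have hcoord : ∀ A : Fin n → Matrix (Fin k) (Fin k) ℂ, ∃ u : Fin n × Fin k × Fin k → ℝ,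
        A ∈ T → hermTuple u = A := fun A => by
      by_cases hA : A ∈ T
      · obtain ⟨u, hu⟩ := exists_hermTuple_eq (hTS hA).1.1
        exact ⟨u, fun _ => hu⟩
      · exact ⟨0, fun h => absurd h hA⟩
    choose v hv using hcoord
    -- The set of the `A + ε S` in coordinates, as the preimage of the set `G A` of the `S`.
    set E : (Fin n → Matrix (Fin k) (Fin k) ℂ) → Set (Fin n × Fin k × Fin k → ℝ) := fun A =>
      (fun u => u - v A) ⁻¹' ((fun u => ε⁻¹ • u) ⁻¹' G A) with hE
    have hEmem : ∀ A ∈ T, ∀ u ∈ E A, ∃ w ∈ G A, u = v A + ε • w := fun A _ u hu =>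
      ⟨ε⁻¹ • (u - v A), hu, by rw [smul_inv_smul₀ hε.ne', add_sub_cancel]⟩
    have hEtuple : ∀ A ∈ T, ∀ w, hermTuple (v A + ε • w) = fun j => A j + (ε : ℂ) • hermTuple w j :=
      fun A hA w => by
        funext j
        rw [hermTuple_add_smul, hv A hA]
    have hEm : ∀ A ∈ T, MeasurableSet (E A) := fun A hA =>
      (measurable_const_smul ε⁻¹ (hGm A (hTS hA))).preimage
        (measurable_id.sub_const (v A))
    have hEQ : ∀ A ∈ T, E A ⊆ {u | hermTuple u ∈ Q} := fun A hA u hu => by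
      obtain ⟨w, hw, rfl⟩ := hEmem A hA u hu
      change hermTuple _ ∈ Q
      rw [hEtuple A hA]
      exact hGmem A (hTS hA) w hw
    have hEdisj : (T : Set (Fin n → Matrix (Fin k) (Fin k) ℂ)).PairwiseDisjoint E := by
      intro A hA B hB hAB
      refine Set.disjoint_left.2 fun u hu hu' => ?_
      obtain ⟨w, hw, rfl⟩ := hEmem A hA u hu
      obtain ⟨w', hw', heq⟩ := hEmem B hB _ hu'
      have h1 := (isDistOn_microstatesCutoff R m' k γ').le_of_pairwiseDisjoint (by positivity)
        hTS hdisj hA hB hAB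
      have h2 : dist₂ A B = ε * dist₂ (hermTuple w) (hermTuple w') := by
        have hvv : ∀ c, (v A c - v B c) ^ 2 = ε ^ 2 * (w c - w' c) ^ 2 := fun c => by
          have := congrFun heq c
          simp only [Pi.add_apply, Pi.smul_apply, smul_eq_mul] at this
          rw [show v A c - v B c = -(ε * (w c - w' c)) by linarith]
          ring
        rw [← hv A hA, ← hv B hB, dist₂_hermTuple, dist₂_hermTuple]
        simp_rw [hvv]
        rw [← Finset.mul_sum, mul_left_comm, Real.sqrt_mul (sq_nonneg ε), Real.sqrt_sq hε.le]
      have h3 := dist₂_le_of_opNorm_le (isHermitian_hermTuple w) (isHermitian_hermTuple w')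
        (by positivity) (hGop A (hTS hA) w hw) (hGop B (hTS hB) w' hw')
      have h4 : dist₂ (hermTuple w) (hermTuple w') < r := h3.trans_lt (lt_add_one _)
      rw [h2, mul_comm r] at h1
      exact absurd (le_of_mul_le_mul_left h1 hε) (not_le.2 h4)
    have hEvol : ∀ A ∈ T, ENNReal.ofReal q ≤ volume (E A) := fun A hA => by
      have hd : Fintype.card (Fin n × Fin k × Fin k) = n * (k * k) := by simp
      have h1 := (hG A (hTS hA)).trans (gaussMeasure_le (gueVar k) (G A))
      have h2 : volume (E A) = ENNReal.ofReal (ε ^ (n * (k * k))) * volume (G A) := by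
        rw [hE]
        simp only
        rw [(measurePreserving_sub_right volume (v A)).measure_preimage
          (measurable_const_smul ε⁻¹ (hGm A (hTS hA))).nullMeasurableSet,
          Measure.addHaar_preimage_smul _ (inv_ne_zero hε.ne')]
        rw [Module.finrank_fintype_fun_eq_card, hd, inv_pow, inv_inv,
          abs_of_nonneg (by positivity)]
      rw [hd] at h1
      set D : ℝ := √(2 * Real.pi * (gueVar k : ℝ)) with hD
      have hD0 : 0 < D := by
        have : (0 : ℝ) < gueVar k := by simpa [gueVar] using hk
        positivity
      have h3 : q = ε ^ (n * (k * k)) * (D ^ (n * (k * k)) * 2⁻¹) := by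
        rw [hq, ← mul_assoc (ε ^ _), ← mul_pow, hD]
        congr 2
        rw [← Real.sqrt_sq hε.le, ← Real.sqrt_mul (by positivity), Real.sqrt_sq hε.le]
        congr 1
        simp only [gueVar, NNReal.coe_inv, NNReal.coe_natCast]
        ring
      rw [h2, h3, ENNReal.ofReal_mul (by positivity)]
      gcongr
      calc ENNReal.ofReal (D ^ (n * (k * k)) * 2⁻¹)
          = ENNReal.ofReal (D ^ (n * (k * k))) * 2⁻¹ := by
            rw [ENNReal.ofReal_mul (by positivity), ENNReal.ofReal_inv_of_pos two_pos]
            simp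
        _ ≤ ENNReal.ofReal (D ^ (n * (k * k))) *
            (ENNReal.ofReal (D⁻¹ ^ (n * (k * k))) * volume (G A)) := by gcongr
        _ = volume (G A) := by
            rw [← mul_assoc, ← ENNReal.ofReal_mul (by positivity), ← mul_pow,
              mul_inv_cancel₀ hD0.ne', one_pow, ENNReal.ofReal_one, one_mul]
    calc (T.card : ℝ≥0∞) * ENNReal.ofReal q = ∑ _A ∈ T, ENNReal.ofReal q := by
          rw [Finset.sum_const, nsmul_eq_mul]
      _ ≤ ∑ A ∈ T, volume (E A) := Finset.sum_le_sum hEvol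
      _ = volume (⋃ A ∈ T, E A) := (measure_biUnion_finset hEdisj hEm).symm
      _ ≤ volume {u | hermTuple u ∈ Q} := measure_mono (Set.iUnion₂_subset hEQ)
      _ = saVolume Q := (saVolume_eq Q).symm
  have hlog := inv_sq_mul_log_sqrt_pow n hk hε
  have hk1 : ((k : ℝ) ^ 2)⁻¹ ≤ 1 := inv_le_one_of_one_le₀ (one_le_pow₀ (by exact_mod_cast hk))
  have hconst : 0 ≤ ((k : ℝ) ^ 2)⁻¹ * Real.log q + ((n : ℝ) / 2 * Real.log k + c) := by
    rw [hq, Real.log_mul hsq.ne' (by norm_num), Real.log_inv, mul_add, hc]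
    have h1 : ((k : ℝ) ^ 2)⁻¹ * Real.log 2 ≤ Real.log 2 :=
      mul_le_of_le_one_left (Real.log_nonneg one_le_two) hk1
    linarith
  have h1 := inv_sq_mul_log_mono k hpack
  rw [inv_sq_mul_log_mul_ofReal k _ hq0] at h1
  rw [add_assoc, Fintype.card_fin, ← EReal.coe_add]
  refine le_trans ?_ (add_le_add_left h1 _)
  rw [add_assoc, ← EReal.coe_add]
  exact le_add_of_nonneg_right (by exact_mod_cast hconst)

end LowerBound

/-! ### The free entropy dimension -/

section Dimension

lemma microstates_comp {M N I : Type*} [Ring M] [Algebra ℂ M] [Ring N] [Algebra ℂ N]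
    {φ : M →ₗ[ℂ] ℂ} {ψ : N →ₗ[ℂ] ℂ} (ι : M →ₐ[ℂ] N) (hι : ∀ a, ψ (ι a) = φ a) (x : I → M) :
    microstates ψ (fun i => ι (x i)) = microstates φ x := by
  funext m k γ
  simp only [microstates, ← hι, map_list_prod, List.map_ofFn, Function.comp_def]

variable {n : ℕ}

lemma limsupDivLog_coveringInfty {M : Type*} [Ring M] [Algebra ℂ M] (φ : M →ₗ[ℂ] ℂ)
    (x : Fin n → M) : limsupDivLog (coveringInfty φ x) = limsupDivLog (packingInfty φ x) := by
  refine le_antisymm (limsupDivLog_le (c := 1 / 2) (by positivity) 0 ?_)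
    (limsupDivLog_le (c := 1 / 2) (by positivity) 0 ?_) <;>
  filter_upwards [self_mem_nhdsWithin] with ε (hε : 0 < ε)
  · have h := coveringInfty_le_packingInfty (φ := φ) (x := x) (half_pos hε)
    rw [mul_div_cancel₀ _ two_ne_zero] at h
    simpa [div_eq_inv_mul] using h
  · simpa [div_eq_inv_mul] using packingInfty_le_coveringInfty (φ := φ) (x := x) hε

lemma limsupDivLog_covering {M : Type*} [Ring M] [Algebra ℂ M] (φ : M →ₗ[ℂ] ℂ)
    (x : Fin n → M) : limsupDivLog (covering φ x) = limsupDivLog (packing φ x) := by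
  refine le_antisymm (limsupDivLog_le (c := 1 / 2) (by positivity) 0 ?_)
    (limsupDivLog_le (c := 1 / 2) (by positivity) 0 ?_) <;>
  filter_upwards [self_mem_nhdsWithin] with ε (hε : 0 < ε)
  · have h := covering_le_packing (φ := φ) (x := x) (half_pos hε)
    rw [mul_div_cancel₀ _ two_ne_zero] at h
    simpa [div_eq_inv_mul] using h
  · simpa [div_eq_inv_mul] using packing_le_covering (φ := φ) (x := x) hε

lemma limsupDivLog_packingInfty {M : Type*} [CStarAlgebra M] {φ : M →ₗ[ℂ] ℂ}
    (hφ : IsTracialState φ) {x : Fin n → M} (hx : ∀ i, IsSelfAdjoint (x i)) :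
    limsupDivLog (packingInfty φ x) = limsupDivLog (packing φ x) := by
  refine le_antisymm (limsupDivLog_le (c := 1 / 4) (by positivity) 0 ?_)
    (limsupDivLog_le (c := 1 / 4) (by positivity) 0 ?_) <;>
  filter_upwards [self_mem_nhdsWithin] with ε (hε : 0 < ε)
  · simpa [div_eq_inv_mul] using packingInfty_le_packing hφ hx hε
  · simpa [div_eq_inv_mul] using packing_le_packingInfty (φ := φ) (x := x) hε

variable {N : Type*} [Ring N] [Algebra ℂ N] {ψ : N →ₗ[ℂ] ℂ} {y s : Fin n → N}

lemma delta₀_eq_limsupDivLog : delta₀ ψ y s = limsupDivLog fun ε =>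
    chi ψ (fun i => y i + (ε : ℂ) • s i) s + ((n * |Real.log ε| : ℝ) : EReal) :=
  (limsupDivLog_add_mul_abs_log n).symm

lemma delta₀_le_limsupDivLog_covering (hψ : ψ 1 = 1) (hs : ∀ j, ψ (s j * s j) = 1) :
    delta₀ ψ y s ≤ limsupDivLog (covering ψ y) := by
  rw [delta₀_eq_limsupDivLog]
  refine limsupDivLog_le one_pos
    ((n : ℝ) / 2 * Real.log (2 * Real.pi) + (1 + √(2 * n)) ^ 2 / 2) ?_
  filter_upwards [Ioo_mem_nhdsGT one_pos] with ε ⟨hε, hε1⟩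
  refine (add_le_add_left (chi_le_covering hψ hs hε) _).trans_eq ?_
  rw [one_mul, add_assoc, ← EReal.coe_add, abs_of_neg (Real.log_neg hε hε1)]
  congr 2
  ring

lemma limsupDivLog_packingInfty_le_delta₀ {M : Type*} [CStarAlgebra M] {φ : M →ₗ[ℂ] ℂ}
    (hφ : IsTracialState φ) {x : Fin n → M} (hx : ∀ i, IsSelfAdjoint (x i))
    (ι : M →ₐ[ℂ] N) (hι : ∀ a, ψ (ι a) = φ a) (hψ : ψ 1 = 1)
    (htr : ∀ a b, ψ (a * b) = ψ (b * a))
    (hSD : ∀ i w, ψ (wordProd (Sum.elim (fun i => ι (x i)) s) (Sum.inr i :: w)) =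
      splitSum (Sum.inr i) (fun U V => ψ (wordProd (Sum.elim (fun i => ι (x i)) s) U) *
        ψ (wordProd (Sum.elim (fun i => ι (x i)) s) V)) w) :
    limsupDivLog (packingInfty φ x) ≤ delta₀ ψ (fun i => ι (x i)) s := by
  have hxR := norm_lt_sum_norm_add_one x
  set R : ℝ := ∑ i, ‖x i‖ + 1
  have hR : 0 < R := by positivity
  set r : ℝ := √n * (2 * (256 * ((n : ℝ) + 1))) + 1
  have hr0 : 0 < r := by positivity
  rw [delta₀_eq_limsupDivLog]
  refine limsupDivLog_le (c := (4 * r)⁻¹) (by positivity)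
    (Real.log 2 - (n : ℝ) / 2 * Real.log (2 * Real.pi)) ?_
  filter_upwards [Ioo_mem_nhdsGT (show (0 : ℝ) < 4 * r by positivity)] with ε ⟨hε, hε1⟩
  set t : ℝ := (4 * r)⁻¹ * ε with ht
  have ht0 : 0 < t := by positivity
  have ht1 : t < 1 := by
    rw [ht, inv_mul_lt_iff₀ (by positivity), mul_one]
    exact hε1
  have h1 := packingInfty_le_packingCutoff hφ hx hR hxR hε
  have h2 := packingCutoff_le_chi hψ htr hSD ht0 ht1.le hR.le
  have h3 : ε / 4 = r * t := by
    rw [ht]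
    field_simp
  have h4 : packingCutoff φ x R = packingCutoff ψ (fun i => ι (x i)) R := by
    funext ε
    simp only [packingCutoff, microstatesCutoff, microstates_comp ι hι]
  rw [h3, h4] at h1
  refine (h1.trans h2).trans_eq ?_
  rw [add_assoc, ← EReal.coe_add, abs_of_neg (Real.log_neg ht0 ht1)]
  congr 2
  ring

end Dimension

end FreeEntropy

end

open FreeEntropy in
theorem lemma2p2 {M : Type*} [CStarAlgebra M] (φ : M →ₗ[ℂ] ℂ) (hφ : IsTracialState φ)
    (n : ℕ) (x : Fin n → M) (hx : ∀ i, IsSelfAdjoint (x i)) :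
    (∀ (N : Type*) [CStarAlgebra N] (ψ : N →ₗ[ℂ] ℂ) (_ : IsTracialState ψ)
        (ι : M →⋆ₐ[ℂ] N) (_ : ∀ a, ψ (ι a) = φ a) (s : Fin n → N)
        (_ : IsSemicircularFamily ψ s) (_ : AreFree ψ (fun i => ι (x i)) s),
        delta₀ ψ (fun i => ι (x i)) s = limsupDivLog (packingInfty φ x)) ∧
      limsupDivLog (packingInfty φ x) = limsupDivLog (coveringInfty φ x) ∧
      limsupDivLog (coveringInfty φ x) = limsupDivLog (packing φ x) ∧
      limsupDivLog (packing φ x) = limsupDivLog (covering φ x) := by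
  have hpack := limsupDivLog_packingInfty hφ hx
  refine ⟨fun N _ ψ hψ ι hι s hs hfree => ?_, (limsupDivLog_coveringInfty φ x).symm,
    (limsupDivLog_coveringInfty φ x).trans hpack, (limsupDivLog_covering φ x).symm⟩
  have hSD := schwingerDyson_semicircular hψ.map_one hs hfree
  have hs2 : ∀ j, ψ (s j * s j) = 1 := fun j => by
    simpa [splitSum_cons, hψ.map_one] using hSD j [Sum.inr j]
  refine le_antisymm ?_ (limsupDivLog_packingInfty_le_delta₀ hφ hx (ι : M →ₐ[ℂ] N) hι hψ.map_one
    hψ.tracial hSD)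
  refine (delta₀_le_limsupDivLog_covering hψ.map_one hs2).trans_eq ?_
  have hcov : covering ψ (fun i => ι (x i)) = covering φ x := by
    funext ε
    have h := microstates_comp (ι : M →ₐ[ℂ] N) hι x
    simp only [StarAlgHom.coe_toAlgHom] at h
    simp only [covering, coveringCutoff, microstatesCutoff, h]
  rw [hcov, limsupDivLog_covering, hpack]
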